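/- Let $\mathbb K$ be an infinite field, $n,r\ge 0$ integers, and let $\Psi_n\subset\mathbb Z^n$ be the submonoid generated by the vectors $v_i-v_{i+1}$, $1\le i<n$, where $v_1,\dots,v_n$ is the standard basis of $\mathbb Z^n$. Let $\mathfrak A_n(\mathbb K)=\mathbb K\otimes_{\mathbb Z}\mathfrak A_n(\mathbb Z)$, where $\mathfrak A_n(\mathbb Z)$ is the Kostant form of the universal enveloping algebra of the Lie algebra $sl_n^+$ of strictly upper triangular complex $n\times n$ matrices, i.e. the subring generated by the divided powers $e_{ij}^{(k)}=e_{ij}^k/k!$, $i<j$, $k\ge 0$. It is $\Psi_n$-graded by $\deg e_{ij}^{(k)}=k(v_i-v_j)$. Let $\mathbb K_{\mathfrak A}$ be its trivial module ($e_{ij}^{(k)}$ acts as $0$ for $k>0$), placed in degree $0$. Let $B_n$ be the algebra of all functions $\mathbb Z^n\to\mathbb K$, with $\Psi_n$ acting by $b^\gamma(z)=b(\gamma+z)$. Let $\mathfrak C_n(\mathbb K)=\mathfrak A_n(\mathbb K)\ltimes_{\Psi_n}B_n$ be the vector space $\mathfrak A_n(\mathbb K)\otimes B_n$ with the product $(a\otimes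 b)(a'\otimes b')=aa'\otimes b^{\gamma}b'$ for $a'$ of degree $\gamma$. For a $\Psi_n$-graded $\mathfrak A_n(\mathbb K)$-module $M$ and a $B_n$-module $N$, let $M\ltimes_{\Psi_n}N$ be $M\otimes N$ with the $\mathfrak C_n(\mathbb K)$-action $(a\otimes b)(m\otimes x)=am\otimes b^\gamma x$ for $m$ of degree $\gamma$. Let $\Lambda(n,r)\subset\mathbb Z^n$ be the set of vectors with non-negative coordinates of sum $r$, and let $\mathfrak C_n(\Lambda(n,r))$ be the quotient of $\mathfrak C_n(\mathbb K)$ by the two-sided ideal generated by $1\otimes\bar\chi$, where $\bar\chi$ is the indicator function of $\mathbb Z^n\setminus\Lambda(n,r)$. These algebras and modules are $\Psi_n$-graded by the $\mathfrak A_n(\mathbb K)$-factor, resp. the $M$-factor. For $\lambda\in\Lambda(n,r)$ let $N_\lambda$ be the one-dimensional $B_n$-module on which $b$ acts as $b(\lambda)$. Put $$F_\lambda(M)=\mathfrak C_n(\Lambda(n,r))\otimes_{\mathfrak C_n(\mathbb K)}\left(M\ltimes_{\Psi_n}N_\lambda\right),$$ a functor on $\Psi_n$-graded $\mathfrak A_n(\mathbb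 K)$-modules. Let $V=\mathbb K^n$, with standard basis $u_1,\dots,u_n$. Let $S^+(n,r)\subset\operatorname{End}_{\mathbb K}(V^{\otimes r})$ be the linear span of the operators $g^{\otimes r}$, for $g\in GL_n(\mathbb K)$ upper triangular, and for $\lambda\in\Lambda(n,r)$ let $\mathbb K_\lambda$ be the one-dimensional $S^+(n,r)$-module on which $g^{\otimes r}$ acts as $\prod_i g_{ii}^{\lambda_i}$. A graded module is called graded free if it has a basis of homogeneous elements, and graded projective if it is a direct summand of a graded free module in the category of graded modules and degree-preserving homomorphisms. A graded projective resolution $\cdots\to P_1\to P_0\to M\to0$ over a graded algebra $A$ is minimal if $\operatorname{Im}(P_{i+1}\to P_i)\subset\operatorname{rad}(A)P_i$ for all $i\ge0$, where $\operatorname{rad}(A)$ is the intersection of the maximal graded left ideals. Ungraded minimal resolutions are defined in the same way with the Jacobson radical. **Theorem.** There is an isomorphism of algebras $\Phi\colon\mathfrak C_n(\Lambda(n,r))\to S^+(n,r)$ such that $\Phi$ maps the class of $e_{ij}^{(k)}\otimes1$ to the sum, over all $k$-element sets of tensor positions, of the operators that apply the matrix unit $E_{ij}$ at these positions, and $\Phi$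 maps the class of $1\otimes b$ to the operator that multiplies each basis vector $u_{f_1}\otimes\dots\otimes u_{f_r}$ of $V^{\otimes r}$ by $b(\mu)$, where $\mu_i=\#\{s: f_s=i\}$. Moreover, for each $\lambda\in\Lambda(n,r)$, with $\mathfrak C_n(\Lambda(n,r))$-modules regarded as $S^+(n,r)$-modules through $\Phi$: 1. $\mathbb K_\lambda$ is simple, $F_\lambda$ maps finitely generated $\Psi_n$-graded $\mathfrak A_n(\mathbb K)$-modules to finite-dimensional $S^+(n,r)$-modules, and there is an isomorphism $F_\lambda(\mathbb K_{\mathfrak A})\cong\mathbb K_\lambda$ of $S^+(n,r)$-modules. 2. If $P_\bullet$ is a $\Psi_n$-graded projective resolution of $\mathbb K_{\mathfrak A}$, then $F_\lambda(P_\bullet)$ is a $\Psi_n$-graded projective resolution of $F_\lambda(\mathbb K_{\mathfrak A})$ over $\mathfrak C_n(\Lambda(n,r))$, and (in the ungraded sense, with the isomorphism of 1.) a projective resolution of the $S^+(n,r)$-module $\mathbb K_\lambda$. 3. If $P_\bullet$ is minimal, then both resolutions in 2. are minimal. -/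

import Mathlib

open scoped DirectSum TensorProduct
open CategoryTheory

universe u

set_option linter.unusedSectionVars false

noncomputable section

namespace KostantSchur

section Graded

theorem isInternal_of_proj {K V Γ : Type*} [Field K] [AddCommGroup V] [Module K V] [DecidableEq Γ]
    (𝒱 : Γ → Submodule K V) (p : Γ → V →ₗ[K] V) (h1 : ∀ γ, ∀ v ∈ 𝒱 γ, p γ v = v)
    (h2 : ∀ γ γ', γ' ≠ γ → ∀ v ∈ 𝒱 γ', p γ v = 0) (h3 : ⨆ γ, 𝒱 γ = ⊤) :
    DirectSum.IsInternal 𝒱 := by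
  refine DirectSum.isInternal_submodule_of_iSupIndep_of_iSup_eq_top ?_ h3
  intro γ
  rw [Submodule.disjoint_def]
  intro v hv hv'
  have : (⨆ j, ⨆ (_ : j ≠ γ), 𝒱 j) ≤ LinearMap.ker (p γ) :=
    iSup₂_le fun j hj v hv => h2 γ j hj v hv
  rw [← h1 γ v hv]
  exact this hv'

variable {K : Type u} [Field K] {Γ : Type} [AddMonoid Γ] [DecidableEq Γ]
  {A : Type u} [Ring A] [Algebra K A]

/-- The projection of a graded vector space onto its component of degree `γ`. -/
def projDeg {V : Type*} [AddCommGroup V] [Module K V] (𝒱 : Γ → Submodule K V)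
    [DirectSum.Decomposition 𝒱] (γ : Γ) : V →ₗ[K] V :=
  (𝒱 γ).subtype ∘ₗ DirectSum.component K Γ (fun i => 𝒱 i) γ ∘ₗ
    (DirectSum.decomposeLinearEquiv 𝒱).toLinearMap

theorem projDeg_apply {V : Type*} [AddCommGroup V] [Module K V] (𝒱 : Γ → Submodule K V)
    [DirectSum.Decomposition 𝒱] (γ : Γ) (v : V) :
    projDeg 𝒱 γ v = (DirectSum.decompose 𝒱 v γ : V) := rfl

theorem projDeg_mem {V : Type*} [AddCommGroup V] [Module K V] (𝒱 : Γ → Submodule K V)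
    [DirectSum.Decomposition 𝒱] (γ : Γ) (v : V) : projDeg 𝒱 γ v ∈ 𝒱 γ := SetLike.coe_mem _

theorem projDeg_same {V : Type*} [AddCommGroup V] [Module K V] (𝒱 : Γ → Submodule K V)
    [DirectSum.Decomposition 𝒱] (γ : Γ) (v : V) (hv : v ∈ 𝒱 γ) : projDeg 𝒱 γ v = v := by
  rw [projDeg_apply, DirectSum.decompose_of_mem_same _ hv]

theorem projDeg_ne {V : Type*} [AddCommGroup V] [Module K V] (𝒱 : Γ → Submodule K V)
    [DirectSum.Decomposition 𝒱] (γ γ' : Γ) (h : γ' ≠ γ) (v : V) (hv : v ∈ 𝒱 γ') :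
    projDeg 𝒱 γ v = 0 := by
  rw [projDeg_apply, DirectSum.decompose_of_mem_ne _ hv h]

theorem iSup_deg {V : Type*} [AddCommGroup V] [Module K V] (𝒱 : Γ → Submodule K V)
    [DirectSum.Decomposition 𝒱] : ⨆ γ, 𝒱 γ = ⊤ :=
  (DirectSum.Decomposition.isInternal 𝒱).submodule_iSup_eq_top

/-- A left module over the `Γ`-graded `K`-algebra `A = ⨁ 𝒜 γ`, together with a `Γ`-grading. -/
structure GrMod (𝒜 : Γ → Submodule K A) where
  carrier : Type u
  [addCommGroup : AddCommGroup carrier]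
  [moduleK : Module K carrier]
  [moduleA : Module A carrier]
  [isScalarTower : IsScalarTower K A carrier]
  deg : Γ → Submodule K carrier
  [decomposition : DirectSum.Decomposition deg]
  [gradedSMul : SetLike.GradedSMul 𝒜 deg]

attribute [instance] GrMod.addCommGroup GrMod.moduleK GrMod.moduleA GrMod.isScalarTower
  GrMod.decomposition GrMod.gradedSMul

namespace GrMod

variable {𝒜 : Γ → Submodule K A}

instance : CoeSort (GrMod 𝒜) (Type u) := ⟨GrMod.carrier⟩

/-- Homomorphisms of graded modules: `A`-linear maps which preserve degrees. -/
@[ext] structure Hom (M N : GrMod 𝒜) where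
  lin : M →ₗ[A] N
  map_deg : ∀ γ, ∀ m ∈ M.deg γ, lin m ∈ N.deg γ

instance : Category (GrMod 𝒜) where
  Hom M N := Hom M N
  id M := ⟨LinearMap.id, fun _ _ h => h⟩
  comp f g := ⟨g.lin ∘ₗ f.lin, fun γ m h => g.map_deg γ _ (f.map_deg γ m h)⟩

@[ext] theorem hom_ext {M N : GrMod 𝒜} {f g : M ⟶ N} (h : f.lin = g.lin) : f = g := Hom.ext h

@[simp] theorem id_lin (M : GrMod 𝒜) : (𝟙 M : M ⟶ M).lin = LinearMap.id := rfl

@[simp] theorem comp_lin {M N P : GrMod 𝒜} (f : M ⟶ N) (g : N ⟶ P) :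
    (f ≫ g).lin = g.lin ∘ₗ f.lin := rfl

variable (𝒜) in
/-- The functor that forgets the grading. -/
def forgetGrading : GrMod 𝒜 ⥤ ModuleCat.{u} A where
  obj M := ModuleCat.of A M
  map f := ModuleCat.ofHom f.lin

/-- A graded module is free if it has an `A`-basis that consists of homogeneous elements. -/
def IsFree (F : GrMod 𝒜) : Prop :=
  ∃ (ι : Type u) (b : Module.Basis ι A F), ∀ i, ∃ γ, b i ∈ F.deg γ

/-- A graded module is projective if it is a direct summand, in the category of graded modules,
of a free graded module. -/
def IsProjective (P : GrMod 𝒜) : Prop :=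
  ∃ F : GrMod 𝒜, F.IsFree ∧ ∃ (i : P ⟶ F) (p : F ⟶ P), i ≫ p = 𝟙 P

/-- `⋯ → P 2 → P 1 → P 0 → M → 0` is a graded projective resolution of `M`. -/
structure IsProjRes (P : ℕ → GrMod 𝒜) (d : ∀ i, P (i + 1) ⟶ P i) {M : GrMod 𝒜}
    (ε : P 0 ⟶ M) : Prop where
  projective : ∀ i, (P i).IsProjective
  exact : ∀ i, Function.Exact (d (i + 1)).lin (d i).lin
  exact_zero : Function.Exact (d 0).lin ε.lin
  surjective : Function.Surjective ε.lin

end GrMod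

/-- The graded radical of a graded algebra: the intersection of all maximal graded left ideals. -/
def gradedRadical (𝒜 : Γ → Submodule K A) [GradedAlgebra 𝒜] : Ideal A :=
  sInf {m | Maximal (fun I : Ideal A => Submodule.IsHomogeneous I 𝒜 ∧ I ≠ ⊤) m}

/-- A graded projective resolution is minimal if `Im (P (i + 1) → P i) ⊆ rad(A) P i` for all `i`.
-/
structure GrMod.IsMinimalProjRes {𝒜 : Γ → Submodule K A} [GradedAlgebra 𝒜] (P : ℕ → GrMod 𝒜)
    (d : ∀ i, P (i + 1) ⟶ P i) {M : GrMod 𝒜} (ε : P 0 ⟶ M) : Prop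
    extends GrMod.IsProjRes P d ε where
  minimal : ∀ i, LinearMap.range (d i).lin ≤ gradedRadical 𝒜 • (⊤ : Submodule A (P i))

end Graded

section Ungraded

variable {R : Type u} [Ring R]

/-- `⋯ → P 2 → P 1 → P 0 → M → 0` is a projective resolution of the `R`-module `M`. -/
structure IsProjRes (P : ℕ → ModuleCat.{u} R) (d : ∀ i, P (i + 1) ⟶ P i) {M : ModuleCat.{u} R}
    (ε : P 0 ⟶ M) : Prop where
  projective : ∀ i, Module.Projective R (P i)
  exact : ∀ i, Function.Exact (d (i + 1)).hom (d i).hom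
  exact_zero : Function.Exact (d 0).hom ε.hom
  surjective : Function.Surjective ε.hom

/-- A projective resolution is minimal if `Im (P (i + 1) → P i) ⊆ Rad(R) P i` for all `i`, where
`Rad(R)` is the Jacobson radical. -/
structure IsMinimalProjRes (P : ℕ → ModuleCat.{u} R) (d : ∀ i, P (i + 1) ⟶ P i)
    {M : ModuleCat.{u} R} (ε : P 0 ⟶ M) : Prop extends IsProjRes P d ε where
  minimal : ∀ i, LinearMap.range (d i).hom ≤ Ring.jacobson R • (⊤ : Submodule R (P i))

end Ungraded

section Quotient

variable {K : Type u} [Field K] {Γ : Type} [AddMonoid Γ] [DecidableEq Γ]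
  {C : Type u} [Ring C] [Algebra K C] (𝒞 : Γ → Submodule K C) [GradedAlgebra 𝒞]
  (I : Ideal C) [I.IsTwoSided]

/-- The grading of a quotient algebra by the images of the homogeneous components. -/
def quotDeg (γ : Γ) : Submodule K (C ⧸ I) := (𝒞 γ).map (Ideal.Quotient.mkₐ K I).toLinearMap

theorem mk_mem_quotDeg {γ : Γ} {c : C} (hc : c ∈ 𝒞 γ) :
    (Ideal.Quotient.mk I c) ∈ quotDeg 𝒞 I γ := ⟨c, hc, rfl⟩

theorem quotDeg_isInternal (hI : Submodule.IsHomogeneous I 𝒞) :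
    DirectSum.IsInternal (quotDeg 𝒞 I) := by
  refine isInternal_of_proj (quotDeg 𝒞 I)
    (fun γ => Submodule.mapQ (I.restrictScalars K) (I.restrictScalars K) (projDeg 𝒞 γ)
      (fun c hc => hI γ hc)) ?_ ?_ ?_
  · rintro γ _ ⟨c, hc, rfl⟩
    exact congrArg (Ideal.Quotient.mk I) (projDeg_same 𝒞 γ c hc)
  · rintro γ γ' h _ ⟨c, hc, rfl⟩
    exact (congrArg (Ideal.Quotient.mk I) (projDeg_ne 𝒞 γ γ' h c hc)).trans (map_zero _)
  · unfold quotDeg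
    rw [← Submodule.map_iSup, iSup_deg, Submodule.map_top, LinearMap.range_eq_top]
    exact Ideal.Quotient.mk_surjective

theorem quotDeg_gradedMonoid : SetLike.GradedMonoid (quotDeg 𝒞 I) where
  one_mem := ⟨1, SetLike.GradedOne.one_mem, rfl⟩
  mul_mem := by
    rintro γ γ' _ _ ⟨c, hc, rfl⟩ ⟨c', hc', rfl⟩
    exact ⟨c * c', SetLike.GradedMul.mul_mem hc hc', map_mul (Ideal.Quotient.mk I) _ _⟩

/-- A quotient of a graded algebra by a homogeneous two-sided ideal is a graded algebra. -/
@[reducible] def quotGradedAlgebra (hI : Submodule.IsHomogeneous I 𝒞) :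
    GradedAlgebra (quotDeg 𝒞 I) :=
  { quotDeg_gradedMonoid 𝒞 I, (quotDeg_isInternal 𝒞 I hI).chooseDecomposition with }

section Tensor

variable (Q : Type u) [AddCommGroup Q] [Module K Q] [Module C Q] [IsScalarTower K C Q]

/-- The relations `x c ⊗ q = x ⊗ c q` that cut `(C ⧸ I) ⊗_C Q` out of `(C ⧸ I) ⊗_K Q`. -/
def tensorRel : Submodule (C ⧸ I) ((C ⧸ I) ⊗[K] Q) :=
  Submodule.span (C ⧸ I)
    {t | ∃ (x : C ⧸ I) (c : C) (q : Q), t = (x * Ideal.Quotient.mk I c) ⊗ₜ q - x ⊗ₜ (c • q)}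

variable (K) in
/-- The left `C ⧸ I`-module `(C ⧸ I) ⊗_C Q`, the tensor product over the noncommutative algebra `C`
of the `(C ⧸ I)`-`C`-bimodule `C ⧸ I` with the left `C`-module `Q`. -/
abbrev QuotTensor : Type u := ((C ⧸ I) ⊗[K] Q) ⧸ tensorRel (K := K) I Q

variable {Q} in
variable (K) in
/-- The class of `x ⊗ q` in `(C ⧸ I) ⊗_C Q`. -/
def qtmul (x : C ⧸ I) (q : Q) : QuotTensor K I Q := (tensorRel (K := K) I Q).mkQ (x ⊗ₜ[K] q)

variable {Q}

theorem qtmul_mul (x : C ⧸ I) (c : C) (q : Q) :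
    qtmul K I (x * Ideal.Quotient.mk I c) q = qtmul K I x (c • q) := by
  unfold qtmul
  rw [← sub_eq_zero, ← map_sub, Submodule.mkQ_apply, Submodule.Quotient.mk_eq_zero]
  exact Submodule.subset_span ⟨x, c, q, rfl⟩

theorem qtmul_mk (c : C) (q : Q) : qtmul K I (Ideal.Quotient.mk I c) q = qtmul K I 1 (c • q) := by
  rw [← qtmul_mul, one_mul]

theorem smul_qtmul (y x : C ⧸ I) (q : Q) : y • qtmul K I x q = qtmul K I (y * x) q := by
  unfold qtmul
  rw [← map_smul, TensorProduct.smul_tmul', smul_eq_mul]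

variable (K) in
/-- The map `q ↦ 1 ⊗ q`. -/
def oneTmul : Q →ₗ[K] QuotTensor K I Q where
  toFun q := qtmul K I 1 q
  map_add' q q' := by unfold qtmul; rw [TensorProduct.tmul_add, map_add]
  map_smul' k q := by
    unfold qtmul
    rw [RingHom.id_apply, TensorProduct.tmul_smul]
    rfl

theorem oneTmul_surjective : Function.Surjective (oneTmul K I (Q := Q)) := by
  rw [← LinearMap.range_eq_top, eq_top_iff]
  rintro t -
  obtain ⟨t, rfl⟩ := Submodule.mkQ_surjective _ t
  induction t using TensorProduct.induction_on with
  | zero => rw [map_zero]; exact zero_mem _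
  | tmul x q =>
    obtain ⟨c, rfl⟩ := Ideal.Quotient.mk_surjective x
    exact ⟨c • q, (qtmul_mk I c q).symm⟩
  | add x y hx hy => rw [map_add]; exact add_mem hx hy

theorem oneTmul_smul_eq_zero {c : C} (hc : c ∈ I) (q : Q) : oneTmul K I (c • q) = 0 := by
  change qtmul K I 1 (c • q) = 0
  rw [← qtmul_mk, Ideal.Quotient.eq_zero_iff_mem.2 hc]
  unfold qtmul
  rw [TensorProduct.zero_tmul, map_zero]

/-- `(C ⧸ I) ⊗_C f`. -/
def quotTensorMap {Q' : Type u} [AddCommGroup Q'] [Module K Q'] [Module C Q'] [IsScalarTower K C Q']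
    (f : Q →ₗ[C] Q') : QuotTensor K I Q →ₗ[C ⧸ I] QuotTensor K I Q' :=
  Submodule.mapQ _ _
    (TensorProduct.AlgebraTensorModule.map (LinearMap.id : (C ⧸ I) →ₗ[C ⧸ I] (C ⧸ I))
      (f.restrictScalars K)) (by
      unfold tensorRel
      rw [Submodule.span_le]
      rintro _ ⟨x, c, q, rfl⟩
      refine Submodule.subset_span ⟨x, c, f q, ?_⟩
      simp)

theorem quotTensorMap_qtmul {Q' : Type u} [AddCommGroup Q'] [Module K Q'] [Module C Q']
    [IsScalarTower K C Q'] (f : Q →ₗ[C] Q') (x : C ⧸ I) (q : Q) :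
    quotTensorMap (K := K) I f (qtmul K I x q) = qtmul K I x (f q) := rfl

theorem quotTensor_hom_ext {X : Type*} [AddCommGroup X] [Module (C ⧸ I) X]
    {f g : QuotTensor K I Q →ₗ[C ⧸ I] X} (h : ∀ q, f (qtmul K I 1 q) = g (qtmul K I 1 q)) :
    f = g := by
  refine LinearMap.ext fun t => ?_
  obtain ⟨q, rfl⟩ := oneTmul_surjective (K := K) I t
  exact h q

/-- The grading of `(C ⧸ I) ⊗_C Q`: the component of degree `γ` consists of the `1 ⊗ q` with `q`
of degree `γ`. As `c ⊗ q = 1 ⊗ c q`, this is the usual total degree. -/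
def quotTensorDeg (𝒬 : Γ → Submodule K Q) (γ : Γ) : Submodule K (QuotTensor K I Q) :=
  (𝒬 γ).map (oneTmul K I)

variable (𝒬 : Γ → Submodule K Q) [DirectSum.Decomposition 𝒬] [SetLike.GradedSMul 𝒞 𝒬]

theorem projDeg_smul_mem (hI : Submodule.IsHomogeneous I 𝒞) {c : C} (hc : c ∈ I) (q : Q) (γ : Γ) :
    oneTmul K I (projDeg 𝒬 γ (c • q)) = 0 := by
  classical
  have hq : q ∈ ⨆ γ, 𝒬 γ := by rw [iSup_deg]; trivial
  induction hq using Submodule.iSup_induction' with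
  | zero => simp
  | add x y _ _ hx hy => rw [smul_add, map_add, map_add, hx, hy, add_zero]
  | mem β q hq =>
    rw [← DirectSum.sum_support_decompose 𝒞 c, Finset.sum_smul, map_sum, map_sum]
    refine Finset.sum_eq_zero fun α _ => ?_
    have hm : (DirectSum.decompose 𝒞 c α : C) • q ∈ 𝒬 (α +ᵥ β) :=
      SetLike.GradedSMul.smul_mem (SetLike.coe_mem _) hq
    by_cases h : α +ᵥ β = γ
    · subst h
      rw [projDeg_same _ _ _ hm]
      exact oneTmul_smul_eq_zero I (hI α hc) q
    · rw [projDeg_ne _ _ _ h _ hm, map_zero]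

/-- The projections onto the homogeneous components of `(C ⧸ I) ⊗_C Q`. -/
def quotTensorProj (hI : Submodule.IsHomogeneous I 𝒞) (γ : Γ) :
    QuotTensor K I Q →ₗ[K] QuotTensor K I Q :=
  let f : C →ₗ[K] Q →ₗ[K] QuotTensor K I Q :=
    LinearMap.mk₂ K (fun c q => oneTmul K I (projDeg 𝒬 γ (c • q)))
      (fun c c' q => by rw [add_smul, map_add, map_add])
      (fun k c q => by rw [smul_assoc, map_smul, map_smul])
      (fun c q q' => by rw [smul_add, map_add, map_add])
      (fun k c q => by rw [smul_comm, map_smul, map_smul])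
  let g : ((C ⧸ I) ⊗[K] Q) →ₗ[K] QuotTensor K I Q :=
    TensorProduct.lift (Submodule.liftQ (I.restrictScalars K) f (fun c hc => by
      ext q
      exact projDeg_smul_mem 𝒞 I 𝒬 hI hc q γ) : (C ⧸ I) →ₗ[K] Q →ₗ[K] QuotTensor K I Q)
  Submodule.liftQ ((tensorRel (K := K) I Q).restrictScalars K) g (by
    intro t ht
    have key : ∀ y : C ⧸ I, g (y • t) = 0 := by
      refine Submodule.span_induction (p := fun t _ => ∀ y : C ⧸ I, g (y • t) = 0)
        ?_ ?_ ?_ ?_ (show t ∈ tensorRel (K := K) I Q from ht)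
      · rintro _ ⟨x, c, q, rfl⟩ y
        obtain ⟨b, rfl⟩ := Ideal.Quotient.mk_surjective x
        obtain ⟨a, rfl⟩ := Ideal.Quotient.mk_surjective y
        rw [smul_sub, TensorProduct.smul_tmul', TensorProduct.smul_tmul', map_sub, sub_eq_zero]
        change oneTmul K I (projDeg 𝒬 γ ((a * (b * c)) • q)) =
          oneTmul K I (projDeg 𝒬 γ ((a * b) • (c • q)))
        rw [← mul_smul, mul_assoc]
      · intro y
        rw [smul_zero, map_zero]
      · intro t t' _ _ h h' y
        rw [smul_add, map_add, h, h', add_zero]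
      · intro x t _ h y
        rw [← mul_smul, h]
    simpa using key 1)

theorem quotTensorProj_oneTmul (hI : Submodule.IsHomogeneous I 𝒞) (γ : Γ) (q : Q) :
    quotTensorProj 𝒞 I 𝒬 hI γ (oneTmul K I q) = oneTmul K I (projDeg 𝒬 γ q) := by
  change oneTmul K I (projDeg 𝒬 γ ((1 : C) • q)) = _
  rw [one_smul]

theorem quotTensorDeg_isInternal (hI : Submodule.IsHomogeneous I 𝒞) :
    DirectSum.IsInternal (quotTensorDeg I 𝒬) := by
  refine isInternal_of_proj _ (quotTensorProj 𝒞 I 𝒬 hI) ?_ ?_ ?_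
  · rintro γ _ ⟨q, hq, rfl⟩
    rw [quotTensorProj_oneTmul, projDeg_same _ _ _ hq]
  · rintro γ γ' h _ ⟨q, hq, rfl⟩
    rw [quotTensorProj_oneTmul, projDeg_ne _ _ _ h _ hq, map_zero]
  · unfold quotTensorDeg
    rw [← Submodule.map_iSup, iSup_deg, Submodule.map_top, LinearMap.range_eq_top]
    exact oneTmul_surjective I

theorem quotTensorDeg_gradedSMul :
    SetLike.GradedSMul (quotDeg 𝒞 I) (quotTensorDeg I 𝒬) where
  smul_mem := by
    rintro γ γ' _ _ ⟨c, hc, rfl⟩ ⟨q, hq, rfl⟩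
    refine ⟨c • q, SetLike.GradedSMul.smul_mem hc hq, ?_⟩
    change qtmul K I 1 (c • q) = (Ideal.Quotient.mk I c) • qtmul K I 1 q
    rw [smul_qtmul, mul_one, qtmul_mk]

end Tensor

/-- The functor `(C ⧸ I) ⊗_C -` from graded `C`-modules to graded `C ⧸ I`-modules. -/
def quotTensorFunctor (hI : Submodule.IsHomogeneous I 𝒞) : GrMod 𝒞 ⥤ GrMod (quotDeg 𝒞 I) where
  obj Q :=
    { carrier := QuotTensor K I Q
      deg := quotTensorDeg I Q.deg
      decomposition := (quotTensorDeg_isInternal 𝒞 I Q.deg hI).chooseDecomposition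
      gradedSMul := quotTensorDeg_gradedSMul 𝒞 I Q.deg }
  map {Q Q'} f :=
    { lin := quotTensorMap I f.lin
      map_deg := by
        rintro γ _ ⟨q, hq, rfl⟩
        exact ⟨f.lin q, f.map_deg γ q hq, rfl⟩ }
  map_id Q := GrMod.hom_ext (quotTensor_hom_ext (K := K) I fun _ => rfl)
  map_comp f g := GrMod.hom_ext (quotTensor_hom_ext (K := K) I fun _ => rfl)

end Quotient
section Skew

variable {K : Type u} [Field K] {Γ : Type} [AddMonoid Γ] [DecidableEq Γ]
  {A : Type u} [Ring A] [Algebra K A] (𝒜 : Γ → Submodule K A)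
  (S : Type) [AddAction Γ S]

/-- The right action of `Γ` on the algebra of functions on a `Γ`-set: `(b ^ γ) x = b (γ x)`. -/
def shift {S : Type} [AddAction Γ S] (γ : Γ) : (S → K) →ₐ[K] (S → K) where
  toFun b x := b (γ +ᵥ x)
  map_one' := rfl
  map_mul' _ _ := rfl
  map_zero' := rfl
  map_add' _ _ := rfl
  commutes' _ := rfl

variable {S} in
theorem shift_apply (γ : Γ) (b : S → K) (x : S) : shift γ b x = b (γ +ᵥ x) := rfl

variable {S} in
theorem shift_zero (b : S → K) : shift (0 : Γ) b = b := by
  funext x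
  rw [shift_apply, zero_vadd]

variable {S} in
theorem shift_shift (γ γ' : Γ) (b : S → K) : shift γ' (shift γ b) = shift (γ + γ') b := by
  funext x
  simp only [shift_apply, add_vadd]

section Act

variable {M : Type u} [AddCommGroup M] [Module K M] [Module A M] [IsScalarTower K A M]
  (ℳ : Γ → Submodule K M) [DirectSum.Decomposition ℳ]
  (N : Type u) [AddCommGroup N] [Module K N] [Module (S → K) N] [IsScalarTower K (S → K) N]

/-- For `m` of degree `γ`: the bilinear map `(b, n) ↦ m ⊗ b ^ γ n`. -/
def twistDeg (γ : Γ) : ℳ γ →ₗ[K] (S → K) →ₗ[K] N →ₗ[K] M ⊗[K] N where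
  toFun m := LinearMap.mk₂ K (fun b n => (m : M) ⊗ₜ[K] (shift γ b • n))
    (fun b b' n => by rw [map_add, add_smul, TensorProduct.tmul_add])
    (fun k b n => by rw [map_smul, smul_assoc, TensorProduct.tmul_smul])
    (fun b n n' => by rw [smul_add, TensorProduct.tmul_add])
    (fun k b n => by rw [smul_comm, TensorProduct.tmul_smul])
  map_add' m m' := by
    ext b n
    exact TensorProduct.add_tmul (m : M) (m' : M) _
  map_smul' k m := by
    ext b n
    exact (TensorProduct.smul_tmul' k (m : M) _).symm

/-- The map `m ↦ b ↦ n ↦ ∑ γ, m_γ ⊗ b ^ γ n`. -/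
def twist : M →ₗ[K] (S → K) →ₗ[K] N →ₗ[K] M ⊗[K] N :=
  DirectSum.toModule K Γ _ (twistDeg S ℳ N) ∘ₗ (DirectSum.decomposeLinearEquiv ℳ).toLinearMap

theorem twist_apply {γ : Γ} {m : M} (hm : m ∈ ℳ γ) (b : S → K) (n : N) :
    twist S ℳ N m b n = m ⊗ₜ (shift γ b • n) := by
  have : DirectSum.decompose ℳ m = DirectSum.of (fun i => ℳ i) γ ⟨m, hm⟩ :=
    DirectSum.decompose_of_mem ℳ hm
  change DirectSum.toModule K Γ _ (twistDeg S ℳ N) (DirectSum.decompose ℳ m) b n = _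
  rw [this]
  erw [DirectSum.toModule_lof]
  rfl

/-- The bilinear map `(a ⊗ b, m ⊗ n) ↦ a m ⊗ b ^ γ n`, for `m` of degree `γ`. -/
def skewAct : (A ⊗[K] (S → K)) →ₗ[K] (M ⊗[K] N) →ₗ[K] (M ⊗[K] N) :=
  TensorProduct.lift (LinearMap.mk₂ K
    (fun (a : A) (b : S → K) =>
      LinearMap.rTensor N (Algebra.lsmul K K M a) ∘ₗ TensorProduct.lift ((twist S ℳ N).flip b))
    (fun a a' b => by rw [map_add, LinearMap.rTensor_add, LinearMap.add_comp])
    (fun k a b => by rw [map_smul, LinearMap.rTensor_smul, LinearMap.smul_comp])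
    (fun a b b' => by rw [map_add]; exact TensorProduct.ext' fun m n => by simp)
    (fun k a b => by rw [map_smul]; exact TensorProduct.ext' fun m n => by simp))

variable {S N} in
theorem skewAct_tmul {γ : Γ} {m : M} (hm : m ∈ ℳ γ) (a : A) (b : S → K) (n : N) :
    skewAct S ℳ N (a ⊗ₜ b) (m ⊗ₜ n) = (a • m) ⊗ₜ (shift γ b • n) := by
  simp only [skewAct, TensorProduct.lift.tmul, LinearMap.mk₂_apply, LinearMap.comp_apply,
    LinearMap.flip_apply, twist_apply S ℳ N hm, LinearMap.rTensor_tmul, Algebra.lsmul_coe]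

variable {N} in
theorem tensor_induction {p : M ⊗[K] N → Prop} (t : M ⊗[K] N) (h0 : p 0)
    (hadd : ∀ x y, p x → p y → p (x + y)) (h : ∀ γ, ∀ m ∈ ℳ γ, ∀ n, p (m ⊗ₜ n)) : p t := by
  induction t using TensorProduct.induction_on with
  | zero => exact h0
  | add x y hx hy => exact hadd x y hx hy
  | tmul m n =>
    have hm : m ∈ ⨆ γ, ℳ γ := by rw [iSup_deg]; trivial
    induction hm using Submodule.iSup_induction' with
    | zero => rw [TensorProduct.zero_tmul]; exact h0
    | add x y _ _ hx hy => rw [TensorProduct.add_tmul]; exact hadd _ _ hx hy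
    | mem γ m hm => exact h γ m hm n

variable [GradedAlgebra 𝒜] [SetLike.GradedSMul 𝒜 ℳ]

theorem skewAct_skewAct (x y : A ⊗[K] (S → K)) (t : M ⊗[K] N) :
    skewAct S ℳ N (skewAct S 𝒜 (S → K) x y) t = skewAct S ℳ N x (skewAct S ℳ N y t) := by
  induction x using TensorProduct.induction_on with
  | zero => simp
  | add x x' hx hx' => simp [hx, hx']
  | tmul a b =>
    refine tensor_induction (p := fun y => skewAct S ℳ N (skewAct S 𝒜 (S → K) (a ⊗ₜ b) y) t =
      skewAct S ℳ N (a ⊗ₜ b) (skewAct S ℳ N y t)) 𝒜 y (by simp) (fun y y' h h' => by simp only [map_add, LinearMap.add_apply, h, h']) ?_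
    intro γ a' ha' b'
    refine tensor_induction
      (p := fun t => skewAct S ℳ N (skewAct S 𝒜 (S → K) (a ⊗ₜ b) (a' ⊗ₜ b')) t =
        skewAct S ℳ N (a ⊗ₜ b) (skewAct S ℳ N (a' ⊗ₜ b') t)) ℳ t
      (by simp) (fun y y' h h' => by simp only [map_add, h, h']) ?_
    intro γ' m hm n
    rw [skewAct_tmul 𝒜 ha', skewAct_tmul ℳ hm, skewAct_tmul ℳ hm,
      skewAct_tmul ℳ (γ := γ + γ') (SetLike.GradedSMul.smul_mem ha' hm)]
    rw [smul_eq_mul, smul_eq_mul, mul_smul, map_mul, shift_shift, mul_smul]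

theorem skewAct_one (t : M ⊗[K] N) : skewAct S ℳ N ((1 : A) ⊗ₜ[K] (1 : S → K)) t = t := by
  refine tensor_induction (p := fun t => skewAct S ℳ N ((1 : A) ⊗ₜ[K] (1 : S → K)) t = t) ℳ t
    (by simp) (fun y y' h h' => by rw [map_add, h, h']) ?_
  intro γ m hm n
  rw [skewAct_tmul ℳ hm, map_one, one_smul, one_smul]

end Act

/-- The skew product `A ⋉ B` of the graded algebra `A` with the algebra `B` of all functions on
the `Γ`-set `S`: the vector space `A ⊗ B` with `(a ⊗ b) (a' ⊗ b') = a a' ⊗ b ^ γ b'` for `a'` of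
degree `γ`. -/
@[nolint unusedArguments]
def SkewProduct (_𝒜 : Γ → Submodule K A) (S : Type) [AddAction Γ S] : Type u := A ⊗[K] (S → K)

namespace SkewProduct

instance : AddCommGroup (SkewProduct 𝒜 S) := inferInstanceAs (AddCommGroup (A ⊗[K] (S → K)))
instance : Module K (SkewProduct 𝒜 S) := inferInstanceAs (Module K (A ⊗[K] (S → K)))

variable {S}

/-- The element `a ⊗ b` of the skew product. -/
def tmul (a : A) (b : S → K) : SkewProduct 𝒜 S := (a ⊗ₜ[K] b : A ⊗[K] (S → K))

variable [GradedAlgebra 𝒜]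

instance : Mul (SkewProduct 𝒜 S) := ⟨fun x y => skewAct S 𝒜 (S → K) x y⟩
instance : One (SkewProduct 𝒜 S) := ⟨tmul 𝒜 1 1⟩

theorem mul_def (x y : SkewProduct 𝒜 S) : x * y = skewAct S 𝒜 (S → K) x y := rfl

theorem one_def : (1 : SkewProduct 𝒜 S) = tmul 𝒜 1 1 := rfl

theorem tmul_mul_tmul {γ : Γ} {a' : A} (ha' : a' ∈ 𝒜 γ) (a : A) (b b' : S → K) :
    tmul 𝒜 a b * tmul 𝒜 a' b' = tmul 𝒜 (a * a') (shift γ b * b') :=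
  skewAct_tmul 𝒜 ha' a b b'

instance : Ring (SkewProduct 𝒜 S) :=
  { (inferInstance : AddCommGroup (SkewProduct 𝒜 S)) with
    mul := (· * ·)
    one := 1
    left_distrib := fun x y z => (skewAct S 𝒜 (S → K) x).map_add y z
    right_distrib := fun x y z => (skewAct S 𝒜 (S → K)).map_add₂ x y z
    zero_mul := fun x => (skewAct S 𝒜 (S → K)).map_zero₂ x
    mul_zero := fun x => (skewAct S 𝒜 (S → K) x).map_zero
    mul_assoc := fun x y z => skewAct_skewAct 𝒜 S 𝒜 (S → K) x y z
    one_mul := fun x => skewAct_one S 𝒜 (S → K) x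
    mul_one := fun x => by
      change skewAct S 𝒜 (S → K) x ((1 : A) ⊗ₜ[K] (1 : S → K)) = x
      induction x using TensorProduct.induction_on with
      | zero => simp
      | add x y hx hy => rw [map_add, LinearMap.add_apply, hx, hy]
      | tmul a b =>
        rw [skewAct_tmul 𝒜 SetLike.GradedOne.one_mem, shift_zero, smul_eq_mul, smul_eq_mul,
          mul_one, mul_one] }

instance : Algebra K (SkewProduct 𝒜 S) :=
  Algebra.ofModule
    (fun k x y => (skewAct S 𝒜 (S → K)).map_smul₂ k x y)
    (fun k x y => (skewAct S 𝒜 (S → K) x).map_smul k y)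

end SkewProduct

section SkewModule

variable {M : Type u} [AddCommGroup M] [Module K M] [Module A M] [IsScalarTower K A M]
  (ℳ : Γ → Submodule K M)
  (N : Type u) [AddCommGroup N] [Module K N]

/-- The component `M_γ ⊗ N` of `M ⋉ N`. -/
def skewModuleDeg (γ : Γ) : Submodule K (M ⊗[K] N) :=
  LinearMap.range (LinearMap.rTensor N (ℳ γ).subtype)

theorem skewModuleDeg_le {γ : Γ} {p : Submodule K (M ⊗[K] N)} (h : ∀ m ∈ ℳ γ, ∀ n, m ⊗ₜ n ∈ p) :
    skewModuleDeg ℳ N γ ≤ p := by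
  rintro _ ⟨t, rfl⟩
  induction t using TensorProduct.induction_on with
  | zero => rw [map_zero]; exact p.zero_mem
  | add x y hx hy => rw [map_add]; exact p.add_mem hx hy
  | tmul m n => exact h m m.2 n

theorem tmul_mem_skewModuleDeg {γ : Γ} {m : M} (hm : m ∈ ℳ γ) (n : N) :
    (m ⊗ₜ[K] n : M ⊗[K] N) ∈ skewModuleDeg ℳ N γ := ⟨(⟨m, hm⟩ : ℳ γ) ⊗ₜ n, rfl⟩

variable [DirectSum.Decomposition ℳ]

theorem skewModuleDeg_isInternal : DirectSum.IsInternal (skewModuleDeg ℳ N) := by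
  refine isInternal_of_proj (K := K) (V := M ⊗[K] N) (skewModuleDeg ℳ N)
    (fun γ => LinearMap.rTensor N (projDeg ℳ γ)) ?_ ?_ ?_
  · intro γ v hv
    refine skewModuleDeg_le ℳ N
      (p := LinearMap.eqLocus (LinearMap.rTensor N (projDeg ℳ γ)) LinearMap.id) ?_ hv
    intro m hm n
    rw [LinearMap.mem_eqLocus, LinearMap.rTensor_tmul, projDeg_same _ _ _ hm]
    rfl
  · intro γ γ' h v hv
    refine skewModuleDeg_le ℳ N
      (p := LinearMap.ker (LinearMap.rTensor N (projDeg ℳ γ))) ?_ hv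
    intro m hm n
    rw [LinearMap.mem_ker, LinearMap.rTensor_tmul, projDeg_ne _ _ _ h _ hm,
      TensorProduct.zero_tmul]
  · rw [eq_top_iff]
    rintro t -
    refine tensor_induction ℳ (p := fun t => t ∈ ⨆ γ, skewModuleDeg ℳ N γ) t
      (Submodule.zero_mem _) (fun x y hx hy => Submodule.add_mem _ hx hy) ?_
    intro γ m hm n
    exact Submodule.mem_iSup_of_mem γ (tmul_mem_skewModuleDeg ℳ N hm n)

instance : DirectSum.Decomposition (skewModuleDeg ℳ N) :=
  (skewModuleDeg_isInternal ℳ N).chooseDecomposition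

variable [GradedAlgebra 𝒜] [SetLike.GradedSMul 𝒜 ℳ]
  [Module (S → K) N] [IsScalarTower K (S → K) N]

/-- The module `M ⋉ N` over the skew product `A ⋉ B`: the vector space `M ⊗ N` with
`(a ⊗ b) (m ⊗ n) = a m ⊗ b ^ γ n` for `m` of degree `γ`. -/
@[reducible] def skewModuleModule : Module (SkewProduct 𝒜 S) (M ⊗[K] N) where
  smul x t := skewAct S ℳ N x t
  one_smul t := skewAct_one S ℳ N t
  mul_smul x y t := skewAct_skewAct 𝒜 S ℳ N x y t
  smul_zero x := (skewAct S ℳ N x).map_zero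
  smul_add x t t' := (skewAct S ℳ N x).map_add t t'
  add_smul x y t := (skewAct S ℳ N).map_add₂ x y t
  zero_smul t := (skewAct S ℳ N).map_zero₂ t

end SkewModule

/-- The grading of the skew product: the component of degree `γ` is `A_γ ⊗ B`. -/
def skewDeg (γ : Γ) : Submodule K (SkewProduct 𝒜 S) := skewModuleDeg 𝒜 (S → K) γ

variable [GradedAlgebra 𝒜]

section

variable {M : Type u} [AddCommGroup M] [Module K M] [Module A M] [IsScalarTower K A M]
  (ℳ : Γ → Submodule K M) [DirectSum.Decomposition ℳ] [SetLike.GradedSMul 𝒜 ℳ]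
  (N : Type u) [AddCommGroup N] [Module K N] [Module (S → K) N] [IsScalarTower K (S → K) N]

theorem skewAct_mem {γ γ' : Γ} {x : A ⊗[K] (S → K)} (hx : x ∈ skewDeg 𝒜 S γ) {t : M ⊗[K] N}
    (ht : t ∈ skewModuleDeg ℳ N γ') : skewAct S ℳ N x t ∈ skewModuleDeg ℳ N (γ + γ') := by
  refine skewModuleDeg_le 𝒜 (S → K)
    (p := (skewModuleDeg ℳ N (γ + γ') : Submodule K (M ⊗[K] N)).comap
      ((skewAct S ℳ N).flip t)) ?_ hx
  intro a ha b
  refine skewModuleDeg_le ℳ N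
    (p := (skewModuleDeg ℳ N (γ + γ') : Submodule K (M ⊗[K] N)).comap
      (skewAct S ℳ N (a ⊗ₜ b))) ?_ ht
  intro m hm n
  rw [Submodule.mem_comap, skewAct_tmul ℳ hm]
  exact tmul_mem_skewModuleDeg ℳ N (SetLike.GradedSMul.smul_mem ha hm) _

end

instance : GradedAlgebra (skewDeg 𝒜 S) :=
  { one_mem := tmul_mem_skewModuleDeg 𝒜 (S → K) SetLike.GradedOne.one_mem 1
    mul_mem := fun {_ _ _ _} hx hy => skewAct_mem 𝒜 S 𝒜 (S → K) hx hy
    toDecomposition := (skewModuleDeg_isInternal 𝒜 (S → K)).chooseDecomposition }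

theorem skewAct_map (N : Type u) [AddCommGroup N] [Module K N] [Module (S → K) N]
    [IsScalarTower K (S → K) N] {M M' : GrMod 𝒜} (f : M ⟶ M') (x : A ⊗[K] (S → K))
    (t : M ⊗[K] N) :
    LinearMap.rTensor N (f.lin.restrictScalars K) (skewAct S M.deg N x t) =
      skewAct S M'.deg N x (LinearMap.rTensor N (f.lin.restrictScalars K) t) := by
  induction x using TensorProduct.induction_on with
  | zero => simp
  | add x y hx hy => simp only [map_add, LinearMap.add_apply, hx, hy]
  | tmul a b =>
    refine tensor_induction (p := fun t =>
      LinearMap.rTensor N (f.lin.restrictScalars K) (skewAct S M.deg N (a ⊗ₜ b) t) =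
        skewAct S M'.deg N (a ⊗ₜ b) (LinearMap.rTensor N (f.lin.restrictScalars K) t)) M.deg t
      (by simp) (fun x y hx hy => by simp only [map_add, hx, hy]) ?_
    intro γ m hm n
    rw [skewAct_tmul M.deg hm, LinearMap.rTensor_tmul, LinearMap.rTensor_tmul,
      LinearMap.restrictScalars_apply, LinearMap.restrictScalars_apply,
      skewAct_tmul M'.deg (f.map_deg γ m hm), map_smul]

/-- The graded `A ⋉ B`-module `M ⋉ N`. -/
def skewObj (N : Type u) [AddCommGroup N] [Module K N] [Module (S → K) N]
    [IsScalarTower K (S → K) N] (M : GrMod 𝒜) : GrMod (skewDeg 𝒜 S) where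
  carrier := M ⊗[K] N
  moduleA := skewModuleModule 𝒜 S M.deg N
  isScalarTower := by
    let := skewModuleModule 𝒜 S M.deg N
    exact ⟨fun k x t => (skewAct S M.deg N).map_smul₂ k x t⟩
  deg := skewModuleDeg M.deg N
  gradedSMul := by
    let := skewModuleModule 𝒜 S M.deg N
    exact ⟨fun {_ _ _ _} hx ht => skewAct_mem 𝒜 S M.deg N hx ht⟩

/-- The functor `- ⋉ N` from graded `A`-modules to graded `A ⋉ B`-modules. -/
def skewFunctor (N : Type u) [AddCommGroup N] [Module K N] [Module (S → K) N]
    [IsScalarTower K (S → K) N] : GrMod 𝒜 ⥤ GrMod (skewDeg 𝒜 S) where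
  obj M := skewObj 𝒜 S N M
  map {M M'} f :=
    { lin :=
        { toFun := LinearMap.rTensor N (f.lin.restrictScalars K)
          map_add' := map_add _
          map_smul' := fun x t => skewAct_map 𝒜 S N f x t }
      map_deg := fun γ t ht => by
        refine skewModuleDeg_le M.deg N
          (p := (skewModuleDeg M'.deg N γ : Submodule K (M' ⊗[K] N)).comap
            (LinearMap.rTensor N (f.lin.restrictScalars K))) ?_ ht
        intro m hm n
        exact tmul_mem_skewModuleDeg M'.deg N (f.map_deg γ m hm) n }
  map_id M := GrMod.hom_ext (LinearMap.ext fun t => LinearMap.rTensor_id_apply N M t)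
  map_comp f g := GrMod.hom_ext (LinearMap.ext fun t => by
    exact LinearMap.rTensor_comp_apply N (g.lin.restrictScalars K) (f.lin.restrictScalars K) t)

variable {S} in
/-- The one-dimensional module `N_x` over the algebra of functions on `S`, on which a function `b`
acts as multiplication by `b x`. -/
@[nolint unusedArguments]
def EvalModule (K : Type u) [Field K] {S : Type} (_x : S) : Type u := K

instance (x : S) : AddCommGroup (EvalModule K x) := inferInstanceAs (AddCommGroup K)
instance (x : S) : Module K (EvalModule K x) := inferInstanceAs (Module K K)
instance (x : S) : Module (S → K) (EvalModule K x) :=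
  Module.compHom K (Pi.evalRingHom (fun _ : S => K) x)
instance (x : S) : IsScalarTower K (S → K) (EvalModule K x) :=
  ⟨fun k b v => mul_assoc k (b x) v⟩

end Skew

section Truncation

variable {K : Type u} [Field K] {Γ : Type} [AddMonoid Γ] [DecidableEq Γ]
  {A : Type u} [Ring A] [Algebra K A] (𝒜 : Γ → Submodule K A) [GradedAlgebra 𝒜]
  {S : Type} [AddAction Γ S] (X : Set S)

/-- The idempotent `1 ⊗ χ` of the skew product, for the indicator function `χ` of a set. -/
def idem (Y : Set S) : SkewProduct 𝒜 S := SkewProduct.tmul 𝒜 1 (Y.indicator 1)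

theorem idem_mem (Y : Set S) : idem 𝒜 Y ∈ skewDeg 𝒜 S 0 :=
  tmul_mem_skewModuleDeg 𝒜 (S → K) SetLike.GradedOne.one_mem _

/-- The two-sided ideal of the skew product `C = A ⋉ B` generated by the idempotent of the
complement of `X`. -/
def truncIdeal : Ideal (SkewProduct 𝒜 S) := (TwoSidedIdeal.span {idem 𝒜 Xᶜ}).asIdeal

instance : (truncIdeal 𝒜 X).IsTwoSided :=
  inferInstanceAs (TwoSidedIdeal.span {idem 𝒜 Xᶜ}).asIdeal.IsTwoSided

theorem truncIdeal_isHomogeneous : Submodule.IsHomogeneous (truncIdeal 𝒜 X) (skewDeg 𝒜 S) := by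
  classical
  intro γ x hx
  replace hx : x ∈ TwoSidedIdeal.span {idem 𝒜 Xᶜ} := hx
  change projDeg (skewDeg 𝒜 S) γ x ∈ TwoSidedIdeal.span {idem 𝒜 Xᶜ}
  rw [TwoSidedIdeal.mem_span_iff_mem_addSubgroup_closure] at hx
  induction hx using AddSubgroup.closure_induction with
  | zero => rw [map_zero]; exact zero_mem _
  | add y z _ _ hy hz => rw [map_add]; exact add_mem hy hz
  | neg y _ hy => rw [map_neg]; exact neg_mem hy
  | mem y hy =>
    obtain ⟨_, ⟨a, -, _, rfl, rfl⟩, b, -, rfl⟩ := hy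
    have he : idem 𝒜 Xᶜ ∈ TwoSidedIdeal.span {idem 𝒜 Xᶜ} :=
      TwoSidedIdeal.subset_span rfl
    change projDeg (skewDeg 𝒜 S) γ (a * idem 𝒜 Xᶜ * b) ∈ _
    rw [← DirectSum.sum_support_decompose (skewDeg 𝒜 S) a,
      ← DirectSum.sum_support_decompose (skewDeg 𝒜 S) b, Finset.sum_mul, Finset.sum_mul, map_sum]
    refine sum_mem fun α _ => ?_
    rw [Finset.mul_sum, map_sum]
    refine sum_mem fun β _ => ?_
    have hm := SetLike.GradedMul.mul_mem (SetLike.GradedMul.mul_mem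
      (SetLike.coe_mem (DirectSum.decompose (skewDeg 𝒜 S) a α)) (idem_mem 𝒜 Xᶜ))
      (SetLike.coe_mem (DirectSum.decompose (skewDeg 𝒜 S) b β))
    by_cases h : α + 0 + β = γ
    · rw [← h, projDeg_same _ _ _ hm]
      exact TwoSidedIdeal.mul_mem_right _ _ _ (TwoSidedIdeal.mul_mem_left _ _ _ he)
    · rw [projDeg_ne _ _ _ h _ hm]
      exact zero_mem _

/-- The algebra `C(X) = C ⧸ C χ C`, where `χ` is the indicator function of the complement
of `X`. -/
abbrev Trunc : Type u := SkewProduct 𝒜 S ⧸ truncIdeal 𝒜 X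

/-- The grading of `C(X)`. -/
abbrev truncDeg : Γ → Submodule K (Trunc 𝒜 X) := quotDeg (skewDeg 𝒜 S) (truncIdeal 𝒜 X)

instance : GradedAlgebra (truncDeg 𝒜 X) :=
  quotGradedAlgebra (skewDeg 𝒜 S) (truncIdeal 𝒜 X) (truncIdeal_isHomogeneous 𝒜 X)

/-- The functor `C(X) ⊗_C (- ⋉ N_x)`, for a point `x` of `S`. -/
def truncFunctor (x : S) : GrMod 𝒜 ⥤ GrMod (truncDeg 𝒜 X) :=
  skewFunctor 𝒜 S (EvalModule K x) ⋙
    quotTensorFunctor (skewDeg 𝒜 S) (truncIdeal 𝒜 X) (truncIdeal_isHomogeneous 𝒜 X)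

/-- The class of `a ⊗ b` in `C(X)`. -/
def Trunc.of (a : A) (b : S → K) : Trunc 𝒜 X :=
  Ideal.Quotient.mk (truncIdeal 𝒜 X) (SkewProduct.tmul 𝒜 a b)

end Truncation

section Kostant

attribute [local instance] LieRing.ofAssociativeRing

/-- The Lie algebra `sl_n^+` of strictly upper triangular complex matrices. -/
def slPlus (n : ℕ) : LieSubalgebra ℂ (Matrix (Fin n) (Fin n) ℂ) where
  carrier := {x | ∀ i j, j ≤ i → x i j = 0}
  zero_mem' _ _ _ := rfl
  add_mem' hx hy i j h := by rw [Matrix.add_apply, hx i j h, hy i j h, add_zero]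
  smul_mem' c x hx i j h := by rw [Matrix.smul_apply, hx i j h, smul_zero]
  lie_mem' {x y} hx hy i j h := by
    rw [Ring.lie_def, Matrix.sub_apply, Matrix.mul_apply, Matrix.mul_apply,
      Finset.sum_eq_zero, Finset.sum_eq_zero, sub_zero]
    · intro k _
      rcases le_or_gt k i with hk | hk
      · rw [hy i k hk, zero_mul]
      · rw [hx k j (h.trans hk.le), mul_zero]
    · intro k _
      rcases le_or_gt k i with hk | hk
      · rw [hx i k hk, zero_mul]
      · rw [hy k j (h.trans hk.le), mul_zero]

/-- The pairs `i < j`, which index the positive roots `v_i - v_j` of `sl_n`. -/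
abbrev PosRoot (n : ℕ) : Type := {p : Fin n × Fin n // p.1 < p.2}

/-- The submonoid `Ψ_n` of `ℤ ^ n` generated by the `v_i - v_{i+1}`. -/
def Psi (n : ℕ) : AddSubmonoid (Fin n → ℤ) :=
  AddSubmonoid.closure
    {z | ∃ i j : Fin n, (i : ℕ) + 1 = j ∧ z = Pi.single i 1 - Pi.single j 1}

theorem root_mem_Psi (n : ℕ) {i j : Fin n} (h : i < j) :
    (Pi.single i 1 - Pi.single j 1 : Fin n → ℤ) ∈ Psi n := by
  obtain ⟨i, hi⟩ := i
  obtain ⟨j, hj⟩ := j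
  have h : i < j := h
  induction j, h using Nat.le_induction with
  | base => exact AddSubmonoid.subset_closure ⟨_, _, rfl, rfl⟩
  | succ j hij ih =>
    have hj' : j < n := (Nat.lt_succ_self j).trans hj
    rw [← sub_add_sub_cancel _ (Pi.single (⟨j, hj'⟩ : Fin n) (1 : ℤ)) _]
    exact add_mem (ih hj' hij) (AddSubmonoid.subset_closure ⟨_, _, rfl, rfl⟩)

/-- The positive root `v_i - v_j`, as an element of `Ψ_n`. -/
def rootDeg {n : ℕ} (p : PosRoot n) : Psi n :=
  ⟨Pi.single p.1.1 1 - Pi.single p.1.2 1, root_mem_Psi n p.2⟩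

/-- The basis element `e_{ij}` of `sl_n^+`. -/
def rootVec {n : ℕ} (p : PosRoot n) : slPlus n :=
  ⟨Matrix.single p.1.1 p.1.2 1, fun _ _ h => Matrix.single_apply_of_ne _ _ _ _ _
    (fun h' => absurd p.2 (not_lt_of_ge (h'.1.symm ▸ h'.2.symm ▸ h)))⟩

/-- The universal enveloping algebra of `sl_n^+`. -/
abbrev UPlus (n : ℕ) : Type := UniversalEnvelopingAlgebra ℂ (slPlus n)

/-- The divided power `e_{ij}^{(k)} = e_{ij} ^ k / k!`. -/
def divPow {n : ℕ} (q : PosRoot n × ℕ) : UPlus n :=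
  ((q.2.factorial : ℂ)⁻¹) • (UniversalEnvelopingAlgebra.ι ℂ (rootVec q.1)) ^ q.2

/-- The Kostant form over `ℤ`: the subring generated by the divided powers `e_{ij}^{(k)}`. -/
def kostantZ (n : ℕ) : Subalgebra ℤ (UPlus n) := Algebra.adjoin ℤ (Set.range divPow)

/-- The Kostant form over a field `K`. -/
abbrev Kostant (K : Type u) [Field K] (n : ℕ) : Type u := K ⊗[ℤ] (kostantZ n)

def divPowZ {n : ℕ} (q : PosRoot n × ℕ) : kostantZ n :=
  ⟨divPow q, Algebra.subset_adjoin ⟨q, rfl⟩⟩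

/-- The divided power `e_{ij}^{(k)}` in the Kostant form over `K`. -/
def divPowK (K : Type u) [Field K] {n : ℕ} (q : PosRoot n × ℕ) : Kostant K n :=
  1 ⊗ₜ[ℤ] divPowZ q

/-- The degree of a product of divided powers. -/
def listDeg {n : ℕ} (l : List (PosRoot n × ℕ)) : Psi n := (l.map fun q => q.2 • rootDeg q.1).sum

/-- The component of degree `γ` of the Kostant form: the span of the products of divided powers
in which the degrees `k (v_i - v_j)` of the factors `e_{ij}^{(k)}` add up to `γ`. -/
def kostantDeg (K : Type u) [Field K] (n : ℕ) (γ : Psi n) : Submodule K (Kostant K n) :=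
  Submodule.span K {x | ∃ l : List (PosRoot n × ℕ), listDeg l = γ ∧ (l.map (divPowK K)).prod = x}

instance (n : ℕ) : DecidableEq (Psi n) := inferInstanceAs (DecidableEq {z // z ∈ Psi n})

section Coaction

variable {n : ℕ}

def matDeg (i j : Fin n) : Psi n := if h : i < j then rootDeg ⟨(i, j), h⟩ else 0

def matVec (i j : Fin n) : UPlus n :=
  if h : i < j then UniversalEnvelopingAlgebra.ι ℂ (rootVec ⟨(i, j), h⟩) else 0

def matElt (i j : Fin n) : AddMonoidAlgebra (UPlus n) (Psi n) :=
  AddMonoidAlgebra.single (matDeg i j) (matVec i j)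

theorem matVec_of_lt {i j : Fin n} (h : i < j) :
    matVec i j = UniversalEnvelopingAlgebra.ι ℂ (rootVec ⟨(i, j), h⟩) := dif_pos h

theorem matDeg_of_lt {i j : Fin n} (h : i < j) : matDeg i j = rootDeg ⟨(i, j), h⟩ := dif_pos h

theorem matDeg_add {i j k : Fin n} (h : i < j) (h' : j < k) :
    matDeg i j + matDeg j k = matDeg i k := by
  rw [matDeg_of_lt h, matDeg_of_lt h', matDeg_of_lt (h.trans h')]
  exact Subtype.ext (sub_add_sub_cancel _ _ _)

theorem matVec_lie {i j k l : Fin n} (hij : i < j) (hkl : k < l) :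
    matVec i j * matVec k l - matVec k l * matVec i j =
      (if j = k then matVec i l else 0) - (if l = i then matVec k j else 0) := by
  have h1 : matVec i j * matVec k l - matVec k l * matVec i j =
      UniversalEnvelopingAlgebra.ι ℂ
        ⁅rootVec ⟨(i, j), hij⟩, rootVec ⟨(k, l), hkl⟩⁆ := by
    rw [LieHom.map_lie, matVec_of_lt hij, matVec_of_lt hkl]
    rfl
  rw [h1]
  have h2 : ((⁅rootVec ⟨(i, j), hij⟩, rootVec ⟨(k, l), hkl⟩⁆ : slPlus n) :
      Matrix (Fin n) (Fin n) ℂ) =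
      Matrix.single i j 1 * Matrix.single k l 1 - Matrix.single k l 1 * Matrix.single i j 1 := rfl
  by_cases hjk : j = k
  · subst hjk
    have hli : l ≠ i := (hij.trans hkl).ne'
    rw [if_pos rfl, if_neg hli, sub_zero, matVec_of_lt (hij.trans hkl)]
    congr 1
    apply Subtype.ext
    rw [h2, Matrix.single_mul_single_same, Matrix.single_mul_single_of_ne _ _ _ _ hli, sub_zero,
      mul_one]
    rfl
  · rw [if_neg hjk]
    by_cases hli : l = i
    · subst hli
      rw [if_pos rfl, zero_sub, matVec_of_lt (hkl.trans hij), ← map_neg]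
      congr 1
      apply Subtype.ext
      rw [h2, Matrix.single_mul_single_same, Matrix.single_mul_single_of_ne _ _ _ _ hjk, zero_sub,
        mul_one]
      rfl
    · rw [if_neg hli, sub_zero, ← map_zero (UniversalEnvelopingAlgebra.ι ℂ : slPlus n →ₗ⁅ℂ⁆ UPlus n)]
      congr 1
      apply Subtype.ext
      rw [h2, Matrix.single_mul_single_of_ne _ _ _ _ hjk, Matrix.single_mul_single_of_ne _ _ _ _ hli,
        sub_zero]
      rfl

theorem matElt_lie {i j k l : Fin n} (hij : i < j) (hkl : k < l) :
    matElt i j * matElt k l - matElt k l * matElt i j =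
      (if j = k then matElt i l else 0) - (if l = i then matElt k j else 0) := by
  unfold matElt
  rw [AddMonoidAlgebra.single_mul_single, AddMonoidAlgebra.single_mul_single,
    add_comm (matDeg k l), ← AddMonoidAlgebra.single_sub, matVec_lie hij hkl]
  by_cases hjk : j = k
  · subst hjk
    have hli : l ≠ i := (hij.trans hkl).ne'
    rw [if_pos rfl, if_neg hli, if_pos rfl, if_neg hli, sub_zero, sub_zero, matDeg_add hij hkl]
  · rw [if_neg hjk, if_neg hjk]
    by_cases hli : l = i
    · subst hli
      rw [if_pos rfl, if_pos rfl, zero_sub, zero_sub, add_comm, matDeg_add hkl hij,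
        AddMonoidAlgebra.single_neg]
    · rw [if_neg hli, if_neg hli, sub_zero, sub_zero, AddMonoidAlgebra.single_zero]

theorem sum_mul_sub {R : Type*} [Ring R] (X Y : Fin n → Fin n → R) :
    (∑ i, ∑ j, X i j) * (∑ i, ∑ j, Y i j) - (∑ i, ∑ j, Y i j) * (∑ i, ∑ j, X i j) =
      ∑ i, ∑ j, ∑ k, ∑ l, (X i j * Y k l - Y k l * X i j) := by
  have h : ∀ Z : Fin n → Fin n → R, ∑ i, ∑ j, Z i j = ∑ p : Fin n × Fin n, Z p.1 p.2 :=
    fun Z => (Fintype.sum_prod_type' Z).symm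
  rw [h X, h Y, Finset.sum_mul_sum, Finset.sum_mul_sum,
    Finset.sum_comm (f := fun p q : Fin n × Fin n => Y p.1 p.2 * X q.1 q.2),
    ← Finset.sum_sub_distrib, h]
  refine Finset.sum_congr rfl fun p _ => ?_
  rw [h (fun k l => X p.1 p.2 * Y k l - Y k l * X p.1 p.2), Finset.sum_sub_distrib]

theorem sum_matrix {R M : Type*} [CommRing R] [AddCommGroup M] [Module R M]
    (x y : Matrix (Fin n) (Fin n) R) (T : Fin n → Fin n → M) :
    ∑ i, ∑ j, ∑ k, ∑ l, (x i j * y k l) •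
      ((if j = k then T i l else 0) - (if l = i then T k j else 0)) =
      ∑ i, ∑ j, (x * y - y * x) i j • T i j := by
  simp only [smul_sub, Finset.sum_sub_distrib, smul_ite, smul_zero, Matrix.sub_apply,
    Matrix.mul_apply, sub_smul, Finset.sum_smul]
  congr 1
  · refine Finset.sum_congr rfl fun i _ => ?_
    have h : ∀ j, ∑ k, ∑ l, (if j = k then (x i j * y k l) • T i l else 0) =
        ∑ l, (x i j * y j l) • T i l := fun j => by
      rw [Finset.sum_comm]
      simp
    simp only [h]
    exact Finset.sum_comm
  · have h : ∀ i j, ∑ k, ∑ l, (if l = i then (x i j * y k l) • T k j else 0) =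
        ∑ k, (y k i * x i j) • T k j := fun i j => by
      simp [mul_comm]
    simp only [h]
    have h' : ∀ i, ∑ j, ∑ k, (y k i * x i j) • T k j = ∑ k, ∑ j, (y k i * x i j) • T k j :=
      fun i => Finset.sum_comm
    simp only [h']
    rw [Finset.sum_comm]
    exact Finset.sum_congr rfl fun k _ => Finset.sum_comm

/-- The Lie homomorphism `e_{ij} ↦ (v_i - v_j) ⊗ e_{ij}` behind the grading. -/
def coactLie (n : ℕ) : slPlus n →ₗ⁅ℂ⁆ AddMonoidAlgebra (UPlus n) (Psi n) where
  toFun x := ∑ i, ∑ j, (x : Matrix (Fin n) (Fin n) ℂ) i j • matElt i j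
  map_add' x y := by
    simp [add_smul, Finset.sum_add_distrib]
  map_smul' c x := by
    simp [mul_smul, Finset.smul_sum]
  map_lie' {x y} := by
    obtain ⟨x, hx⟩ := x
    obtain ⟨y, hy⟩ := y
    change ∑ i, ∑ j, (x * y - y * x) i j • matElt i j =
      (∑ i, ∑ j, x i j • matElt i j) * (∑ i, ∑ j, y i j • matElt i j) -
        (∑ i, ∑ j, y i j • matElt i j) * (∑ i, ∑ j, x i j • matElt i j)
    have h1 : ∀ i j k l, (x i j • matElt i j) * (y k l • matElt k l) -
        (y k l • matElt k l) * (x i j • matElt i j) =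
        (x i j * y k l) • ((if j = k then matElt i l else 0) - (if l = i then matElt k j else 0)) := by
      intro i j k l
      rw [smul_mul_smul_comm, smul_mul_smul_comm, mul_comm (y k l), ← smul_sub]
      rcases le_or_gt j i with h | h
      · rw [hx i j h, zero_mul, zero_smul, zero_smul]
      rcases le_or_gt l k with h' | h'
      · rw [hy k l h', mul_zero, zero_smul, zero_smul]
      rw [matElt_lie h h']
    rw [sum_mul_sub, ← sum_matrix]
    exact (Finset.sum_congr rfl fun i _ => Finset.sum_congr rfl fun j _ =>
      Finset.sum_congr rfl fun k _ => Finset.sum_congr rfl fun l _ => h1 i j k l).symm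

theorem coactLie_rootVec (p : PosRoot n) : coactLie n (rootVec p) =
    AddMonoidAlgebra.single (rootDeg p) (UniversalEnvelopingAlgebra.ι ℂ (rootVec p)) := by
  obtain ⟨⟨i, j⟩, h⟩ := p
  change ∑ k, ∑ l, (Matrix.single i j (1 : ℂ)) k l • matElt k l = _
  have h1 : ∀ k l, (Matrix.single i j (1 : ℂ)) k l • matElt k l =
      if k = i then (if l = j then matElt i j else 0) else 0 := by
    intro k l
    by_cases hk : k = i
    · by_cases hl : l = j
      · subst hk hl
        simp
      · rw [Matrix.single_apply_of_ne _ _ _ _ _ (fun h => hl h.2.symm)]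
        simp [hl]
    · rw [Matrix.single_apply_of_ne _ _ _ _ _ (fun h => hk h.1.symm)]
      simp [hk]
  simp only [h1]
  have h2 : ∑ k : Fin n, ∑ l : Fin n,
      (if k = i then (if l = j then matElt i j else 0) else 0) = matElt i j := by simp
  rw [h2, matElt, matDeg_of_lt h, matVec_of_lt h]

def coact (n : ℕ) : UPlus n →ₐ[ℂ] AddMonoidAlgebra (UPlus n) (Psi n) :=
  UniversalEnvelopingAlgebra.lift ℂ (coactLie n)

theorem coact_divPow (q : PosRoot n × ℕ) :
    coact n (divPow q) = AddMonoidAlgebra.single (q.2 • rootDeg q.1) (divPow q) := by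
  unfold coact divPow
  rw [map_smul, map_pow, UniversalEnvelopingAlgebra.lift_ι_apply, coactLie_rootVec,
    AddMonoidAlgebra.single_pow, AddMonoidAlgebra.smul_single]

theorem coact_prod (l : List (PosRoot n × ℕ)) :
    coact n (l.map divPow).prod = AddMonoidAlgebra.single (listDeg l) (l.map divPow).prod := by
  induction l with
  | nil =>
    rw [List.map_nil, List.prod_nil, map_one]
    rfl
  | cons q l ih =>
    rw [List.map_cons, List.prod_cons, map_mul, ih, coact_divPow,
      AddMonoidAlgebra.single_mul_single]
    rfl

end Coaction

section Grading

variable {n : ℕ}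

theorem coe_prod_divPowZ (l : List (PosRoot n × ℕ)) :
    (((l.map divPowZ).prod : kostantZ n) : UPlus n) = (l.map divPow).prod := by
  rw [← Subalgebra.coe_val, map_list_prod, List.map_map]
  rfl

theorem kostantZ_span (u : kostantZ n) :
    u ∈ Submodule.span ℤ (Set.range fun l : List (PosRoot n × ℕ) => (l.map divPowZ).prod) := by
  obtain ⟨u, hu⟩ := u
  have hu' := hu
  unfold kostantZ at hu'
  rw [← Subalgebra.mem_toSubmodule, Algebra.adjoin_eq_span, ← FreeMonoid.mrange_lift] at hu'
  have h2 : Submodule.span ℤ (MonoidHom.mrange (FreeMonoid.lift (divPow (n := n))) : Set (UPlus n)) ≤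
      (Submodule.span ℤ (Set.range fun l : List (PosRoot n × ℕ) => (l.map divPowZ).prod)).map
        (kostantZ n).val.toLinearMap := by
    rw [Submodule.span_le]
    rintro _ ⟨l, rfl⟩
    exact ⟨_, Submodule.subset_span ⟨l.toList, rfl⟩, (coe_prod_divPowZ _).trans (FreeMonoid.lift_apply _ _).symm⟩
  obtain ⟨v, hv, hvu⟩ := h2 hu'
  have : v = ⟨u, hu⟩ := Subtype.ext hvu
  rwa [← this]

def coactCoeff (γ : Psi n) : UPlus n →+ UPlus n where
  toFun u := (coact n u).coeff γ
  map_zero' := by rw [map_zero]; rfl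
  map_add' x y := by rw [map_add]; rfl

theorem coactCoeff_prod (γ : Psi n) (l : List (PosRoot n × ℕ)) :
    coactCoeff γ (l.map divPow).prod = if listDeg l = γ then (l.map divPow).prod else 0 := by
  change (coact n (l.map divPow).prod).coeff γ = _
  rw [coact_prod, AddMonoidAlgebra.coeff_single, Finsupp.single_apply]

theorem coactCoeff_mem (γ : Psi n) (u : kostantZ n) : coactCoeff γ u ∈ kostantZ n := by
  induction kostantZ_span u using Submodule.span_induction with
  | mem x hx =>
    obtain ⟨l, rfl⟩ := hx
    simp only [coe_prod_divPowZ, coactCoeff_prod]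
    split_ifs
    · rw [← coe_prod_divPowZ]
      exact SetLike.coe_mem _
    · exact zero_mem _
  | zero => rw [ZeroMemClass.coe_zero, map_zero]; exact zero_mem _
  | add x y _ _ hx hy => rw [AddMemClass.coe_add, map_add]; exact add_mem hx hy
  | smul k x _ hx =>
    rw [SetLike.val_smul, map_zsmul]
    exact Subalgebra.smul_mem _ hx k

def kostantZProj (γ : Psi n) : kostantZ n →ₗ[ℤ] kostantZ n :=
  AddMonoidHom.toIntLinearMap
    { toFun := fun u => ⟨coactCoeff γ u, coactCoeff_mem γ u⟩
      map_zero' := Subtype.ext (map_zero (coactCoeff γ))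
      map_add' := fun x y => Subtype.ext (map_add (coactCoeff γ) (x : UPlus n) y) }

variable (K : Type u) [Field K]

theorem prod_divPowK (l : List (PosRoot n × ℕ)) :
    (l.map (divPowK K)).prod = (1 : K) ⊗ₜ[ℤ] (l.map divPowZ).prod := by
  induction l with
  | nil => rfl
  | cons q l ih =>
    rw [List.map_cons, List.prod_cons, ih, List.map_cons, List.prod_cons]
    unfold divPowK
    rw [Algebra.TensorProduct.tmul_mul_tmul, one_mul]

def kostantProj (γ : Psi n) : Kostant K n →ₗ[K] Kostant K n :=
  LinearMap.baseChange K (kostantZProj γ)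

theorem kostantProj_prod (γ : Psi n) (l : List (PosRoot n × ℕ)) :
    kostantProj K γ (l.map (divPowK K)).prod =
      if listDeg l = γ then (l.map (divPowK K)).prod else 0 := by
  rw [prod_divPowK, kostantProj, LinearMap.baseChange_tmul]
  have : kostantZProj γ (l.map divPowZ).prod =
      if listDeg l = γ then (l.map divPowZ).prod else 0 := by
    apply Subtype.ext
    change coactCoeff γ (((l.map divPowZ).prod : kostantZ n) : UPlus n) = _
    rw [coe_prod_divPowZ, coactCoeff_prod]
    split_ifs
    · rw [coe_prod_divPowZ]
    · rfl
  rw [this]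
  split_ifs
  · rfl
  · rw [TensorProduct.tmul_zero]

theorem kostantDeg_isInternal (n : ℕ) : DirectSum.IsInternal (kostantDeg K n) := by
  refine isInternal_of_proj _ (kostantProj K) ?_ ?_ ?_
  · intro γ v hv
    refine (Submodule.span_le (p := LinearMap.eqLocus (kostantProj K γ) LinearMap.id)).2 ?_ hv
    rintro _ ⟨l, hl, rfl⟩
    change kostantProj K γ _ = _
    rw [kostantProj_prod, if_pos hl]
    rfl
  · intro γ γ' h v hv
    refine (Submodule.span_le (p := LinearMap.ker (kostantProj K γ))).2 ?_ hv
    rintro _ ⟨l, hl, rfl⟩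
    change kostantProj K γ _ = 0
    rw [kostantProj_prod, if_neg (by rwa [hl])]
  · rw [eq_top_iff]
    rintro t -
    induction t using TensorProduct.induction_on with
    | zero => exact zero_mem _
    | add x y hx hy => exact add_mem hx hy
    | tmul k u =>
      have hk : k ⊗ₜ[ℤ] u = k • ((1 : K) ⊗ₜ[ℤ] u) := by
        rw [TensorProduct.smul_tmul', smul_eq_mul, mul_one]
      rw [hk]
      refine Submodule.smul_mem _ k ?_
      clear hk
      induction kostantZ_span u using Submodule.span_induction with
      | mem x hx =>
        obtain ⟨l, rfl⟩ := hx
        exact Submodule.mem_iSup_of_mem (listDeg l)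
          (Submodule.subset_span ⟨l, rfl, prod_divPowK K l⟩)
      | zero => rw [TensorProduct.tmul_zero]; exact zero_mem _
      | add x y _ _ hx hy =>
        rw [TensorProduct.tmul_add]
        exact add_mem hx hy
      | smul m x _ hx =>
        rw [TensorProduct.tmul_smul]
        exact zsmul_mem hx m

theorem kostantDeg_mul {γ γ' : Psi n} {x y : Kostant K n} (hx : x ∈ kostantDeg K n γ)
    (hy : y ∈ kostantDeg K n γ') : x * y ∈ kostantDeg K n (γ + γ') := by
  have h := Submodule.mul_mem_mul hx hy
  unfold kostantDeg at h
  rw [Submodule.span_mul_span] at h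
  refine Submodule.span_mono ?_ h
  rintro _ ⟨_, ⟨l, rfl, rfl⟩, _, ⟨l', rfl, rfl⟩, rfl⟩
  refine ⟨l ++ l', ?_, ?_⟩
  · rw [listDeg, List.map_append, List.sum_append]
    rfl
  · rw [List.map_append, List.prod_append]

instance (n : ℕ) : GradedAlgebra (kostantDeg K n) :=
  { one_mem := Submodule.subset_span ⟨[], rfl, rfl⟩
    mul_mem := fun {_ _ _ _} hx hy => kostantDeg_mul K hx hy
    toDecomposition := (kostantDeg_isInternal K n).chooseDecomposition }

end Grading

section Trivial

variable {n : ℕ}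

/-- The counit of the universal enveloping algebra. -/
def counitU (n : ℕ) : UPlus n →ₐ[ℂ] ℂ :=
  UniversalEnvelopingAlgebra.lift ℂ (0 : slPlus n →ₗ⁅ℂ⁆ ℂ)

theorem counitU_divPow (q : PosRoot n × ℕ) : counitU n (divPow q) = if q.2 = 0 then 1 else 0 := by
  unfold counitU divPow
  rw [map_smul, map_pow, UniversalEnvelopingAlgebra.lift_ι_apply]
  split_ifs with h
  · simp [h]
  · simp [h]

theorem counitU_mem (u : kostantZ n) : counitU n u ∈ (⊥ : Subalgebra ℤ ℂ) := by
  have h : kostantZ n ≤ (⊥ : Subalgebra ℤ ℂ).comap ((counitU n).restrictScalars ℤ) := by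
    refine Algebra.adjoin_le ?_
    rintro _ ⟨q, rfl⟩
    change counitU n (divPow q) ∈ (⊥ : Subalgebra ℤ ℂ)
    rw [counitU_divPow]
    split_ifs
    · exact one_mem _
    · exact zero_mem _
  exact h u.2

/-- The augmentation of the Kostant form over `ℤ`. -/
def counitZ (n : ℕ) : kostantZ n →ₐ[ℤ] ℤ :=
  (Algebra.botEquivOfInjective (R := ℤ) (A := ℂ) (algebraMap ℤ ℂ).injective_int).toAlgHom.comp
    ((((counitU n).restrictScalars ℤ).comp (kostantZ n).val).codRestrict ⊥ counitU_mem)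

theorem counitZ_coe (u : kostantZ n) : (counitZ n u : ℂ) = counitU n u := by
  have h := (Algebra.botEquivOfInjective (R := ℤ) (A := ℂ)
    (algebraMap ℤ ℂ).injective_int).symm_apply_apply ⟨counitU n u, counitU_mem u⟩
  exact congrArg Subtype.val h

/-- The augmentation of the Kostant form over `K`; it maps `e_{ij}^{(k)}` to `0` if `k > 0`. -/
def counitK (K : Type u) [Field K] (n : ℕ) : Kostant K n →ₐ[K] K :=
  Algebra.TensorProduct.lift (AlgHom.id K K) ((Algebra.ofId ℤ K).comp (counitZ n))
    (fun _ _ => Commute.all _ _)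

theorem counitK_divPowK (K : Type u) [Field K] (q : PosRoot n × ℕ) :
    counitK K n (divPowK K q) = if q.2 = 0 then 1 else 0 := by
  have h : counitZ n (divPowZ q) = if q.2 = 0 then 1 else 0 := by
    have h := counitZ_coe (divPowZ q)
    rw [show ((divPowZ q : kostantZ n) : UPlus n) = divPow q from rfl, counitU_divPow] at h
    split_ifs at h ⊢ <;> exact_mod_cast h
  unfold counitK divPowK
  rw [Algebra.TensorProduct.lift_tmul, map_one, one_mul, AlgHom.comp_apply, h]
  split_ifs <;> simp

theorem counitK_eq_zero (K : Type u) [Field K] {γ : Psi n} (hγ : γ ≠ 0) {a : Kostant K n}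
    (ha : a ∈ kostantDeg K n γ) : counitK K n a = 0 := by
  refine (Submodule.span_le (p := LinearMap.ker (counitK K n).toLinearMap)).2 ?_ ha
  rintro _ ⟨l, hl, rfl⟩
  change counitK K n _ = 0
  rw [map_list_prod, List.map_map, List.prod_eq_zero_iff]
  by_contra h
  apply hγ
  rw [← hl]
  refine List.sum_eq_zero fun x hx => ?_
  obtain ⟨q, hq, rfl⟩ := List.mem_map.1 hx
  have : q.2 = 0 := by
    by_contra h'
    exact h (List.mem_map.2 ⟨q, hq, (counitK_divPowK K q).trans (if_neg h')⟩)
  rw [this, zero_smul]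

/-- The trivial module of the Kostant form. -/
@[nolint unusedArguments]
def TrivialModule (K : Type u) [Field K] (_n : ℕ) : Type u := K

instance (K : Type u) [Field K] (n : ℕ) : AddCommGroup (TrivialModule K n) :=
  inferInstanceAs (AddCommGroup K)
instance (K : Type u) [Field K] (n : ℕ) : Module K (TrivialModule K n) :=
  inferInstanceAs (Module K K)
instance (K : Type u) [Field K] (n : ℕ) : Module (Kostant K n) (TrivialModule K n) :=
  Module.compHom K (counitK K n).toRingHom
instance (K : Type u) [Field K] (n : ℕ) : IsScalarTower K (Kostant K n) (TrivialModule K n) :=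
  ⟨fun k a (v : K) => by
    change counitK K n (k • a) * v = k * (counitK K n a * v)
    rw [map_smul, smul_eq_mul, mul_assoc]⟩

/-- The grading of the trivial module: everything has degree `0`. -/
def trivialDeg (K : Type u) [Field K] (n : ℕ) (γ : Psi n) : Submodule K (TrivialModule K n) :=
  if γ = 0 then ⊤ else ⊥

theorem trivialDeg_isInternal (K : Type u) [Field K] (n : ℕ) :
    DirectSum.IsInternal (trivialDeg K n) := by
  refine isInternal_of_proj _ (fun γ => if γ = 0 then LinearMap.id else 0) ?_ ?_ ?_
  · intro γ v hv
    unfold trivialDeg at hv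
    split_ifs at hv ⊢
    · rfl
    · exact ((Submodule.mem_bot K).1 hv).symm
  · intro γ γ' h v hv
    unfold trivialDeg at hv
    by_cases h2 : γ' = 0
    · rw [if_neg (fun h1 => h (h2.trans h1.symm))]
      rfl
    · rw [if_neg h2, Submodule.mem_bot] at hv
      rw [hv, map_zero]
  · rw [eq_top_iff]
    exact le_iSup_of_le 0 (by rw [trivialDeg, if_pos rfl])

/-- The trivial module as a graded module. -/
def trivialMod (K : Type u) [Field K] (n : ℕ) : GrMod (kostantDeg K n) where
  carrier := TrivialModule K n
  deg := trivialDeg K n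
  decomposition := (trivialDeg_isInternal K n).chooseDecomposition
  gradedSMul := by
    refine ⟨fun {γ γ' a v} ha hv => ?_⟩
    by_cases h' : γ' = 0
    · by_cases h : γ = 0
      · rw [h, h', trivialDeg, if_pos (by simp)]
        trivial
      · have : a • v = 0 := by
          change (counitK K n a : K) * (show K from v) = 0
          rw [counitK_eq_zero K h ha, zero_mul]
        rw [this]
        exact zero_mem _
    · rw [trivialDeg, if_neg h', Submodule.mem_bot] at hv
      rw [hv, smul_zero]
      exact zero_mem _

end Trivial

end Kostant
section Schur

variable (K : Type u) [Field K] (n r : ℕ)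

/-- The set `Λ(n, r)` of compositions of `r` into `n` parts, as a subset of `ℤ ^ n`. -/
def compositions : Set (Fin n → ℤ) := {z | (∀ i, 0 ≤ z i) ∧ ∑ i, z i = r}

/-- The weight of a multi-index. -/
def weight {n r : ℕ} (f : Fin r → Fin n) (i : Fin n) : ℤ :=
  (Finset.univ.filter fun s => f s = i).card

theorem exists_weight_eq {n r : ℕ} {z : Fin n → ℤ} (hz : z ∈ compositions n r) :
    ∃ f : Fin r → Fin n, weight f = z := by
  obtain ⟨h0, hs⟩ := hz
  have hs' : ∑ i, (z i).toNat = r := by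
    zify
    rw [← hs]
    exact Finset.sum_congr rfl fun i _ => Int.toNat_of_nonneg (h0 i)
  subst hs'
  refine ⟨fun s => (finSigmaFinEquiv.symm s).1, funext fun i => ?_⟩
  unfold weight
  rw [← Int.toNat_of_nonneg (h0 i), Nat.cast_inj, ← Fintype.card_subtype,
    Fintype.card_congr ((finSigmaFinEquiv (n := fun i => (z i).toNat)).symm.subtypeEquiv
      (q := fun p => p.1 = i) fun _ => Iff.rfl),
    Fintype.card_congr (Equiv.sigmaSubtype i), Fintype.card_fin]

/-- The tensor power `V^{⊗ r}` of the natural module `V = K ^ n`. -/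
abbrev TensorPow : Type u := ⨂[K] (_ : Fin r), (Fin n → K)

variable {n r} in
/-- The basis vector `v_{f 1} ⊗ ⋯ ⊗ v_{f r}` of `V^{⊗ r}`. -/
def basisVec (f : Fin r → Fin n) : TensorPow K n r :=
  PiTensorProduct.tprod K fun s => Pi.single (f s) 1

/-- The diagonal action of `GL_n` on `V^{⊗ r}`. -/
def tau : GL (Fin n) K →* Module.End K (TensorPow K n r) where
  toFun g := PiTensorProduct.map fun _ => Matrix.toLin' (g : Matrix (Fin n) (Fin n) K)
  map_one' := by
    rw [Units.val_one, Matrix.toLin'_one]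
    exact PiTensorProduct.map_id
  map_mul' g h := by
    rw [Units.val_mul, Matrix.toLin'_mul]
    exact PiTensorProduct.map_comp _ _

/-- The upper triangular matrices in `GL_n`. -/
def upperBorel : Submonoid (GL (Fin n) K) where
  carrier := {g | ∀ i j, j < i → (g : Matrix (Fin n) (Fin n) K) i j = 0}
  one_mem' i j h := Matrix.one_apply_ne h.ne'
  mul_mem' {g h} hg hh i j hij := by
    rw [Units.val_mul, Matrix.mul_apply]
    refine Finset.sum_eq_zero fun k _ => ?_
    rcases lt_or_ge k i with hk | hk
    · rw [hg i k hk, zero_mul]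
    · rw [hh k j (hij.trans_le hk), mul_zero]

/-- The Borel subalgebra `S^+(n, r)` of the Schur algebra: the linear span of the operators by
which the upper triangular invertible matrices act on `V^{⊗ r}`. -/
def borelSchur : Subalgebra K (Module.End K (TensorPow K n r)) :=
  (Submodule.span K (tau K n r '' upperBorel K n)).toSubalgebra
    (Submodule.subset_span ⟨1, one_mem _, map_one _⟩)
    (fun x y hx hy => by
      have h := Submodule.mul_mem_mul hx hy
      rw [Submodule.span_mul_span] at h
      refine Submodule.span_mono ?_ h
      rintro _ ⟨_, ⟨g, hg, rfl⟩, _, ⟨g', hg', rfl⟩, rfl⟩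
      exact ⟨g * g', mul_mem hg hg', map_mul _ _ _⟩)

instance : Ring (borelSchur K n r) := Algebra.semiringToRing K

variable {n r}

/-- The diagonal matrix coefficient of an operator at the basis vector of index `f`. -/
def diagCoeff (f : Fin r → Fin n) : Module.End K (TensorPow K n r) →ₗ[K] K :=
  PiTensorProduct.lift ((MultilinearMap.mkPiAlgebra K (Fin r) K).compLinearMap
    fun s => LinearMap.proj (f s)) ∘ₗ LinearMap.applyₗ (basisVec K f)

theorem diagCoeff_tau (f : Fin r → Fin n) (g : GL (Fin n) K) :
    diagCoeff K f (tau K n r g) = ∏ s, (g : Matrix (Fin n) (Fin n) K) (f s) (f s) := by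
  change PiTensorProduct.lift _ (PiTensorProduct.map _ (PiTensorProduct.tprod K _)) = _
  rw [PiTensorProduct.map_tprod, PiTensorProduct.lift.tprod]
  simp

theorem diagCoeff_mul (f : Fin r → Fin n) (x y : Module.End K (TensorPow K n r))
    (hx : x ∈ borelSchur K n r) (hy : y ∈ borelSchur K n r) :
    diagCoeff K f (x * y) = diagCoeff K f x * diagCoeff K f y := by
  replace hx : x ∈ Submodule.span K (tau K n r '' upperBorel K n) := hx
  replace hy : y ∈ Submodule.span K (tau K n r '' upperBorel K n) := hy
  induction hx, hy using Submodule.span_induction₂ with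
  | mem_mem x y hx hy =>
    obtain ⟨g, hg, rfl⟩ := hx
    obtain ⟨h, hh, rfl⟩ := hy
    rw [← map_mul, diagCoeff_tau, diagCoeff_tau, diagCoeff_tau, ← Finset.prod_mul_distrib]
    refine Finset.prod_congr rfl fun s _ => ?_
    rw [Units.val_mul, Matrix.mul_apply]
    refine Finset.sum_eq_single (f s) (fun k _ hk => ?_) (fun h => absurd (Finset.mem_univ _) h)
    rcases lt_or_gt_of_ne hk with h' | h'
    · rw [hg _ _ h', zero_mul]
    · rw [hh _ _ h', mul_zero]
  | zero_left y hy => rw [zero_mul, map_zero, zero_mul]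
  | zero_right x hx => rw [mul_zero, map_zero, mul_zero]
  | add_left x y z _ _ _ h h' => rw [add_mul, map_add, map_add, h, h', add_mul]
  | add_right x y z _ _ _ h h' => rw [mul_add, map_add, map_add, h, h', mul_add]
  | smul_left k x y _ _ h => rw [smul_mul_assoc, map_smul, map_smul, h, smul_mul_assoc]
  | smul_right k x y _ _ h => rw [mul_smul_comm, map_smul, map_smul, h, mul_smul_comm]

/-- The character of `S^+(n, r)` of weight `z`; see `weightChar_tau`. -/
def weightChar (z : compositions n r) : borelSchur K n r →ₐ[K] K :=
  AlgHom.ofLinearMap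
    (diagCoeff K (exists_weight_eq z.2).choose ∘ₗ (borelSchur K n r).val.toLinearMap)
    (by
      change diagCoeff K _ 1 = 1
      rw [← map_one (tau K n r), diagCoeff_tau]
      simp)
    (fun x y => diagCoeff_mul K (exists_weight_eq z.2).choose x.1 y.1 x.2 y.2)

/-- An upper triangular matrix `g` acts with weight `z` as `∏ i, (g i i) ^ (z i)`. -/
theorem weightChar_tau (z : compositions n r) {g : GL (Fin n) K} (hg : g ∈ upperBorel K n) :
    weightChar K z ⟨tau K n r g, Submodule.subset_span ⟨g, hg, rfl⟩⟩ =
      ∏ i, (g : Matrix (Fin n) (Fin n) K) i i ^ (z.1 i) := by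
  have h := (exists_weight_eq z.2).choose_spec
  change diagCoeff K (exists_weight_eq z.2).choose (tau K n r g) = _
  rw [diagCoeff_tau]
  generalize (exists_weight_eq z.2).choose = f at h
  rw [← h, ← Finset.prod_fiberwise Finset.univ f]
  refine Finset.prod_congr rfl fun i _ => ?_
  rw [weight, zpow_natCast]
  refine Finset.prod_eq_pow_card fun s hs => ?_
  rw [(Finset.mem_filter.1 hs).2]

/-- The simple `S^+(n, r)`-module `K_z` of weight `z`: the one-dimensional module on which an
upper triangular matrix `g` acts as `∏ i, (g i i) ^ (z i)`. -/
@[nolint unusedArguments]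
def WeightModule (_z : compositions n r) : Type u := K

instance (z : compositions n r) : AddCommGroup (WeightModule K z) :=
  inferInstanceAs (AddCommGroup K)
instance (z : compositions n r) : Module (borelSchur K n r) (WeightModule K z) :=
  Module.compHom K (weightChar K z).toRingHom

/-- The operator by which `e_{ij}^{(k)}` acts on `V^{⊗ r}`: the sum, over all `k`-element sets of
tensor positions, of the operators that apply the matrix unit `E_{ij}` at these positions. -/
def rho (r : ℕ) (q : PosRoot n × ℕ) : Module.End K (TensorPow K n r) :=
  ∑ s ∈ Finset.powersetCard q.2 (Finset.univ : Finset (Fin r)),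
    PiTensorProduct.map fun t =>
      if t ∈ s then Matrix.toLin' (Matrix.single q.1.1.1 q.1.1.2 1) else LinearMap.id

end Schur

section Main

variable (K : Type u) [Field K] (n r : ℕ)

/-- The algebra `C_n(Λ(n, r))`, the quotient of `A_n(K) ⋉ B_n` by the ideal generated by the
idempotent of the complement of `Λ(n, r)` in `ℤ ^ n`. -/
abbrev CLambda : Type u := Trunc (kostantDeg K n) (compositions n r)

/-- The grading of `C_n(Λ(n, r))` by `Ψ_n`. -/
abbrev cLambdaDeg : Psi n → Submodule K (CLambda K n r) :=
  truncDeg (kostantDeg K n) (compositions n r)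

/-- The class of `a ⊗ b` in `C_n(Λ(n, r))`. -/
abbrev CLambda.of (a : Kostant K n) (b : (Fin n → ℤ) → K) : CLambda K n r :=
  Trunc.of (kostantDeg K n) (compositions n r) a b

variable {n r}

/-- The functor `C_n(Λ(n, r)) ⊗_{C_n(K)} (- ⋉ N_z)` from graded modules over the Kostant form to
graded `C_n(Λ(n, r))`-modules. -/
def gradedF (z : compositions n r) : GrMod (kostantDeg K n) ⥤ GrMod (cLambdaDeg K n r) :=
  truncFunctor (kostantDeg K n) (compositions n r) (z : Fin n → ℤ)

variable {K} in
/-- The functor `F_z` from graded modules over the Kostant form to (ungraded) `S^+(n, r)`-modules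
that `gradedF` becomes through an isomorphism of `C_n(Λ(n, r))` with `S^+(n, r)`. -/
def schurF (Φ : CLambda K n r ≃ₐ[K] borelSchur K n r) (z : compositions n r) :
    GrMod (kostantDeg K n) ⥤ ModuleCat.{u} (borelSchur K n r) :=
  gradedF K z ⋙ GrMod.forgetGrading (cLambdaDeg K n r) ⋙
    ModuleCat.restrictScalars (Φ.symm : borelSchur K n r →+* CLambda K n r)

end Main

end KostantSchur

end

open KostantSchur

/-! Write `A` for the Kostant form over `K`, `C` for its skew product with the functions on `ℤ ^ n`,
and `Λ` for `compositions n r`.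

The isomorphism. Divided powers of root vectors act on tensor powers of `ℂ ^ n` by matrices with
entries `0` and `1`, so `A` acts on the tensor powers of `K ^ n` for every `K`. Straightening
(`dp_mul_dp_of_commutator`) shows that the monomials in divided powers, with the rows of the
positive roots in decreasing order, span `A`; their matrices show that they are independent
(`linearIndependent_pbw`). In `C(Λ)`, a monomial times the indicator of a weight `w` is zero unless
its exponents fit into columns with the sums `w` (`of_pbw_indicator_eq_zero`). So `C(Λ)` is spanned
by elements indexed by the upper triangular matrices of natural numbers with total `r`. These
elements act on the `r`-th tensor power by `0`-`1` matrices with disjoint supports, and the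
representation is injective (`weightRep_injective`). Its image is the span of the operators of the
upper triangular `g`: over an infinite field, a polynomial that vanishes on all invertible upper
triangular matrices vanishes identically as a polynomial in the entries on and above the diagonal
(`orbMat_mem`).

The functor. The module `F_z(M)` is the quotient of `M` by the submodule generated by the components
`M_γ` with `γ + z` outside `Λ` (`toTrunc_eq_zero`). The coordinates of `γ` add up to `0`, so these
are the `γ` for which `γ + z` has a negative coordinate. A homogeneous dual basis of a projective
`P` yields one of `F_z(P)`, hence projectivity; the difficult point is exactness.

Exactness. The negative coordinates are removed one at a time. Let `R_k` and `L_k` be generated by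
the divided powers of `e_{ij}` with `i ≥ k` and with `i < k`. Then `A = R_k L_k`
(`rowAlg_mul_lowAlg`), and the coordinate `k` of a degree is nonnegative on `R_k` and nonpositive on
`L_k`. Hence the components with `(γ + z)_k < 0` generate the same submodule over `R_k` as over `A`,
and in a graded free `R_k`-module this is the summand on the basis elements of such degrees
(`truncates_negAt`). These summands of the resolution form an exact subcomplex: the trivial module
has no such components, and the cycles split off step by step (`Truncates.exists_preimage`). So the
quotient complex is still exact. Its terms have homogeneous dual bases over `R_k`, hence over
`R_{k+1}`, because `R_k` is graded free over `R_{k+1}`, and the next coordinate can be treated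
(`exists_sub_mem_spanDeg`).

Minimality. The graded radical of `A` lies in the augmentation ideal, whose elements have only
components of positive height. In `C(Λ)` heights are bounded by `n r`, so homogeneous elements of
positive height lie in the graded radical and in the Jacobson radical. -/

noncomputable section

namespace KostantSchur

/-! ### Action of the Kostant form on tensor powers by integral matrices -/

section MatrixRep

/-- Multi-indices, which index the standard basis of the tensor power. -/
abbrev Idx (n r : ℕ) : Type := Fin r → Fin n

variable {K : Type u} [Field K] {n r : ℕ}

variable (K n r) in
/-- The standard basis of the tensor power. -/
def tensorBasis : Module.Basis (Idx n r) K (TensorPow K n r) :=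
  Basis.piTensorProduct fun _ => Pi.basisFun K (Fin n)

theorem tensorBasis_apply (f : Idx n r) : tensorBasis K n r f = basisVec K f := by
  unfold tensorBasis basisVec
  rw [Basis.piTensorProduct_apply]
  simp

variable (K n r) in
/-- The matrix of an operator on the tensor power. -/
def toMat : Module.End K (TensorPow K n r) ≃ₐ[K] Matrix (Idx n r) (Idx n r) K :=
  LinearMap.toMatrixAlgEquiv (tensorBasis K n r)

theorem toMat_apply (x : Module.End K (TensorPow K n r)) (g f : Idx n r) :
    toMat K n r x g f = (tensorBasis K n r).repr (x (basisVec K f)) g := by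
  unfold toMat
  rw [LinearMap.toMatrixAlgEquiv_apply, tensorBasis_apply]

theorem toMat_map (φ : Fin r → (Fin n → K) →ₗ[K] (Fin n → K)) (g f : Idx n r) :
    toMat K n r (PiTensorProduct.map φ) g f = ∏ s, φ s (Pi.single (f s) 1) (g s) := by
  rw [toMat_apply, basisVec, PiTensorProduct.map_tprod, tensorBasis,
    Basis.piTensorProduct_repr_tprod_apply]
  simp

/-- The matrix of the operator by which `e_{ij}^{(k)}` acts on the tensor power. -/
def rhoM (R : Type*) [CommRing R] (r : ℕ) (q : PosRoot n × ℕ) : Matrix (Idx n r) (Idx n r) R :=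
  Matrix.of fun g f =>
    if (∀ s, g s = f s ∨ (g s = q.1.1.1 ∧ f s = q.1.1.2)) ∧
      (Finset.univ.filter fun s => g s ≠ f s).card = q.2 then 1 else 0

theorem rhoM_apply (R : Type*) [CommRing R] (q : PosRoot n × ℕ) (g f : Idx n r) :
    rhoM R r q g f = if (∀ s, g s = f s ∨ (g s = q.1.1.1 ∧ f s = q.1.1.2)) ∧
      (Finset.univ.filter fun s => g s ≠ f s).card = q.2 then 1 else 0 := rfl

theorem single_apply_single (i j k l : Fin n) :
    Matrix.toLin' (Matrix.single i j (1 : K)) (Pi.single k 1) l =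
      if l = i ∧ k = j then 1 else 0 := by
  rw [Matrix.toLin'_apply, Matrix.mulVec_single_one, Matrix.col_apply, Matrix.single_apply]
  simp only [eq_comm]

/-- As `i ≠ j`, the term of a set `S` of positions has a nonzero entry at `(g, f)` only if `S` is
exactly the set where `g` and `f` differ. At most one term survives, so the entries are `0` and `1`.
-/
theorem toMat_rho (q : PosRoot n × ℕ) : toMat K n r (rho K r q) = rhoM K r q := by
  ext g f
  obtain ⟨⟨⟨i, j⟩, hij⟩, k⟩ := q
  have hij' : i ≠ j := ne_of_lt hij
  unfold rho
  rw [map_sum, Matrix.sum_apply, rhoM_apply]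
  have h1 : ∀ S : Finset (Fin r), toMat K n r (PiTensorProduct.map fun t =>
      if t ∈ S then Matrix.toLin' (Matrix.single i j (1 : K)) else LinearMap.id) g f =
      if (∀ s, g s = f s ∨ (g s = i ∧ f s = j)) ∧
        S = Finset.univ.filter (fun s => g s ≠ f s) then 1 else 0 := by
    intro S
    rw [toMat_map]
    have h2 : ∀ s, (if s ∈ S then Matrix.toLin' (Matrix.single i j (1 : K)) else LinearMap.id)
        (Pi.single (f s) 1) (g s) =
        if (s ∈ S ∧ g s = i ∧ f s = j) ∨ (s ∉ S ∧ g s = f s) then 1 else 0 := by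
      intro s
      by_cases hs : s ∈ S
      · rw [if_pos hs, single_apply_single]
        simp [hs]
      · rw [if_neg hs, LinearMap.id_apply, Pi.single_apply]
        simp [hs]
    simp only [h2]
    rw [Finset.prod_ite_zero]
    simp only [Finset.prod_const_one]
    congr 1
    apply propext
    constructor
    · intro h
      refine ⟨fun s => ?_, ?_⟩
      · rcases h s (Finset.mem_univ _) with h | h
        · exact Or.inr h.2
        · exact Or.inl h.2
      · ext s
        rw [Finset.mem_filter]
        rcases h s (Finset.mem_univ _) with ⟨h1, h2, h3⟩ | ⟨h1, h2⟩
        · simp [h1, h2, h3, hij']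
        · simp [h1, h2]
    · rintro ⟨h1, rfl⟩ s -
      rw [Finset.mem_filter]
      have := h1 s
      by_cases h : g s = f s
      · simp [h]
      · rw [or_iff_right h] at this
        simp [this, hij']
  rw [Finset.sum_congr rfl fun S _ => h1 S]
  by_cases h : ∀ s, g s = f s ∨ (g s = i ∧ f s = j)
  · have h' : (∀ s, g s = f s ∨ (g s = i ∧ f s = j)) = True := eq_true h
    simp only [h', true_and]
    rw [Finset.sum_ite_eq']
    congr 1
    simp [Finset.mem_powersetCard]
  · simp [h]

/-- The operator that applies a matrix at the tensor position `s`. -/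
def slot (s : Fin r) : Matrix (Fin n) (Fin n) K →ₗ[K] Module.End K (TensorPow K n r) where
  toFun x := PiTensorProduct.map (Function.update (fun _ => LinearMap.id) s (Matrix.toLin' x))
  map_add' x y := by rw [map_add, PiTensorProduct.map_update_add]
  map_smul' c x := by rw [map_smul, PiTensorProduct.map_update_smul, RingHom.id_apply]

theorem slot_mul (s : Fin r) (x y : Matrix (Fin n) (Fin n) K) :
    slot s x * slot s y = slot s (x * y) := by
  change PiTensorProduct.map _ * PiTensorProduct.map _ = PiTensorProduct.map _
  rw [← PiTensorProduct.map_mul]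
  congr 1
  funext t
  by_cases h : t = s
  · subst h
    simp [Matrix.toLin'_mul, Module.End.mul_eq_comp]
  · simp [Function.update_of_ne h, Module.End.mul_eq_comp]

theorem slot_commute {s t : Fin r} (h : s ≠ t) (x y : Matrix (Fin n) (Fin n) K) :
    slot s x * slot t y = slot t y * slot s x := by
  change PiTensorProduct.map _ * PiTensorProduct.map _ =
    PiTensorProduct.map _ * PiTensorProduct.map _
  rw [← PiTensorProduct.map_mul, ← PiTensorProduct.map_mul]
  congr 1
  funext a
  by_cases h1 : a = s
  · subst h1
    simp [Function.update_of_ne h, Module.End.mul_eq_comp]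
  · simp [Function.update_of_ne h1, Module.End.mul_eq_comp]

/-- Operators at different positions commute, so only the diagonal terms of the double sum survive.
-/
theorem sum_commutator {R : Type*} [Ring R] (a b : Fin r → R)
    (h : ∀ s t, s ≠ t → a s * b t = b t * a s) :
    ∑ s, (a s * b s - b s * a s) = (∑ s, a s) * (∑ s, b s) - (∑ s, b s) * (∑ s, a s) := by
  rw [Finset.sum_mul_sum, Finset.sum_mul_sum,
    Finset.sum_comm (f := fun s t => b s * a t), ← Finset.sum_sub_distrib]
  refine Finset.sum_congr rfl fun s _ => ?_
  rw [← Finset.sum_sub_distrib, Finset.sum_eq_single s]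
  · intro t _ hts
    rw [h s t hts.symm, sub_self]
  · exact fun h => absurd (Finset.mem_univ _) h

theorem sum_slot_commutator (x y : Matrix (Fin n) (Fin n) K) :
    ∑ s : Fin r, slot s (x * y - y * x) =
      (∑ s : Fin r, slot s x) * (∑ s : Fin r, slot s y) -
        (∑ s : Fin r, slot s y) * (∑ s : Fin r, slot s x) := by
  refine Eq.trans ?_ (sum_commutator (fun s => slot s x) (fun s => slot s y)
    fun s t h => slot_commute h x y)
  refine Finset.sum_congr rfl fun s _ => ?_
  rw [map_sub, slot_mul, slot_mul]

section Lie

attribute [local instance] LieRing.ofAssociativeRing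

variable (n r) in
/-- The action of strictly upper triangular matrices on the tensor power by derivations. -/
def tensorLie : slPlus n →ₗ⁅ℂ⁆ Matrix (Idx n r) (Idx n r) ℂ where
  toFun x := toMat ℂ n r (∑ s, slot s (x : Matrix (Fin n) (Fin n) ℂ))
  map_add' x y := by
    simp [Finset.sum_add_distrib]
  map_smul' c x := by
    simp [Finset.smul_sum]
  map_lie' {x y} := by
    obtain ⟨x, hx⟩ := x
    obtain ⟨y, hy⟩ := y
    change toMat ℂ n r (∑ s, slot s (x * y - y * x)) =
      toMat ℂ n r (∑ s, slot s x) * toMat ℂ n r (∑ s, slot s y) -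
        toMat ℂ n r (∑ s, slot s y) * toMat ℂ n r (∑ s, slot s x)
    rw [sum_slot_commutator, ← map_mul, ← map_mul, ← map_sub]

theorem toMat_slot_single (s : Fin r) (i j : Fin n) (g f : Idx n r) :
    toMat K n r (slot s (Matrix.single i j 1)) g f =
      if g = Function.update f s i ∧ f s = j then 1 else 0 := by
  change toMat K n r (PiTensorProduct.map _) g f = _
  rw [toMat_map]
  have h2 : ∀ t, (Function.update (fun _ => LinearMap.id) s
      (Matrix.toLin' (Matrix.single i j (1 : K))) : Fin r → (Fin n → K) →ₗ[K] (Fin n → K)) t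
        (Pi.single (f t) 1) (g t) =
        if (t = s ∧ g t = i ∧ f t = j) ∨ (t ≠ s ∧ g t = f t) then 1 else 0 := by
    intro t
    by_cases h : t = s
    · subst h
      rw [Function.update_self, single_apply_single]
      simp
    · rw [Function.update_of_ne h, LinearMap.id_apply, Pi.single_apply]
      simp [h]
  simp only [h2]
  rw [Finset.prod_ite_zero]
  simp only [Finset.prod_const_one]
  congr 1
  apply propext
  constructor
  · intro h
    refine ⟨funext fun t => ?_, ?_⟩
    · by_cases ht : t = s
      · subst ht
        simpa using (h t (Finset.mem_univ _)).elim (fun h => h.2.1) (fun h => absurd rfl h.1)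
      · rw [Function.update_of_ne ht]
        exact (h t (Finset.mem_univ _)).elim (fun h => absurd h.1 ht) (fun h => h.2)
    · exact (h s (Finset.mem_univ _)).elim (fun h => h.2.2) (fun h => absurd rfl h.1)
  · rintro ⟨rfl, h⟩ t -
    by_cases ht : t = s
    · subst ht
      simp [h]
    · simp [ht]

/-- The only intermediate index is `f` with its letter at `s` changed from `j` to `i`. Summed over
`s`, the condition `g s ≠ f s` holds `k + 1` times, which gives the factor in `rhoM_mul_tensorLie`.
-/
theorem rhoM_mul_slot (p : PosRoot n) (k : ℕ) (s : Fin r) (g f : Idx n r) :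
    (rhoM K r (p, k) * toMat K n r (slot s (Matrix.single p.1.1 p.1.2 1))) g f =
      if g s ≠ f s then rhoM K r (p, k + 1) g f else 0 := by
  obtain ⟨⟨i, j⟩, hij⟩ := p
  have hij' : i ≠ j := ne_of_lt hij
  rw [Matrix.mul_apply]
  simp only [toMat_slot_single]
  rw [Finset.sum_eq_single (Function.update f s i)]
  rotate_left
  · intro h _ hh
    simp [hh]
  · exact fun h => absurd (Finset.mem_univ _) h
  rw [rhoM_apply, rhoM_apply]
  simp only [true_and]
  by_cases hf : f s = j
  · simp only [hf, if_true, mul_one]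
    by_cases hg : g s = i
    · rw [if_pos (show g s ≠ j from fun h => hij' (hg.symm.trans h))]
      congr 1
      apply propext
      have e1 : (∀ t, g t = Function.update f s i t ∨ g t = i ∧ Function.update f s i t = j) ↔
          ∀ t, g t = f t ∨ g t = i ∧ f t = j := by
        refine forall_congr' fun t => ?_
        by_cases ht : t = s
        · subst ht
          simp [hg, hf]
        · simp [ht]
      have e2 : (Finset.univ.filter fun t => g t ≠ f t) =
          insert s (Finset.univ.filter fun t => g t ≠ Function.update f s i t) := by
        ext t
        by_cases ht : t = s
        · subst ht
          simp [hg, hf, hij']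
        · simp [ht]
      rw [e1, e2, Finset.card_insert_of_notMem (by simp [hg]), Nat.add_right_cancel_iff]
    · rw [if_neg, eq_comm]
      · split_ifs with h1 h2
        · exact absurd ((h2.1 s).resolve_left (by rw [hf]; exact h1)).1 hg
        · rfl
        · rfl
      · rintro ⟨h, -⟩
        have := h s
        simp [hg, hij'] at this
  · simp only [hf, if_false, mul_zero]
    rw [eq_comm]
    split_ifs with h1 h2
    · exact absurd ((h2.1 s).resolve_left h1).2 hf
    · rfl
    · rfl

theorem tensorLie_rootVec (p : PosRoot n) :
    tensorLie n r (rootVec p) = ∑ s, toMat ℂ n r (slot s (Matrix.single p.1.1 p.1.2 1)) :=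
  map_sum (toMat ℂ n r) _ _

theorem rhoM_mul_tensorLie (p : PosRoot n) (k : ℕ) :
    rhoM ℂ r (p, k) * tensorLie n r (rootVec p) = ((k + 1 : ℕ) : ℂ) • rhoM ℂ r (p, k + 1) := by
  ext g f
  rw [tensorLie_rootVec, Finset.mul_sum, Matrix.sum_apply]
  simp only [rhoM_mul_slot]
  rw [← Finset.sum_filter, Finset.sum_const, Matrix.smul_apply, nsmul_eq_mul, smul_eq_mul,
    rhoM_apply]
  split_ifs with h
  · rw [h.2]
  · simp

theorem rhoM_zero (R : Type*) [CommRing R] (p : PosRoot n) : rhoM R r (p, 0) = 1 := by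
  ext g f
  rw [rhoM_apply, Matrix.one_apply]
  congr 1
  apply propext
  rw [Finset.card_eq_zero, Finset.filter_eq_empty_iff]
  constructor
  · intro h
    funext s
    exact not_not.1 (h.2 (Finset.mem_univ s))
  · rintro rfl
    simp

variable (n r) in
/-- The representation of the enveloping algebra on the tensor power. -/
def tensorRep : UPlus n →ₐ[ℂ] Matrix (Idx n r) (Idx n r) ℂ :=
  UniversalEnvelopingAlgebra.lift ℂ (tensorLie n r)

/-- By `rhoM_mul_tensorLie`, the power `e ^ k` acts as `k!` times a `0`-`1` matrix and the factorial
cancels. This integrality lets the action restrict to the Kostant form over `ℤ` and pass to any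
field. -/
theorem tensorRep_divPow (q : PosRoot n × ℕ) : tensorRep n r (divPow q) = rhoM ℂ r q := by
  obtain ⟨p, k⟩ := q
  have h : (tensorLie n r (rootVec p)) ^ k = (k.factorial : ℂ) • rhoM ℂ r (p, k) := by
    induction k with
    | zero => simp [rhoM_zero]
    | succ k ih =>
      rw [pow_succ, ih, smul_mul_assoc, rhoM_mul_tensorLie, smul_smul, Nat.factorial_succ]
      push_cast
      rw [mul_comm]
  unfold tensorRep divPow
  rw [map_smul, map_pow, UniversalEnvelopingAlgebra.lift_ι_apply, h, smul_smul,
    inv_mul_cancel₀ (by exact_mod_cast k.factorial_ne_zero), one_smul]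

end Lie

variable (n r) in
/-- Integral matrices as matrices over a commutative ring. -/
def castMat (R : Type*) [CommRing R] :
    Matrix (Idx n r) (Idx n r) ℤ →ₐ[ℤ] Matrix (Idx n r) (Idx n r) R :=
  (Algebra.ofId ℤ R).mapMatrix

theorem castMat_injective : Function.Injective (castMat n r ℂ) :=
  Matrix.map_injective (RingHom.injective_int (Int.castRingHom ℂ))

theorem castMat_rhoM (R : Type*) [CommRing R] (q : PosRoot n × ℕ) :
    castMat n r R (rhoM ℤ r q) = rhoM R r q := by
  ext g f
  change algebraMap ℤ R (rhoM ℤ r q g f) = _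
  rw [rhoM_apply, rhoM_apply]
  split_ifs <;> simp

theorem tensorRep_mem (u : kostantZ n) : tensorRep n r u ∈ (castMat n r ℂ).range := by
  have h : kostantZ n ≤ (castMat n r ℂ).range.comap ((tensorRep n r).restrictScalars ℤ) := by
    refine Algebra.adjoin_le ?_
    rintro _ ⟨q, rfl⟩
    exact ⟨rhoM ℤ r q, (castMat_rhoM ℂ q).trans (tensorRep_divPow q).symm⟩
  exact h u.2

variable (n r) in
/-- The representation of the integral Kostant form on the tensor power. -/
def intRep : kostantZ n →ₐ[ℤ] Matrix (Idx n r) (Idx n r) ℤ :=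
  (AlgEquiv.ofInjective (castMat n r ℂ) castMat_injective).symm.toAlgHom.comp
    ((((tensorRep n r).restrictScalars ℤ).comp (kostantZ n).val).codRestrict _ tensorRep_mem)

theorem castMat_intRep (u : kostantZ n) : castMat n r ℂ (intRep n r u) = tensorRep n r u :=
  congrArg Subtype.val
    ((AlgEquiv.ofInjective (castMat n r ℂ) castMat_injective).apply_symm_apply
      ⟨tensorRep n r u, tensorRep_mem u⟩)

theorem intRep_divPowZ (q : PosRoot n × ℕ) : intRep n r (divPowZ q) = rhoM ℤ r q := by
  apply castMat_injective
  rw [castMat_intRep]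
  exact (tensorRep_divPow q).trans (castMat_rhoM ℂ q).symm

variable (K n r) in
/-- The representation of the Kostant form on the tensor power. -/
def kostantRep : Kostant K n →ₐ[K] Matrix (Idx n r) (Idx n r) K :=
  Algebra.TensorProduct.lift (Algebra.ofId K _)
    ((castMat n r K).comp (intRep n r))
    (fun k _ => (Algebra.commutes k _ : Commute _ _))

theorem kostantRep_divPowK (q : PosRoot n × ℕ) :
    kostantRep K n r (divPowK K q) = rhoM K r q := by
  have h : kostantRep K n r (divPowK K q) =
      Algebra.ofId K (Matrix (Idx n r) (Idx n r) K) 1 * castMat n r K (intRep n r (divPowZ q)) :=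
    Algebra.TensorProduct.lift_tmul _ _ _ _ _
  rw [h, map_one, one_mul, intRep_divPowZ, castMat_rhoM]

end MatrixRep

end KostantSchur

end

noncomputable section

namespace KostantSchur

/-! ### Ordered monomials in divided powers and their linear independence -/

section Monomials

variable {n : ℕ}

/-- The positive roots `v_k - v_j` for a fixed `k`. -/
def rowRoots (n k : ℕ) : List (PosRoot n) :=
  (Finset.univ.filter fun p : PosRoot n => (p.1.1 : ℕ) = k).toList

theorem mem_rowRoots {k : ℕ} {p : PosRoot n} : p ∈ rowRoots n k ↔ (p.1.1 : ℕ) = k := by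
  simp [rowRoots]

/-- The positive roots `v_i - v_j` with `k ≤ i < k + d`, with decreasing `i`. -/
def rootsFrom (n : ℕ) : ℕ → ℕ → List (PosRoot n)
  | _, 0 => []
  | k, d + 1 => rootsFrom n (k + 1) d ++ rowRoots n k

theorem mem_rootsFrom {k d : ℕ} {p : PosRoot n} :
    p ∈ rootsFrom n k d ↔ k ≤ p.1.1 ∧ (p.1.1 : ℕ) < k + d := by
  induction d generalizing k with
  | zero => simp [rootsFrom]
  | succ d ih =>
    rw [rootsFrom, List.mem_append, ih, mem_rowRoots]
    omega

theorem rootsFrom_append (k m d : ℕ) :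
    rootsFrom n k (m + d) = rootsFrom n (k + m) d ++ rootsFrom n k m := by
  induction m generalizing k with
  | zero => simp [rootsFrom]
  | succ m ih =>
    rw [Nat.add_right_comm, rootsFrom, ih, rootsFrom, List.append_assoc, Nat.add_right_comm,
      Nat.add_assoc]

theorem nodup_rootsFrom (k d : ℕ) : (rootsFrom n k d).Nodup := by
  induction d generalizing k with
  | zero => exact List.nodup_nil
  | succ d ih =>
    refine List.nodup_append.2 ⟨ih _, Finset.nodup_toList _, ?_⟩
    rintro p hp _ hp' rfl
    rw [mem_rootsFrom] at hp
    rw [mem_rowRoots] at hp'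
    omega

theorem pairwise_rootsFrom (k d : ℕ) :
    (rootsFrom n k d).Pairwise fun q p => p.1.1 ≤ q.1.1 := by
  induction d generalizing k with
  | zero => exact List.Pairwise.nil
  | succ d ih =>
    refine List.pairwise_append.2 ⟨ih _, ?_, ?_⟩
    · refine List.Pairwise.imp_of_mem (R := fun _ _ => True) ?_
        (List.pairwise_iff_forall_sublist.2 fun _ => trivial)
      intro a b ha hb _
      rw [mem_rowRoots] at ha hb
      exact Fin.le_def.2 (by omega)
    · intro a ha b hb
      rw [mem_rootsFrom] at ha
      rw [mem_rowRoots] at hb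
      exact Fin.le_def.2 (by omega)

/-- The product of the divided powers with exponents `T` over a list of positive roots. -/
def mon (K : Type u) [Field K] (l : List (PosRoot n)) (T : PosRoot n → ℕ) : Kostant K n :=
  (l.map fun p => divPowK K (p, T p)).prod

variable {r : ℕ}

/-- The factor of `q = (i, j)` acts after the roots of `l`. These have first index at most `i < j`,
so none of them writes the letter `j`. Hence each position changes at most once, and the
intermediate index is determined by `g` and `f`. -/
theorem rhoM_mul_apply {R : Type*} [CommRing R] (q : PosRoot n) (l : List (PosRoot n))
    (hq : q ∉ l) (hl : ∀ p ∈ l, p.1.1 ≤ q.1.1) (T : PosRoot n → ℕ)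
    (X : Matrix (Idx n r) (Idx n r) R)
    (hX : ∀ g f, X g f = if (∀ s, g s = f s ∨ ∃ p ∈ l, g s = p.1.1 ∧ f s = p.1.2) ∧
      ∀ p ∈ l, (Finset.univ.filter fun s => g s = p.1.1 ∧ f s = p.1.2).card = T p then 1 else 0)
    (g f : Idx n r) :
    (rhoM R r (q, T q) * X) g f =
      if (∀ s, g s = f s ∨ ∃ p ∈ q :: l, g s = p.1.1 ∧ f s = p.1.2) ∧
      ∀ p ∈ q :: l, (Finset.univ.filter fun s => g s = p.1.1 ∧ f s = p.1.2).card = T p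
      then 1 else 0 := by
  obtain ⟨⟨i, j⟩, hij⟩ := q
  have hij' : i ≠ j := ne_of_lt hij
  -- The intermediate index: `q` is undone exactly where the pair `(g, f)` is `(i, j)`.
  let h0 : Idx n r := fun s => if g s = i ∧ f s = j then j else g s
  have h0s : ∀ s, h0 s = if g s = i ∧ f s = j then j else g s := fun _ => rfl
  rw [Matrix.mul_apply, Finset.sum_eq_single h0]
  · rw [rhoM_apply, hX, mul_ite, mul_one, mul_zero, ← ite_and]
    congr 1
    apply propext
    have e1 : ∀ s, g s = h0 s ∨ (g s = i ∧ h0 s = j) := by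
      intro s
      rw [h0s]
      split_ifs with h
      · exact Or.inr ⟨h.1, rfl⟩
      · exact Or.inl rfl
    have e2 : (Finset.univ.filter fun s => g s ≠ h0 s) =
        Finset.univ.filter fun s => g s = i ∧ f s = j := by
      ext s
      simp only [Finset.mem_filter, Finset.mem_univ, true_and, h0s]
      split_ifs with h
      · simp [h, hij']
      · simp [h]
    have e3 : ∀ p ∈ l, (Finset.univ.filter fun s => h0 s = p.1.1 ∧ f s = p.1.2) =
        Finset.univ.filter fun s => g s = p.1.1 ∧ f s = p.1.2 := by
      intro p hp
      ext s
      simp only [Finset.mem_filter, Finset.mem_univ, true_and, h0s]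
      split_ifs with h
      · constructor
        · rintro ⟨h1, h2⟩
          exact absurd (h1.symm.trans (h.2.symm.trans h2)) (ne_of_lt p.2)
        · rintro ⟨h1, h2⟩
          refine absurd hp ?_
          have : p = ⟨(i, j), hij⟩ :=
            Subtype.ext (Prod.ext (h1.symm.trans h.1) (h2.symm.trans h.2))
          rwa [this]
      · exact Iff.rfl
    have e4 : (∀ s, h0 s = f s ∨ ∃ p ∈ l, h0 s = p.1.1 ∧ f s = p.1.2) ↔
        ∀ s, g s = f s ∨ ∃ p ∈ (⟨(i, j), hij⟩ : PosRoot n) :: l, g s = p.1.1 ∧ f s = p.1.2 := by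
      refine forall_congr' fun s => ?_
      simp only [List.exists_mem_cons_iff, h0s]
      split_ifs with h
      · exact ⟨fun _ => Or.inr (Or.inl h), fun _ => Or.inl h.2.symm⟩
      · simp [h]
    rw [← e4, e2, List.forall_mem_cons]
    constructor
    · rintro ⟨⟨h3, h4⟩, h1, h2⟩
      exact ⟨h3, h2, fun p hp => (congrArg Finset.card (e3 p hp)).symm.trans (h4 p hp)⟩
    · rintro ⟨h1, h2, h3⟩
      exact ⟨⟨h1, fun p hp => (congrArg Finset.card (e3 p hp)).trans (h3 p hp)⟩, e1, h2⟩
  · intro h _ hh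
    rw [rhoM_apply, hX, mul_ite, mul_one, mul_zero, ← ite_and, if_neg]
    rintro ⟨⟨h2, -⟩, h1, -⟩
    apply hh
    funext s
    rw [h0s]
    rcases h1 s with h3 | ⟨h3, h4⟩
    · rw [← h3]
      split_ifs with h5
      -- Here `l` would already have changed `j` to `i`, which only the root `q` does.
      · exfalso
        rcases h2 s with h6 | ⟨p, hp, h6, h7⟩
        · exact hij' (h5.1.symm.trans (h3.trans (h6.trans h5.2)))
        · have : p = ⟨(i, j), hij⟩ :=
            Subtype.ext (Prod.ext (h6.symm.trans (h3.symm.trans h5.1)) (h7.symm.trans h5.2))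
          exact hq (this ▸ hp)
      · rfl
    · rw [h4]
      rw [if_pos]
      refine ⟨h3, ?_⟩
      rcases h2 s with h6 | ⟨p, hp, h6, h7⟩
      · rw [← h6, h4]
      -- A root of `l` that wrote the letter `j` would have first index `j`, which exceeds `i`.
      · have := hl p hp
        rw [← h6, h4] at this
        exact absurd hij (not_lt_of_ge this)
  · exact fun h => absurd (Finset.mem_univ _) h

theorem prod_rhoM_apply {R : Type*} [CommRing R] (l : List (PosRoot n)) (hl : l.Nodup)
    (hl' : l.Pairwise fun q p => p.1.1 ≤ q.1.1) (T : PosRoot n → ℕ) (g f : Idx n r) :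
    (l.map fun p => rhoM R r (p, T p)).prod g f =
      if (∀ s, g s = f s ∨ ∃ p ∈ l, g s = p.1.1 ∧ f s = p.1.2) ∧
      ∀ p ∈ l, (Finset.univ.filter fun s => g s = p.1.1 ∧ f s = p.1.2).card = T p
      then 1 else 0 := by
  induction l generalizing g f with
  | nil => simp [Matrix.one_apply, funext_iff]
  | cons q l ih =>
    rw [List.nodup_cons] at hl
    rw [List.pairwise_cons] at hl'
    rw [List.map_cons, List.prod_cons]
    exact rhoM_mul_apply q l hl.1 hl'.1 T _ (ih hl.2 hl'.2) g f

/-- The ordered monomials in the divided powers. -/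
def pbw (K : Type u) [Field K] (T : PosRoot n → ℕ) : Kostant K n := mon K (rootsFrom n 0 n) T

variable {K : Type u} [Field K]

theorem mem_rootsFrom_zero (p : PosRoot n) : p ∈ rootsFrom n 0 n :=
  mem_rootsFrom.2 ⟨Nat.zero_le _, by omega⟩

/-- Every positive root occurs in the list, so the pairs at which `g` and `f` differ are only
constrained by `g s < f s` and by their multiplicities. The pairs `(i, i)` stay free; in
`weightRep_orbElt` the weight of `f` fixes them. -/
theorem kostantRep_pbw (T : PosRoot n → ℕ) (g f : Idx n r) :
    kostantRep K n r (pbw K T) g f = if (∀ s, g s ≤ f s) ∧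
      ∀ p : PosRoot n, (Finset.univ.filter fun s => g s = p.1.1 ∧ f s = p.1.2).card = T p
      then 1 else 0 := by
  unfold pbw mon
  rw [map_list_prod, List.map_map]
  have : (kostantRep K n r ∘ fun p => divPowK K (p, T p)) = fun p => rhoM K r (p, T p) :=
    funext fun p => kostantRep_divPowK _
  rw [this, prod_rhoM_apply _ (nodup_rootsFrom _ _) (pairwise_rootsFrom _ _)]
  congr 1
  apply propext
  refine and_congr (forall_congr' fun s => ?_)
    (forall_congr' fun p => by simp [mem_rootsFrom_zero])
  rw [le_iff_eq_or_lt]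
  refine or_congr Iff.rfl ⟨?_, ?_⟩
  · rintro ⟨p, -, h1, h2⟩
    rw [h1, h2]
    exact p.2
  · intro h
    exact ⟨⟨(g s, f s), h⟩, mem_rootsFrom_zero _, rfl, rfl⟩

theorem exists_card_fiber {X : Type*} [Fintype X] [DecidableEq X] (N : X → ℕ) {r : ℕ}
    (hr : ∑ x, N x = r) :
    ∃ c : Fin r → X, ∀ x, (Finset.univ.filter fun s => c s = x).card = N x := by
  have e : Fin r ≃ Σ x, Fin (N x) := (Fintype.equivFinOfCardEq (by simp [hr])).symm
  refine ⟨fun s => (e s).1, fun x => ?_⟩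
  rw [← Fintype.card_subtype,
    Fintype.card_congr (e.subtypeEquiv (q := fun p => p.1 = x) fun _ => Iff.rfl),
    Fintype.card_congr (Equiv.sigmaSubtype x), Fintype.card_fin]

/-- For a given `T`, take the tensor power of exponent `∑ p, T p` and multi-indices in which each
pair `i < j` occurs `T (i, j)` times. Among all ordered monomials, only that of `T` has a nonzero
entry there. The tensor power thus varies with the coefficient that is tested. -/
theorem linearIndependent_pbw : LinearIndependent K (pbw K : (PosRoot n → ℕ) → Kostant K n) := by
  rw [linearIndependent_iff]
  intro c hc
  ext T
  obtain ⟨s, hs⟩ := exists_card_fiber T rfl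
  have h := congrArg (fun a => kostantRep K n (∑ p, T p) a (fun t => (s t).1.1)
    (fun t => (s t).1.2)) hc
  simp only [Finsupp.linearCombination_apply, Finsupp.sum, map_sum, map_smul, Matrix.sum_apply,
    Matrix.smul_apply, kostantRep_pbw, map_zero, Matrix.zero_apply] at h
  rw [Finset.sum_eq_single T] at h
  · rw [if_pos, smul_eq_mul, mul_one] at h
    · exact h
    · refine ⟨fun t => (s t).2.le, fun p => ?_⟩
      rw [← hs p]
      congr 1
      ext t
      simp [Subtype.ext_iff, Prod.ext_iff]
  · intro T' _ hT'
    rw [if_neg, smul_zero]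
    rintro ⟨-, h⟩
    apply hT'
    funext p
    rw [← h p, ← hs p]
    congr 1
    ext t
    simp [Subtype.ext_iff, Prod.ext_iff]
  · intro h'
    rw [Finsupp.notMem_support_iff.1 h', zero_smul]

end Monomials

end KostantSchur

end

noncomputable section

namespace KostantSchur

/-! ### Products of divided powers of two elements with central commutator -/

section DividedPowers

variable {U : Type*} [Ring U] [Algebra ℂ U]

/-- The divided power `x ^ a / a!`. -/
def dp (x : U) (a : ℕ) : U := ((a.factorial : ℂ)⁻¹) • x ^ a

theorem dp_zero (x : U) : dp x 0 = 1 := by simp [dp]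

theorem mul_dp (x : U) (a : ℕ) : x * dp x a = ((a + 1 : ℕ) : ℂ) • dp x (a + 1) := by
  unfold dp
  rw [mul_smul_comm, ← pow_succ', smul_smul, Nat.factorial_succ]
  congr 1
  have := a.factorial_ne_zero
  push_cast
  have h : (a.factorial : ℂ) ≠ 0 := by exact_mod_cast this
  have h' : (a : ℂ) + 1 ≠ 0 := by exact_mod_cast a.succ_ne_zero
  field_simp

theorem dp_commute {x y : U} (h : Commute x y) (a b : ℕ) : Commute (dp x a) (dp y b) :=
  ((h.pow_pow a b).smul_left _).smul_right _

theorem dp_mul_dp (x : U) (a b : ℕ) : dp x a * dp x b = ((a + b).choose a : ℂ) • dp x (a + b) := by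
  unfold dp
  rw [smul_mul_smul_comm, ← pow_add, smul_smul]
  congr 1
  rw [Nat.cast_add_choose]
  have ha : (a.factorial : ℂ) ≠ 0 := by exact_mod_cast a.factorial_ne_zero
  have hb : (b.factorial : ℂ) ≠ 0 := by exact_mod_cast b.factorial_ne_zero
  have hc : ((a + b).factorial : ℂ) ≠ 0 := by exact_mod_cast (a + b).factorial_ne_zero
  field_simp

variable {x y z : U}

/-- The commutator with `x` is a derivation and `z` commutes with `y`, so `[x, y ^ (b + 1)] = (b +
1) y ^ b z`; division by `(b + 1)!` absorbs the coefficient. -/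
theorem mul_dp_succ (h : x * y = y * x + z) (hy : Commute y z) (b : ℕ) :
    x * dp y (b + 1) = dp y (b + 1) * x + dp y b * z := by
  have key : ∀ b : ℕ, x * y ^ (b + 1) = y ^ (b + 1) * x + ((b + 1 : ℕ) : ℂ) • (y ^ b * z) := by
    intro b
    induction b with
    | zero => simp [h]
    | succ b ih =>
      rw [pow_succ, ← mul_assoc, ih, add_mul, mul_assoc, h, mul_add, ← mul_assoc, ← pow_succ,
        smul_mul_assoc, mul_assoc, ← hy.eq, ← mul_assoc, ← pow_succ, add_assoc]
      congr 1
      push_cast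
      module
  unfold dp
  rw [mul_smul_comm, key, smul_add, smul_mul_assoc, smul_mul_assoc, smul_smul, Nat.factorial_succ]
  congr 2
  have := b.factorial_ne_zero
  push_cast
  have h : (b.factorial : ℂ) ≠ 0 := by exact_mod_cast this
  have h' : (b : ℂ) + 1 ≠ 0 := by exact_mod_cast b.succ_ne_zero
  field_simp

/-- Induction on `a`: multiplication by `x` turns the term `t` into `(a + 1 - t)` times the new term
`t` plus `(t + 1)` times the new term `t + 1`. So each new term occurs `a + 1` times in `(a + 1)
x^{(a+1)} y^{(b)}`. All coefficients are `1`, which makes the formula valid in the integral form. -/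
theorem dp_mul_dp_of_commutator (h : x * y = y * x + z) (hx : Commute x z) (hy : Commute y z)
    (a b : ℕ) :
    dp x a * dp y b = ∑ t ∈ Finset.range (a + 1),
      if t ≤ b then dp y (b - t) * dp z t * dp x (a - t) else 0 := by
  induction a with
  | zero => simp [dp_zero]
  | succ a ih =>
    have ha : ((a + 1 : ℕ) : ℂ) ≠ 0 := by exact_mod_cast a.succ_ne_zero
    let G : ℕ → U := fun t => if t ≤ b then dp y (b - t) * dp z t * dp x (a + 1 - t) else 0
    have hG : ∀ t, G t = if t ≤ b then dp y (b - t) * dp z t * dp x (a + 1 - t) else 0 :=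
      fun _ => rfl
    have step : ∀ t ∈ Finset.range (a + 1),
        x * (if t ≤ b then dp y (b - t) * dp z t * dp x (a - t) else 0) =
          ((a + 1 - t : ℕ) : ℂ) • G t + ((t + 1 : ℕ) : ℂ) • G (t + 1) := by
      intro t ht
      rw [Finset.mem_range] at ht
      have hxz : x * dp z t = dp z t * x := by
        exact ((hx.pow_right t).smul_right _).eq
      have e1 : a + 1 - t = a - t + 1 := by omega
      have e2 : a + 1 - (t + 1) = a - t := by omega
      have hx' : x * dp x (a - t) = ((a + 1 - t : ℕ) : ℂ) • dp x (a + 1 - t) := by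
        rw [mul_dp, e1]
      rw [hG, hG, e2]
      by_cases h1 : t ≤ b
      · rw [if_pos h1, if_pos h1]
        by_cases h2 : t + 1 ≤ b
        · rw [if_pos h2]
          obtain ⟨c, rfl⟩ : ∃ c, b = t + 1 + c := ⟨b - (t + 1), by omega⟩
          have e3 : t + 1 + c - t = c + 1 := by omega
          have e4 : t + 1 + c - (t + 1) = c := by omega
          rw [e3, e4, ← mul_assoc, ← mul_assoc, mul_dp_succ h hy, add_mul, add_mul]
          congr 1
          · rw [mul_assoc (dp y (c + 1)) x, hxz, mul_assoc (dp y (c + 1)), mul_assoc (dp z t), hx',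
              mul_smul_comm, mul_smul_comm, mul_assoc]
          · rw [mul_assoc (dp y c) z, mul_dp, mul_smul_comm, smul_mul_assoc]
        · rw [if_neg h2, smul_zero, add_zero]
          have : t = b := by omega
          subst this
          rw [Nat.sub_self, dp_zero, one_mul, ← mul_assoc, hxz, mul_assoc, hx', mul_smul_comm]
      · rw [if_neg h1, if_neg h1, if_neg (by omega)]
        simp
    have h1 : ((a + 1 : ℕ) : ℂ) • (dp x (a + 1) * dp y b) =
        ((a + 1 : ℕ) : ℂ) • ∑ t ∈ Finset.range (a + 1 + 1), G t := by
      rw [← smul_mul_assoc, ← mul_dp, mul_assoc, ih, Finset.mul_sum, Finset.sum_congr rfl step,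
        Finset.sum_add_distrib]
      -- The term `t = a + 1` added to this sum and the term `t = 0` added to the shifted sum have
      -- coefficient `0`. Together the coefficient of `G t` is `(a + 1 - t) + t`.
      have h2 : ∑ t ∈ Finset.range (a + 1), ((a + 1 - t : ℕ) : ℂ) • G t =
          ∑ t ∈ Finset.range (a + 1 + 1), ((a + 1 - t : ℕ) : ℂ) • G t := by
        rw [Finset.sum_range_succ _ (a + 1)]
        simp
      have h3 : ∑ t ∈ Finset.range (a + 1), ((t + 1 : ℕ) : ℂ) • G (t + 1) =
          ∑ t ∈ Finset.range (a + 1 + 1), (t : ℂ) • G t := by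
        rw [Finset.sum_range_succ' (fun t => (t : ℂ) • G t) (a + 1)]
        simp
      rw [h2, h3, ← Finset.sum_add_distrib, Finset.smul_sum]
      refine Finset.sum_congr rfl fun t ht => ?_
      rw [Finset.mem_range] at ht
      rw [← add_smul, ← Nat.cast_add, Nat.sub_add_cancel (by omega)]
    have := congrArg (fun v => ((a + 1 : ℕ) : ℂ)⁻¹ • v) h1
    simpa only [smul_smul, inv_mul_cancel₀ ha, one_smul] using this

end DividedPowers

/-! ### Relations between the divided powers of root vectors -/

section Relations

variable {n : ℕ}

theorem divPow_eq_dp (p : PosRoot n) (a : ℕ) :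
    divPow (p, a) = dp (UniversalEnvelopingAlgebra.ι ℂ (rootVec p)) a := rfl

theorem matVec_root (p : PosRoot n) :
    matVec p.1.1 p.1.2 = UniversalEnvelopingAlgebra.ι ℂ (rootVec p) := matVec_of_lt p.2

theorem rootVec_commute {p q : PosRoot n} (h : p.1.2 ≠ q.1.1) (h' : q.1.2 ≠ p.1.1) :
    Commute (UniversalEnvelopingAlgebra.ι ℂ (rootVec p) : UPlus n)
      (UniversalEnvelopingAlgebra.ι ℂ (rootVec q)) := by
  have := matVec_lie p.2 q.2
  rw [if_neg h, if_neg h', sub_zero, sub_eq_zero, matVec_root, matVec_root] at this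
  exact this

theorem divPow_commute {p q : PosRoot n} (h : p.1.2 ≠ q.1.1) (h' : q.1.2 ≠ p.1.1) (a b : ℕ) :
    divPow (p, a) * divPow (q, b) = divPow (q, b) * divPow (p, a) :=
  dp_commute (rootVec_commute h h') a b

theorem divPow_mul_divPow (p : PosRoot n) (a b : ℕ) :
    divPow (p, a) * divPow (p, b) = (a + b).choose a • divPow (p, a + b) := by
  rw [divPow_eq_dp, divPow_eq_dp, dp_mul_dp, ← Nat.cast_smul_eq_nsmul ℂ]
  rfl

theorem divPow_mul_divPow_of_eq {p q s : PosRoot n} (hpq : p.1.2 = q.1.1) (hs : s.1.1 = p.1.1)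
    (hs' : s.1.2 = q.1.2) (a b : ℕ) :
    divPow (p, a) * divPow (q, b) = ∑ t ∈ Finset.range (a + 1),
      if t ≤ b then divPow (q, b - t) * divPow (s, t) * divPow (p, a - t) else 0 := by
  have hq : p.1.2 < q.1.2 := lt_of_eq_of_lt hpq q.2
  refine dp_mul_dp_of_commutator ?_ (rootVec_commute ?_ ?_) (rootVec_commute ?_ ?_) a b
  · have := matVec_lie p.2 q.2
    have h3 : matVec p.1.1 q.1.2 = UniversalEnvelopingAlgebra.ι ℂ (rootVec s) := by
      rw [← hs, ← hs', matVec_root]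
    rw [if_pos hpq, if_neg (p.2.trans hq).ne', sub_zero, matVec_root, matVec_root, h3] at this
    rw [← this]
    abel
  · rw [hs]; exact p.2.ne'
  · rw [hs']; exact (p.2.trans hq).ne'
  · rw [hs]; exact (p.2.trans hq).ne'
  · rw [hs']; exact q.2.ne'

variable (K : Type u) [Field K]

/-- The ring homomorphism from the integral Kostant form to the Kostant form over `K`. -/
def ofZ (n : ℕ) : kostantZ n →+* Kostant K n :=
  (Algebra.TensorProduct.includeRight : kostantZ n →ₐ[ℤ] K ⊗[ℤ] kostantZ n).toRingHom

theorem ofZ_divPowZ (q : PosRoot n × ℕ) : ofZ K n (divPowZ q) = divPowK K q := rfl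

/-- The relations are proved in the enveloping algebra over `ℂ`; their coefficients are integers, so
they hold in the Kostant form over `ℤ` and are carried to `K` by `ofZ`. -/
theorem divPowK_commute {p q : PosRoot n} (h : p.1.2 ≠ q.1.1) (h' : q.1.2 ≠ p.1.1) (a b : ℕ) :
    divPowK K (p, a) * divPowK K (q, b) = divPowK K (q, b) * divPowK K (p, a) := by
  have : divPowZ (p, a) * divPowZ (q, b) = divPowZ (q, b) * divPowZ (p, a) :=
    Subtype.ext (divPow_commute h h' a b)
  simp only [← ofZ_divPowZ, ← map_mul, this]

theorem divPowK_mul_divPowK (p : PosRoot n) (a b : ℕ) :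
    divPowK K (p, a) * divPowK K (p, b) = (a + b).choose a • divPowK K (p, a + b) := by
  have : divPowZ (p, a) * divPowZ (p, b) = (a + b).choose a • divPowZ (p, a + b) :=
    Subtype.ext ((divPow_mul_divPow p a b).trans (by simp [divPowZ]))
  simp only [← ofZ_divPowZ, ← map_mul, this, map_nsmul]

theorem divPowK_mul_divPowK_of_eq {p q s : PosRoot n} (hpq : p.1.2 = q.1.1) (hs : s.1.1 = p.1.1)
    (hs' : s.1.2 = q.1.2) (a b : ℕ) :
    divPowK K (p, a) * divPowK K (q, b) = ∑ t ∈ Finset.range (a + 1),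
      if t ≤ b then divPowK K (q, b - t) * divPowK K (s, t) * divPowK K (p, a - t) else 0 := by
  have : divPowZ (p, a) * divPowZ (q, b) = ∑ t ∈ Finset.range (a + 1),
      if t ≤ b then divPowZ (q, b - t) * divPowZ (s, t) * divPowZ (p, a - t) else 0 := by
    apply Subtype.ext
    rw [AddSubmonoidClass.coe_finsetSum]
    refine (divPow_mul_divPow_of_eq hpq hs hs' a b).trans (Finset.sum_congr rfl fun t _ => ?_)
    split_ifs <;> rfl
  simp only [← ofZ_divPowZ, ← map_mul, this, map_sum]
  refine Finset.sum_congr rfl fun t _ => ?_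
  split_ifs <;> simp

theorem divPowK_zero (p : PosRoot n) : divPowK K (p, 0) = 1 := by
  have : divPowZ (p, 0) = 1 := Subtype.ext (dp_zero _)
  rw [← ofZ_divPowZ, this, map_one]

end Relations

end KostantSchur

end

noncomputable section

namespace KostantSchur

/-! ### Straightening: the ordered monomials span -/

section Span

variable {n : ℕ} {K : Type u} [Field K] {B : Type u} [Ring B] [Algebra K B]
  (E : PosRoot n → ℕ → B)

variable (K) in
/-- The span of the divided powers of one root vector. -/
def dpSpan (p : PosRoot n) : Submodule K B := Submodule.span K (Set.range (E p))

/-- The relations between the divided powers of the root vectors. -/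
structure DividedPowerRelations : Prop where
  zero : ∀ p, E p 0 = 1
  mul_self : ∀ p a b, E p a * E p b = (a + b).choose a • E p (a + b)
  commute : ∀ p q a b, p.1.2 ≠ q.1.1 → q.1.2 ≠ p.1.1 → E p a * E q b = E q b * E p a
  straighten : ∀ p q s, p.1.2 = q.1.1 → s.1.1 = p.1.1 → s.1.2 = q.1.2 → ∀ a b,
    E p a * E q b = ∑ t ∈ Finset.range (a + 1),
      if t ≤ b then E q (b - t) * E s t * E p (a - t) else 0

variable {E}

theorem mem_dpSpan (p : PosRoot n) (a : ℕ) : E p a ∈ dpSpan K E p :=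
  Submodule.subset_span ⟨a, rfl⟩

theorem one_le_dpSpan (hE : DividedPowerRelations E) (p : PosRoot n) : 1 ≤ dpSpan K E p := by
  rw [Submodule.one_le, ← hE.zero p]
  exact mem_dpSpan p 0

theorem dpSpan_mul_self (hE : DividedPowerRelations E) (p : PosRoot n) :
    dpSpan K E p * dpSpan K E p ≤ dpSpan K E p := by
  unfold dpSpan
  rw [Submodule.span_mul_span, Submodule.span_le]
  rintro _ ⟨_, ⟨a, rfl⟩, _, ⟨b, rfl⟩, rfl⟩
  dsimp only
  rw [hE.mul_self]
  exact nsmul_mem (mem_dpSpan p _) _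

theorem dpSpan_commute (hE : DividedPowerRelations E) {p q : PosRoot n} (h : p.1.2 ≠ q.1.1) (h' : q.1.2 ≠ p.1.1) :
    dpSpan K E p * dpSpan K E q ≤ dpSpan K E q * dpSpan K E p := by
  conv_lhs => unfold dpSpan
  rw [Submodule.span_mul_span, Submodule.span_le]
  rintro _ ⟨_, ⟨a, rfl⟩, _, ⟨b, rfl⟩, rfl⟩
  dsimp only
  rw [hE.commute _ _ _ _ h h']
  exact Submodule.mul_mem_mul (mem_dpSpan q _) (mem_dpSpan p _)

theorem dpSpan_mul_of_eq (hE : DividedPowerRelations E) {p q s : PosRoot n} (hpq : p.1.2 = q.1.1) (hs : s.1.1 = p.1.1)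
    (hs' : s.1.2 = q.1.2) :
    dpSpan K E p * dpSpan K E q ≤ dpSpan K E q * dpSpan K E s * dpSpan K E p := by
  conv_lhs => unfold dpSpan
  rw [Submodule.span_mul_span, Submodule.span_le]
  rintro _ ⟨_, ⟨a, rfl⟩, _, ⟨b, rfl⟩, rfl⟩
  dsimp only
  rw [hE.straighten _ _ _ hpq hs hs']
  refine sum_mem fun t _ => ?_
  split_ifs
  · exact Submodule.mul_mem_mul (Submodule.mul_mem_mul (mem_dpSpan q _)
      (mem_dpSpan s _)) (mem_dpSpan p _)
  · exact zero_mem _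

variable (K E) in
/-- The span of the monomials over a list of roots. -/
def monSpan (l : List (PosRoot n)) : Submodule K B := (l.map (dpSpan K E)).prod

theorem monSpan_cons (p : PosRoot n) (l : List (PosRoot n)) :
    monSpan K E (p :: l) = dpSpan K E p * monSpan K E l := by
  rw [monSpan, List.map_cons, List.prod_cons]
  rfl

theorem monSpan_append (l l' : List (PosRoot n)) :
    monSpan K E (l ++ l') = monSpan K E l * monSpan K E l' := by
  rw [monSpan, List.map_append, List.prod_append]
  rfl

theorem one_le_monSpan (hE : DividedPowerRelations E) (l : List (PosRoot n)) : 1 ≤ monSpan K E l := by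
  induction l with
  | nil => exact le_refl _
  | cons p l ih =>
    rw [monSpan_cons, ← one_mul (1 : Submodule K B)]
    exact mul_le_mul' (one_le_dpSpan hE p) ih

theorem dpSpan_le_monSpan (hE : DividedPowerRelations E) {p : PosRoot n} {l : List (PosRoot n)} (h : p ∈ l) :
    dpSpan K E p ≤ monSpan K E l := by
  induction l with
  | nil => cases h
  | cons q l ih =>
    rw [monSpan_cons]
    rcases List.mem_cons.1 h with rfl | h
    · conv_lhs => rw [← mul_one (dpSpan K E p)]
      exact mul_le_mul' le_rfl (one_le_monSpan hE l)
    · conv_lhs => rw [← one_mul (dpSpan K E p)]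
      exact mul_le_mul' (one_le_dpSpan hE q) (ih h)

theorem dpSpan_commute_row (hE : DividedPowerRelations E) {k : ℕ} {p q : PosRoot n} (hp : p ∈ rowRoots n k)
    (hq : q ∈ rowRoots n k) : dpSpan K E p * dpSpan K E q ≤ dpSpan K E q * dpSpan K E p := by
  rw [mem_rowRoots] at hp hq
  have e : p.1.1 = q.1.1 := Fin.ext (hp.trans hq.symm)
  refine dpSpan_commute hE ?_ ?_
  · rw [← e]
    exact p.2.ne'
  · rw [e]
    exact q.2.ne'

/-- Two roots `(k, j)` and `(k, l)` of one row never compose, so the divided powers of a row commute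
and its monomials span a subalgebra. -/
theorem monSpan_row_mul_self (hE : DividedPowerRelations E) (k : ℕ) :
    monSpan K E (rowRoots n k) * monSpan K E (rowRoots n k) ≤ monSpan K E (rowRoots n k) := by
  -- Tails of a row are not rows, so the induction runs over all lists of roots of row `k`.
  have key : ∀ l : List (PosRoot n), (∀ p ∈ l, p ∈ rowRoots n k) →
      monSpan K E l * monSpan K E l ≤ monSpan K E l := by
    intro l
    induction l with
    | nil => exact fun _ => (mul_one (1 : Submodule K B)).le
    | cons p l ih =>
      intro h
      have hp : ∀ l' : List (PosRoot n), (∀ q ∈ l', q ∈ rowRoots n k) →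
          monSpan K E l' * dpSpan K E p ≤ dpSpan K E p * monSpan K E l' := by
        intro l' hl'
        induction l' with
        | nil => exact ((one_mul (dpSpan K E p)).trans (mul_one (dpSpan K E p)).symm).le
        | cons q l' ih' =>
          rw [monSpan_cons, mul_assoc]
          refine (mul_le_mul' le_rfl (ih' fun q' hq' => hl' q' (List.mem_cons_of_mem _ hq'))).trans ?_
          rw [← mul_assoc, ← mul_assoc]
          exact mul_le_mul' (dpSpan_commute_row hE (hl' q List.mem_cons_self)
            (h p List.mem_cons_self)) le_rfl
      have hl := fun q hq => h q (List.mem_cons_of_mem p hq)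
      rw [monSpan_cons, mul_assoc, ← mul_assoc (monSpan K E l)]
      refine (mul_le_mul' le_rfl (mul_le_mul' (hp l hl) le_rfl)).trans ?_
      rw [mul_assoc, ← mul_assoc (dpSpan K E p)]
      exact mul_le_mul' (dpSpan_mul_self hE p) (ih hl)
  exact key _ fun _ h => h

/-- If `p = (k, j)` and `q = (j, l)` compose, straightening creates only the root `(k, l)`, which is
again in row `k`; otherwise the two factors commute. So a row can be moved to the right of all
higher rows. -/
theorem dpSpan_row_mul (hE : DividedPowerRelations E) {k : ℕ} {p q : PosRoot n} (hp : p ∈ rowRoots n k) (hq : k < q.1.1) :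
    dpSpan K E p * dpSpan K E q ≤ dpSpan K E q * monSpan K E (rowRoots n k) := by
  have hp' := mem_rowRoots.1 hp
  by_cases h : p.1.2 = q.1.1
  · have hs : p.1.1 < q.1.2 := p.2.trans (h ▸ q.2 : p.1.2 < q.1.2)
    let s : PosRoot n := ⟨(p.1.1, q.1.2), hs⟩
    have hs' : s ∈ rowRoots n k := mem_rowRoots.2 hp'
    refine (dpSpan_mul_of_eq hE (s := s) h rfl rfl).trans ?_
    rw [mul_assoc]
    refine mul_le_mul' le_rfl ((mul_le_mul' (dpSpan_le_monSpan hE hs')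
      (dpSpan_le_monSpan hE hp)).trans (monSpan_row_mul_self hE k))
  · refine (dpSpan_commute hE h ?_).trans (mul_le_mul' le_rfl (dpSpan_le_monSpan hE hp))
    intro h'
    have h1 := Fin.lt_def.1 q.2
    have h2 := congrArg Fin.val h'
    omega

theorem monSpan_row_mul (hE : DividedPowerRelations E) {k : ℕ} (l : List (PosRoot n)) (hl : ∀ q ∈ l, k < q.1.1) :
    monSpan K E (rowRoots n k) * monSpan K E l ≤ monSpan K E l * monSpan K E (rowRoots n k) := by
  -- The list `l'` runs through tails of the row, but the result involves the full row, since
  -- straightening may create other roots of the row.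
  have h1 : ∀ q : PosRoot n, k < q.1.1 → ∀ l' : List (PosRoot n), (∀ p ∈ l', p ∈ rowRoots n k) →
      monSpan K E l' * dpSpan K E q ≤ dpSpan K E q * monSpan K E (rowRoots n k) := by
    intro q hq l' hl'
    induction l' with
    | nil =>
      refine (one_mul (dpSpan K E q)).le.trans ?_
      conv_lhs => rw [← mul_one (dpSpan K E q)]
      exact mul_le_mul' le_rfl (one_le_monSpan hE _)
    | cons p l' ih =>
      rw [monSpan_cons, mul_assoc]
      refine (mul_le_mul' le_rfl (ih fun p' hp' => hl' p' (List.mem_cons_of_mem _ hp'))).trans ?_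
      rw [← mul_assoc]
      refine (mul_le_mul' (dpSpan_row_mul hE (hl' p List.mem_cons_self) hq) le_rfl).trans ?_
      rw [mul_assoc]
      exact mul_le_mul' le_rfl (monSpan_row_mul_self hE k)
  induction l with
  | nil => exact ((mul_one (monSpan K E _)).trans (one_mul (monSpan K E _)).symm).le
  | cons q l ih =>
    rw [monSpan_cons, ← mul_assoc]
    refine (mul_le_mul' (h1 q (hl q List.mem_cons_self) _ fun _ h => h) le_rfl).trans ?_
    rw [mul_assoc, mul_assoc]
    exact mul_le_mul' le_rfl (ih fun q' hq' => hl q' (List.mem_cons_of_mem _ hq'))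

/-- With `R` the lowest row and `H` the rows above it, the inner product in `H R H R` can be
reversed, and `H H R R` is handled by induction and by `monSpan_row_mul_self`. -/
theorem monSpan_rootsFrom_mul_self (hE : DividedPowerRelations E) (k d : ℕ) :
    monSpan K E (rootsFrom n k d) * monSpan K E (rootsFrom n k d) ≤ monSpan K E (rootsFrom n k d) := by
  induction d generalizing k with
  | zero => exact (mul_one (1 : Submodule K B)).le
  | succ d ih =>
    rw [rootsFrom, monSpan_append, mul_assoc, ← mul_assoc (monSpan K E (rowRoots n k))]
    refine (mul_le_mul' le_rfl (mul_le_mul' (monSpan_row_mul hE _ fun q hq => ?_) le_rfl)).trans ?_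
    · rw [mem_rootsFrom] at hq
      omega
    · rw [mul_assoc, ← mul_assoc (monSpan K E (rootsFrom n (k + 1) d))]
      exact mul_le_mul' (ih _) (monSpan_row_mul_self hE k)

variable (K E) in
/-- The subalgebra generated by the `e_{ij}^{(a)}` with `i ≥ k`. -/
def rowAlg (k : ℕ) : Subalgebra K B :=
  Algebra.adjoin K {x | ∃ (p : PosRoot n) (a : ℕ), k ≤ p.1.1 ∧ E p a = x}

variable (K E) in
/-- The subalgebra generated by the `e_{ij}^{(a)}` with `i < k`. -/
def lowAlg (k : ℕ) : Subalgebra K B :=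
  Algebra.adjoin K {x | ∃ (p : PosRoot n) (a : ℕ), (p.1.1 : ℕ) < k ∧ E p a = x}

theorem monSpan_le_toSubmodule (l : List (PosRoot n)) (S : Subalgebra K B)
    (h : ∀ p ∈ l, ∀ a, E p a ∈ S) : monSpan K E l ≤ Subalgebra.toSubmodule S := by
  induction l with
  | nil => exact Submodule.one_le.2 S.one_mem
  | cons p l ih =>
    rw [monSpan_cons, Submodule.mul_le]
    intro x hx y hy
    refine S.mul_mem ?_ (ih (fun q hq => h q (List.mem_cons_of_mem _ hq)) hy)
    refine (Submodule.span_le (p := Subalgebra.toSubmodule S)).2 ?_ hx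
    rintro _ ⟨a, rfl⟩
    exact h p List.mem_cons_self a

theorem toSubmodule_rowAlg (hE : DividedPowerRelations E) {k d : ℕ} (h : k + d = n) :
    Subalgebra.toSubmodule (rowAlg K E k) = monSpan K E (rootsFrom n k d) := by
  apply le_antisymm
  · intro x hx
    replace hx : x ∈ rowAlg K E k := hx
    unfold rowAlg at hx
    induction hx using Algebra.adjoin_induction with
    | mem x hx =>
      obtain ⟨p, a, hp, rfl⟩ := hx
      exact dpSpan_le_monSpan hE (mem_rootsFrom.2 ⟨hp, by omega⟩) (mem_dpSpan p a)
    | algebraMap c =>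
      rw [Algebra.algebraMap_eq_smul_one]
      exact Submodule.smul_mem _ _ (Submodule.one_le.1 (one_le_monSpan hE _))
    | add x y _ _ hx hy => exact add_mem hx hy
    | mul x y _ _ hx hy => exact monSpan_rootsFrom_mul_self hE k d (Submodule.mul_mem_mul hx hy)
  · refine monSpan_le_toSubmodule _ _ fun p hp a => Algebra.subset_adjoin ⟨p, a, ?_, rfl⟩
    exact (mem_rootsFrom.1 hp).1

/-- The monomials list the rows in decreasing order, so cutting at row `k` leaves the rows `≥ k` on
the left and the rows `< k` on the right. The order of the factors matters: on a module the low rows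
act before the high ones. -/
theorem rowAlg_mul_lowAlg (hE : DividedPowerRelations E) {k : ℕ} (hk : k ≤ n) :
    Subalgebra.toSubmodule (rowAlg K E 0) ≤
      Subalgebra.toSubmodule (rowAlg K E k) * Subalgebra.toSubmodule (lowAlg K E k) := by
  obtain ⟨d, rfl⟩ := Nat.exists_eq_add_of_le hk
  rw [toSubmodule_rowAlg hE (Nat.zero_add (k + d)), rootsFrom_append, monSpan_append,
    toSubmodule_rowAlg hE (rfl : k + d = k + d), Nat.zero_add]
  refine mul_le_mul' le_rfl (monSpan_le_toSubmodule _ _ fun p hp a =>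
    Algebra.subset_adjoin ⟨p, a, ?_, rfl⟩)
  rw [mem_rootsFrom] at hp
  omega

variable (E) in
/-- The product of the divided powers with exponents `T` over a list of positive roots. -/
def monProd (l : List (PosRoot n)) (T : PosRoot n → ℕ) : B := (l.map fun p => E p (T p)).prod

theorem monProd_congr {l : List (PosRoot n)} {T T' : PosRoot n → ℕ} (h : ∀ p ∈ l, T p = T' p) :
    monProd E l T = monProd E l T' := by
  unfold monProd
  congr 1
  exact List.map_congr_left fun p hp => by rw [h p hp]

theorem monProd_append (l l' : List (PosRoot n)) (T : PosRoot n → ℕ) :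
    monProd E (l ++ l') T = monProd E l T * monProd E l' T := by
  unfold monProd
  rw [List.map_append, List.prod_append]

theorem monProd_eq_one (hE : DividedPowerRelations E) {l : List (PosRoot n)} {T : PosRoot n → ℕ} (h : ∀ p ∈ l, T p = 0) :
    monProd E l T = 1 := by
  unfold monProd
  refine List.prod_eq_one fun x hx => ?_
  obtain ⟨p, hp, rfl⟩ := List.mem_map.1 hx
  rw [h p hp, hE.zero]

theorem monSpan_eq_span {l : List (PosRoot n)} (hl : l.Nodup) :
    monSpan K E l = Submodule.span K {x | ∃ T : PosRoot n → ℕ, (∀ p, p ∉ l → T p = 0) ∧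
      monProd E l T = x} := by
  classical
  induction l with
  | nil =>
    change (1 : Submodule K B) = _
    rw [Submodule.one_eq_span]
    congr 1
    ext x
    constructor
    · rintro rfl
      exact ⟨0, fun _ _ => rfl, rfl⟩
    · rintro ⟨T, -, rfl⟩
      rfl
  | cons q l ih =>
    rw [List.nodup_cons] at hl
    rw [monSpan_cons, ih hl.2, dpSpan, Submodule.span_mul_span]
    congr 1
    ext x
    constructor
    · rintro ⟨_, ⟨a, rfl⟩, _, ⟨T, hT, rfl⟩, rfl⟩
      refine ⟨Function.update T q a, fun p hp => ?_, ?_⟩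
      · rw [List.mem_cons, not_or] at hp
        rw [Function.update_of_ne hp.1, hT p hp.2]
      · unfold monProd
        rw [List.map_cons, List.prod_cons, Function.update_self]
        dsimp only
        congr 1
        refine monProd_congr fun p hp => ?_
        rw [Function.update_of_ne]
        rintro rfl
        exact hl.1 hp
    · rintro ⟨T, hT, rfl⟩
      refine ⟨_, ⟨T q, rfl⟩, _, ⟨fun p => if p ∈ l then T p else 0, fun p hp => if_neg hp, rfl⟩, ?_⟩
      unfold monProd
      rw [List.map_cons, List.prod_cons]
      dsimp only
      congr 1
      exact monProd_congr fun p hp => if_pos hp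

end Span

end KostantSchur

end

noncomputable section

namespace KostantSchur

/-! ### Homogeneous components of degree `γ - w`, where the difference need not exist -/

section Shift

variable {K : Type u} [Field K] {Γ : Type} [AddMonoid Γ] {A : Type u} [Ring A] [Algebra K A]

/-- The span of the homogeneous components of degree `δ` with `δ + w = γ`. -/
def shiftDeg (𝒜 : Γ → Submodule K A) (γ w : Γ) : Submodule K A :=
  ⨆ δ : {δ // δ + w = γ}, 𝒜 δ

theorem mem_shiftDeg {𝒜 : Γ → Submodule K A} {γ w δ : Γ} (h : δ + w = γ) {a : A} (ha : a ∈ 𝒜 δ) :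
    a ∈ shiftDeg 𝒜 γ w :=
  Submodule.mem_iSup_of_mem (⟨δ, h⟩ : {δ // δ + w = γ}) ha

theorem shiftDeg_induction {𝒜 : Γ → Submodule K A} {γ w : Γ} {S : Submodule K A}
    (h : ∀ δ, δ + w = γ → 𝒜 δ ≤ S) : shiftDeg 𝒜 γ w ≤ S :=
  iSup_le fun δ => h δ δ.2

end Shift

/-! ### The basis of ordered monomials and the chain of row subalgebras -/

section PBW

variable {K : Type u} [Field K] {n : ℕ}

theorem kostant_relations :
    DividedPowerRelations (fun (p : PosRoot n) a => divPowK K (p, a)) where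
  zero := divPowK_zero K
  mul_self := divPowK_mul_divPowK K
  commute _ _ a b h h' := divPowK_commute K h h' a b
  straighten _ _ _ h hs hs' := divPowK_mul_divPowK_of_eq K h hs hs'

variable (K n) in
/-- The subalgebra of the Kostant form generated by the `e_{ij}^{(a)}` with `i ≥ k`. -/
abbrev kRow (k : ℕ) : Subalgebra K (Kostant K n) :=
  rowAlg K (fun (p : PosRoot n) a => divPowK K (p, a)) k

variable (K n) in
/-- The subalgebra of the Kostant form generated by the `e_{ij}^{(a)}` with `i < k`. -/
abbrev kLow (k : ℕ) : Subalgebra K (Kostant K n) :=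
  lowAlg K (fun (p : PosRoot n) a => divPowK K (p, a)) k

theorem kRow_zero : kRow K n 0 = ⊤ := by
  rw [eq_top_iff]
  rintro x -
  have hx : x ∈ ⨆ γ, kostantDeg K n γ := by rw [iSup_deg]; trivial
  refine (iSup_le fun γ => ?_ : ⨆ γ, kostantDeg K n γ ≤ Subalgebra.toSubmodule (kRow K n 0)) hx
  refine Submodule.span_le.2 ?_
  rintro _ ⟨l, -, rfl⟩
  change _ ∈ kRow K n 0
  refine list_prod_mem fun y hy => ?_
  obtain ⟨⟨p, a⟩, -, rfl⟩ := List.mem_map.1 hy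
  exact Algebra.subset_adjoin ⟨p, a, Nat.zero_le _, rfl⟩

theorem mon_append (l l' : List (PosRoot n)) (T : PosRoot n → ℕ) :
    mon K (l ++ l') T = mon K l T * mon K l' T :=
  monProd_append (E := fun (p : PosRoot n) a => divPowK K (p, a)) l l' T

theorem mon_congr {l : List (PosRoot n)} {T T' : PosRoot n → ℕ} (h : ∀ p ∈ l, T p = T' p) :
    mon K l T = mon K l T' :=
  monProd_congr (E := fun (p : PosRoot n) a => divPowK K (p, a)) h

theorem mon_eq_one {l : List (PosRoot n)} {T : PosRoot n → ℕ} (h : ∀ p ∈ l, T p = 0) :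
    mon K l T = 1 := monProd_eq_one kostant_relations h

theorem pbw_eq_mul {k d : ℕ} (hk : k + d = n) (T : PosRoot n → ℕ) :
    pbw K T = mon K (rootsFrom n k d) T * mon K (rootsFrom n 0 k) T := by
  unfold pbw
  subst hk
  rw [rootsFrom_append, mon_append, Nat.zero_add]

theorem pbw_eq_mon {k d : ℕ} (hk : k + d = n) {T : PosRoot n → ℕ}
    (hT : ∀ p : PosRoot n, (p.1.1 : ℕ) < k → T p = 0) : pbw K T = mon K (rootsFrom n k d) T := by
  rw [pbw_eq_mul hk, mon_eq_one (l := rootsFrom n 0 k), mul_one]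
  intro p hp
  rw [mem_rootsFrom] at hp
  exact hT p (by omega)

theorem kRow_le_span {k : ℕ} (hk : k ≤ n) {x : Kostant K n} (hx : x ∈ kRow K n k) :
    x ∈ Submodule.span K (pbw K '' {T | ∀ p : PosRoot n, (p.1.1 : ℕ) < k → T p = 0}) := by
  obtain ⟨d, hd⟩ := Nat.exists_eq_add_of_le hk
  have h : x ∈ Subalgebra.toSubmodule (kRow K n k) := hx
  rw [toSubmodule_rowAlg kostant_relations hd.symm, monSpan_eq_span (nodup_rootsFrom _ _)] at h
  refine Submodule.span_mono ?_ h
  rintro _ ⟨T, hT, rfl⟩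
  have hT' : ∀ p : PosRoot n, (p.1.1 : ℕ) < k → T p = 0 := fun p hp => hT p (by
    rw [mem_rootsFrom]
    omega)
  exact ⟨T, hT', pbw_eq_mon hd.symm hT'⟩

theorem pbw_mem_kRow {k : ℕ} (hk : k ≤ n) {T : PosRoot n → ℕ}
    (hT : ∀ p : PosRoot n, (p.1.1 : ℕ) < k → T p = 0) : pbw K T ∈ kRow K n k := by
  obtain ⟨d, hd⟩ := Nat.exists_eq_add_of_le hk
  rw [pbw_eq_mon hd.symm hT]
  refine list_prod_mem fun y hy => ?_
  obtain ⟨p, hp, rfl⟩ := List.mem_map.1 hy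
  exact Algebra.subset_adjoin ⟨p, _, (mem_rootsFrom.1 hp).1, rfl⟩

theorem span_pbw : Submodule.span K (Set.range (pbw K : (PosRoot n → ℕ) → Kostant K n)) = ⊤ := by
  rw [eq_top_iff]
  rintro x -
  refine Submodule.span_mono (Set.image_subset_range _ _)
    (kRow_le_span (Nat.zero_le n) (x := x) ?_)
  rw [kRow_zero]
  trivial

variable (K n) in
/-- The basis of ordered monomials of the Kostant form. -/
def pbwBasis : Module.Basis (PosRoot n → ℕ) K (Kostant K n) :=
  Module.Basis.mk linearIndependent_pbw span_pbw.ge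

theorem pbwBasis_apply (T : PosRoot n → ℕ) : pbwBasis K n T = pbw K T :=
  Module.Basis.mk_apply _ _ _

/-- The degree of an ordered monomial. -/
def expDeg (T : PosRoot n → ℕ) : Psi n := ∑ p, T p • rootDeg p

theorem expDeg_add (T T' : PosRoot n → ℕ) : expDeg (T + T') = expDeg T + expDeg T' := by
  unfold expDeg
  simp [add_smul, Finset.sum_add_distrib]

theorem pbw_mem_deg (T : PosRoot n → ℕ) : pbw K T ∈ kostantDeg K n (expDeg T) := by
  refine Submodule.subset_span ⟨(rootsFrom n 0 n).map fun p => (p, T p), ?_, ?_⟩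
  · classical
    rw [listDeg, List.map_map, ← List.sum_toFinset _ (nodup_rootsFrom 0 n)]
    refine Finset.sum_congr (Finset.eq_univ_iff_forall.2 fun p => ?_) fun _ _ => rfl
    exact List.mem_toFinset.2 (mem_rootsFrom_zero p)
  · rw [List.map_map]
    rfl

theorem coe_expDeg_apply (T : PosRoot n → ℕ) (i : Fin n) :
    (expDeg T : Fin n → ℤ) i =
      ∑ p : PosRoot n, (T p : ℤ) * ((if i = p.1.1 then 1 else 0) - if i = p.1.2 then 1 else 0) := by
  unfold expDeg
  rw [AddSubmonoidClass.coe_finsetSum, Finset.sum_apply]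
  refine Finset.sum_congr rfl fun p _ => ?_
  rw [AddSubmonoidClass.coe_nsmul, Pi.smul_apply, nsmul_eq_mul]
  simp [rootDeg, Pi.single_apply]

/-- The projection to degree `γ` fixes the monomials of degree `γ` and kills the others, so a
homogeneous element involves only monomials of its own degree. -/
theorem repr_deg {γ : Psi n} {x : Kostant K n} (hx : x ∈ kostantDeg K n γ) {T : PosRoot n → ℕ}
    (hT : (pbwBasis K n).repr x T ≠ 0) : expDeg T = γ := by
  by_contra h
  apply hT
  have h1 : ∀ y : Kostant K n, (pbwBasis K n).repr (projDeg (kostantDeg K n) γ y) T = 0 := by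
    intro y
    have : ((Finsupp.lapply T : _ →ₗ[K] K) ∘ₗ (pbwBasis K n).repr.toLinearMap ∘ₗ
        projDeg (kostantDeg K n) γ) = 0 := by
      refine (pbwBasis K n).ext fun T' => ?_
      rw [pbwBasis_apply]
      change (pbwBasis K n).repr (projDeg (kostantDeg K n) γ (pbw K T')) T = 0
      by_cases h' : expDeg T' = γ
      · rw [projDeg_same _ _ _ (h' ▸ pbw_mem_deg T'), ← pbwBasis_apply, Module.Basis.repr_self,
          Finsupp.single_apply, if_neg]
        rintro rfl
        exact h h'
      · have h2 : projDeg (kostantDeg K n) γ (pbw K T') = 0 :=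
          projDeg_ne (kostantDeg K n) γ _ h' _ (pbw_mem_deg T')
        rw [h2, map_zero]
        rfl
    exact LinearMap.congr_fun this y
  have h2 : projDeg (kostantDeg K n) γ x = x := projDeg_same _ γ x hx
  rw [← h2]
  exact h1 x

theorem mem_span_pbw_of_deg {γ : Psi n} {x : Kostant K n} (hx : x ∈ kostantDeg K n γ) :
    x ∈ Submodule.span K (pbw K '' {T | expDeg T = γ}) := by
  rw [← (pbwBasis K n).linearCombination_repr x, Finsupp.linearCombination_apply]
  refine sum_mem fun T hT => Submodule.smul_mem _ _ (Submodule.subset_span ⟨T, ?_, ?_⟩)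
  · exact repr_deg hx (Finsupp.mem_support_iff.1 hT)
  · exact (pbwBasis_apply T).symm

theorem repr_kRow {k : ℕ} (hk : k ≤ n) {x : Kostant K n} (hx : x ∈ kRow K n k)
    {T : PosRoot n → ℕ} (hT : (pbwBasis K n).repr x T ≠ 0) (p : PosRoot n)
    (hp : (p.1.1 : ℕ) < k) : T p = 0 := by
  have h := kRow_le_span hk hx
  by_contra h'
  apply hT
  refine (Submodule.span_le (p := LinearMap.ker ((Finsupp.lapply T : _ →ₗ[K] K) ∘ₗ
    (pbwBasis K n).repr.toLinearMap))).2 ?_ h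
  rintro _ ⟨T', hT', rfl⟩
  change (pbwBasis K n).repr (pbw K T') T = 0
  rw [← pbwBasis_apply, Module.Basis.repr_self, Finsupp.single_apply, if_neg]
  rintro rfl
  exact h' (hT' p hp)

/-- Elements of degree `γ` of the algebra of the rows from `k` on have `γ k ≥ 0`. -/
theorem deg_nonneg_of_mem_kRow {γ : Psi n} {k : Fin n} {x : Kostant K n} (hx : x ∈ kRow K n k)
    (hγ : x ∈ kostantDeg K n γ) (h0 : x ≠ 0) : 0 ≤ (γ : Fin n → ℤ) k := by
  obtain ⟨T, hT⟩ : ∃ T, (pbwBasis K n).repr x T ≠ 0 := by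
    by_contra! h
    apply h0
    rw [← (pbwBasis K n).repr.map_eq_zero_iff]
    exact Finsupp.ext h
  rw [← repr_deg hγ hT, coe_expDeg_apply]
  refine Finset.sum_nonneg fun p _ => ?_
  by_cases hp : (p.1.1 : ℕ) < k
  · rw [repr_kRow k.2.le hx hT p hp]
    simp
  -- A root with first index at least `k` has second index greater than `k`, so the coordinate `k`
  -- never receives a negative contribution.
  · rw [if_neg (c := k = p.1.2)]
    · split_ifs <;> simp
    · rintro rfl
      exact hp p.2

/-- The part of an exponent in row `k`. -/
def rowPart (k : ℕ) (T : PosRoot n → ℕ) : PosRoot n → ℕ :=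
  fun p => if (p.1.1 : ℕ) = k then T p else 0

/-- The part of an exponent outside row `k`. -/
def offPart (k : ℕ) (T : PosRoot n → ℕ) : PosRoot n → ℕ :=
  fun p => if (p.1.1 : ℕ) = k then 0 else T p

theorem offPart_add_rowPart (k : ℕ) (T : PosRoot n → ℕ) : offPart k T + rowPart k T = T := by
  funext p
  simp only [Pi.add_apply, offPart, rowPart]
  split_ifs <;> simp

/-- The rows above `k` stand to the left of row `k` in an ordered monomial, so this product needs no
straightening. -/
theorem pbw_add {k : ℕ} (hk : k < n) {T T' : PosRoot n → ℕ}
    (hT : ∀ p : PosRoot n, (p.1.1 : ℕ) < k + 1 → T p = 0)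
    (hT' : ∀ p : PosRoot n, (p.1.1 : ℕ) ≠ k → T' p = 0) :
    pbw K (T + T') = pbw K T * pbw K T' := by
  obtain ⟨d, rfl⟩ := Nat.exists_eq_add_of_lt hk
  have h1 : k + (d + 1) = k + d + 1 := by omega
  have h2 : (k + 1) + d = k + d + 1 := by omega
  rw [pbw_eq_mon h1 (T := T + T'), pbw_eq_mon h2 hT, pbw_eq_mon h1 (T := T'), rootsFrom, mon_append,
    mon_append, mon_eq_one (l := rootsFrom _ (k + 1) d) (T := T'), one_mul]
  · congr 1
    · refine mon_congr fun p hp => ?_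
      rw [mem_rootsFrom] at hp
      rw [Pi.add_apply, hT' p (by omega), add_zero]
    · refine mon_congr fun p hp => ?_
      rw [mem_rowRoots] at hp
      rw [Pi.add_apply, hT p (by omega), zero_add]
  · intro p hp
    rw [mem_rootsFrom] at hp
    exact hT' p (by omega)
  · exact fun p hp => hT' p hp.ne
  · intro p hp
    rw [Pi.add_apply, hT' p hp.ne, hT p (by omega)]

variable (K n) in
/-- The coordinates with respect to the monomials of row `k`. -/
def rowCoord (k : ℕ) : Kostant K n →ₗ[K] (PosRoot n → ℕ) →₀ Kostant K n :=
  (pbwBasis K n).constr K fun T => Finsupp.single (rowPart k T) (pbw K (offPart k T))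

theorem rowCoord_pbw (k : ℕ) (T : PosRoot n → ℕ) :
    rowCoord K n k (pbw K T) = Finsupp.single (rowPart k T) (pbw K (offPart k T)) := by
  unfold rowCoord
  rw [← pbwBasis_apply, Module.Basis.constr_basis]

/-- Together with `kRow_induction`, this makes `kRow k` a free left module over `kRow (k + 1)` with
the monomials of row `k` as basis and the values of `rowCoord` as coordinates. -/
theorem rowCoord_mul {k : ℕ} (hk : k < n) {c : Kostant K n} (hc : c ∈ kRow K n (k + 1))
    {t : PosRoot n → ℕ} (ht : ∀ p : PosRoot n, (p.1.1 : ℕ) ≠ k → t p = 0) :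
    rowCoord K n k (c * pbw K t) = Finsupp.single t c := by
  have h := kRow_le_span hk hc
  clear hc
  induction h using Submodule.span_induction with
  | mem x hx =>
    obtain ⟨T, hT, rfl⟩ := hx
    rw [← pbw_add hk hT ht, rowCoord_pbw]
    congr 1
    · funext p
      simp only [rowPart, Pi.add_apply]
      split_ifs with hp
      · rw [hT p (by omega), zero_add]
      · exact (ht p hp).symm
    · congr 1
      funext p
      simp only [offPart, Pi.add_apply]
      split_ifs with hp
      · exact (hT p (by omega)).symm
      · rw [ht p hp, add_zero]
  | zero => simp
  | add x y _ _ hx hy => rw [add_mul, map_add, hx, hy, Finsupp.single_add]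
  | smul a x _ hx => rw [smul_mul_assoc, map_smul, hx, Finsupp.smul_single]

theorem kRow_induction {k : ℕ} (hk : k < n) {P : Kostant K n → Prop} (h0 : P 0)
    (hadd : ∀ x y, P x → P y → P (x + y))
    (h : ∀ c ∈ kRow K n (k + 1), ∀ t : PosRoot n → ℕ,
      (∀ p : PosRoot n, (p.1.1 : ℕ) ≠ k → t p = 0) → P (c * pbw K t))
    {x : Kostant K n} (hx : x ∈ kRow K n k) : P x := by
  have h' := kRow_le_span hk.le hx
  clear hx
  induction h' using Submodule.closure_induction with
  | zero => exact h0
  | add x y _ _ hx hy => exact hadd x y hx hy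
  | smul_mem a x hx =>
    obtain ⟨T, hT, rfl⟩ := hx
    rw [← offPart_add_rowPart k T, pbw_add hk, ← smul_mul_assoc]
    · refine h _ (Subalgebra.smul_mem _ (pbw_mem_kRow hk fun p hp => ?_) a) _ fun p hp => if_neg hp
      unfold offPart
      split_ifs with h1
      · rfl
      · exact hT p (by omega)
    · intro p hp
      unfold offPart
      split_ifs with h1
      · rfl
      · exact hT p (by omega)
    · exact fun p hp => if_neg hp

theorem rowCoord_mem {k : ℕ} (hk : k < n) {x : Kostant K n} (hx : x ∈ kRow K n k)
    (t : PosRoot n → ℕ) : rowCoord K n k x t ∈ kRow K n (k + 1) := by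
  classical
  refine kRow_induction hk (P := fun x => rowCoord K n k x t ∈ kRow K n (k + 1)) ?_ ?_ ?_ hx
  · rw [map_zero]
    exact zero_mem _
  · intro x y hx hy
    rw [map_add]
    exact add_mem hx hy
  · intro c hc t' ht'
    rw [rowCoord_mul hk hc ht', Finsupp.single_apply]
    split_ifs
    · exact hc
    · exact zero_mem _

theorem rowCoord_smul {k : ℕ} (hk : k < n) {b x : Kostant K n} (hb : b ∈ kRow K n (k + 1))
    (hx : x ∈ kRow K n k) : rowCoord K n k (b * x) = b • rowCoord K n k x := by
  refine kRow_induction hk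
    (P := fun x => rowCoord K n k (b * x) = b • rowCoord K n k x) ?_ ?_ ?_ hx
  · simp
  · intro x y hx hy
    rw [mul_add, map_add, hx, hy, map_add, smul_add]
  · intro c hc t' ht'
    rw [← mul_assoc, rowCoord_mul hk hc ht', rowCoord_mul hk (mul_mem hb hc) ht',
      Finsupp.smul_single, smul_eq_mul]

theorem rowCoord_sum {k : ℕ} (hk : k < n) {x : Kostant K n} (hx : x ∈ kRow K n k) :
    ((rowCoord K n k x).sum fun t c => c * pbw K t) = x := by
  refine kRow_induction hk
    (P := fun x => ((rowCoord K n k x).sum fun t c => c * pbw K t) = x) ?_ ?_ ?_ hx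
  · simp
  · intro x y hx hy
    rw [map_add, Finsupp.sum_add_index' (by simp) (by simp [add_mul]), hx, hy]
  · intro c hc t' ht'
    rw [rowCoord_mul hk hc ht', Finsupp.sum_single_index (by simp)]

theorem rowCoord_deg (k : ℕ) {γ : Psi n} {x : Kostant K n} (hx : x ∈ kostantDeg K n γ)
    (t : PosRoot n → ℕ) : rowCoord K n k x t ∈ shiftDeg (kostantDeg K n) γ (expDeg t) := by
  classical
  refine (Submodule.span_le (p := (shiftDeg (kostantDeg K n) γ (expDeg t)).comap
    ((Finsupp.lapply t : _ →ₗ[K] Kostant K n) ∘ₗ rowCoord K n k))).2 ?_ (mem_span_pbw_of_deg hx)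
  rintro _ ⟨T, hT, rfl⟩
  change rowCoord K n k (pbw K T) t ∈ shiftDeg (kostantDeg K n) γ (expDeg t)
  rw [rowCoord_pbw, Finsupp.single_apply]
  split_ifs with h
  · refine mem_shiftDeg ?_ (pbw_mem_deg _)
    rw [← h, ← expDeg_add, offPart_add_rowPart]
    exact hT
  · exact zero_mem _

end PBW

end KostantSchur

end

noncomputable section

namespace KostantSchur

/-! ### Truncation of graded modules by a set of degrees -/

section Truncate

variable {K : Type u} [Field K] {Γ : Type} [AddMonoid Γ] [DecidableEq Γ]
  {A : Type u} [Ring A] [Algebra K A] {𝒜 : Γ → Submodule K A}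

namespace GrMod

/-- The submodule generated by the homogeneous elements with degree in `W`. -/
def spanDeg (M : GrMod 𝒜) (W : Set Γ) : Submodule A M :=
  Submodule.span A {m | ∃ γ ∈ W, m ∈ M.deg γ}

theorem mem_spanDeg {M : GrMod 𝒜} {W : Set Γ} {γ : Γ} (hγ : γ ∈ W) {m : M} (hm : m ∈ M.deg γ) :
    m ∈ M.spanDeg W := Submodule.subset_span ⟨γ, hγ, hm⟩

theorem map_mem_spanDeg {M N : GrMod 𝒜} (f : M ⟶ N) {W : Set Γ} {x : M} (hx : x ∈ M.spanDeg W) :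
    f.lin x ∈ N.spanDeg W := by
  refine (Submodule.span_le (p := (N.spanDeg W).comap f.lin)).2 ?_ hx
  rintro m ⟨γ, hγ, hm⟩
  exact mem_spanDeg hγ (f.map_deg γ m hm)

theorem spanDeg_mono (M : GrMod 𝒜) {W W' : Set Γ} (h : W ⊆ W') : M.spanDeg W ≤ M.spanDeg W' :=
  Submodule.span_mono fun _ ⟨γ, hγ, hm⟩ => ⟨γ, h hγ, hm⟩

theorem spanDeg_eq_bot {M : GrMod 𝒜} {W : Set Γ} (h : ∀ γ ∈ W, M.deg γ = ⊥) :
    M.spanDeg W = ⊥ := by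
  rw [eq_bot_iff]
  refine Submodule.span_le.2 ?_
  rintro m ⟨γ, hγ, hm⟩
  rwa [h γ hγ] at hm

theorem iSup_deg' (M : GrMod 𝒜) (m : M) : m ∈ ⨆ γ, M.deg γ := by
  rw [iSup_deg]
  trivial

theorem projDeg_map {M N : GrMod 𝒜} (f : M ⟶ N) (γ : Γ) (m : M) :
    f.lin (projDeg M.deg γ m) = projDeg N.deg γ (f.lin m) := by
  induction iSup_deg' M m using Submodule.iSup_induction' with
  | zero => simp
  | add x y _ _ hx hy => simp only [map_add, hx, hy]
  | mem β m hm =>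
    by_cases h : β = γ
    · subst h
      rw [projDeg_same _ _ _ hm, projDeg_same _ _ _ (f.map_deg _ _ hm)]
    · rw [projDeg_ne _ _ _ h _ hm, projDeg_ne _ _ _ h _ (f.map_deg _ _ hm), map_zero]

variable [GradedAlgebra 𝒜]

theorem projDeg_mem_spanDeg {M : GrMod 𝒜} {W : Set Γ} (γ : Γ) {x : M} (hx : x ∈ M.spanDeg W) :
    projDeg M.deg γ x ∈ M.spanDeg W := by
  induction hx using Submodule.closure_induction with
  | zero => rw [map_zero]; exact zero_mem _
  | add x y _ _ hx hy => rw [map_add]; exact add_mem hx hy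
  | smul_mem a m hm =>
    obtain ⟨β, hβ, hm⟩ := hm
    have ha : a ∈ ⨆ α, 𝒜 α := by rw [iSup_deg]; trivial
    induction ha using Submodule.iSup_induction' with
    | zero => rw [zero_smul, map_zero]; exact zero_mem _
    | add a b _ _ ha hb => rw [add_smul, map_add]; exact add_mem ha hb
    | mem α a ha =>
      have h : a • m ∈ M.deg (α +ᵥ β) := SetLike.GradedSMul.smul_mem ha hm
      by_cases h' : α +ᵥ β = γ
      · rw [projDeg_same _ _ _ (h' ▸ h)]
        exact Submodule.smul_mem _ _ (mem_spanDeg hβ hm)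
      · rw [projDeg_ne _ _ _ h' _ h]
        exact zero_mem _

variable (M : GrMod 𝒜) (W : Set Γ)

/-- The grading of the quotient by the submodule generated by certain homogeneous components. -/
def quotGrDeg (γ : Γ) : Submodule K (M ⧸ M.spanDeg W) :=
  (M.deg γ).map ((M.spanDeg W).mkQ.restrictScalars K)

theorem quotGrDeg_isInternal : DirectSum.IsInternal (M.quotGrDeg W) := by
  let e := Submodule.Quotient.restrictScalarsEquiv K (M.spanDeg W)
  let p (γ : Γ) : (M ⧸ M.spanDeg W) →ₗ[K] (M ⧸ M.spanDeg W) :=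
    e.toLinearMap ∘ₗ Submodule.mapQ ((M.spanDeg W).restrictScalars K)
      ((M.spanDeg W).restrictScalars K) (projDeg M.deg γ)
      (fun c hc => projDeg_mem_spanDeg γ hc) ∘ₗ e.symm.toLinearMap
  have hp (γ : Γ) (c : M) : p γ ((M.spanDeg W).mkQ c) = (M.spanDeg W).mkQ (projDeg M.deg γ c) :=
    rfl
  refine isInternal_of_proj (M.quotGrDeg W) p ?_ ?_ ?_
  · rintro γ _ ⟨c, hc, rfl⟩
    exact (hp γ c).trans (congrArg (M.spanDeg W).mkQ (projDeg_same M.deg γ c hc))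
  · rintro γ γ' h _ ⟨c, hc, rfl⟩
    exact (hp γ c).trans
      ((congrArg (M.spanDeg W).mkQ (projDeg_ne M.deg γ γ' h c hc)).trans (map_zero _))
  · unfold quotGrDeg
    rw [← Submodule.map_iSup, iSup_deg, Submodule.map_top, LinearMap.range_eq_top]
    exact fun x => Submodule.Quotient.mk_surjective (M.spanDeg W) x

/-- The quotient of a graded module by the submodule generated by the homogeneous components with
degree in `W`. -/
def quotGr : GrMod 𝒜 where
  carrier := M ⧸ M.spanDeg W
  deg := M.quotGrDeg W
  decomposition := (M.quotGrDeg_isInternal W).chooseDecomposition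
  gradedSMul := ⟨by
    rintro γ γ' a _ ha ⟨m, hm, rfl⟩
    exact ⟨a • m, SetLike.GradedSMul.smul_mem ha hm, map_smul (M.spanDeg W).mkQ a m⟩⟩

/-- The projection to the quotient. -/
def toQuotGr : M ⟶ M.quotGr W where
  lin := (M.spanDeg W).mkQ
  map_deg _ m hm := ⟨m, hm, rfl⟩

theorem toQuotGr_surjective : Function.Surjective (M.toQuotGr W).lin :=
  Submodule.mkQ_surjective _

variable {M W}

theorem toQuotGr_eq_zero {m : M} : (M.toQuotGr W).lin m = 0 ↔ m ∈ M.spanDeg W :=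
  Submodule.Quotient.mk_eq_zero _

theorem exists_of_mem_quotGr_deg {γ : Γ} {q : M.quotGr W} (hq : q ∈ (M.quotGr W).deg γ) :
    ∃ m ∈ M.deg γ, (M.toQuotGr W).lin m = q := hq

theorem quotGr_deg_eq_bot {γ : Γ} (hγ : γ ∈ W) : (M.quotGr W).deg γ = ⊥ := by
  rw [eq_bot_iff]
  intro q hq
  obtain ⟨m, hm, rfl⟩ := exists_of_mem_quotGr_deg hq
  exact toQuotGr_eq_zero.2 (mem_spanDeg hγ hm)

/-- Homomorphisms from the quotient. -/
def quotGrDesc {N : GrMod 𝒜} (f : M ⟶ N) (hf : ∀ x ∈ M.spanDeg W, f.lin x = 0) :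
    M.quotGr W ⟶ N where
  lin := (M.spanDeg W).liftQ f.lin hf
  map_deg := by
    rintro γ _ ⟨m, hm, rfl⟩
    exact f.map_deg γ m hm

theorem quotGrDesc_apply {N : GrMod 𝒜} (f : M ⟶ N) (hf : ∀ x ∈ M.spanDeg W, f.lin x = 0) (m : M) :
    (quotGrDesc f hf).lin ((M.toQuotGr W).lin m) = f.lin m := rfl

variable (W) in
/-- The homomorphism of quotients induced by a homomorphism. -/
def quotGrMap {N : GrMod 𝒜} (f : M ⟶ N) : M.quotGr W ⟶ N.quotGr W :=
  quotGrDesc (f ≫ N.toQuotGr W) fun _ hx => toQuotGr_eq_zero.2 (map_mem_spanDeg f hx)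

theorem quotGrMap_apply {N : GrMod 𝒜} (f : M ⟶ N) (m : M) :
    (quotGrMap W f).lin ((M.toQuotGr W).lin m) = (N.toQuotGr W).lin (f.lin m) := rfl

/-- A submodule generated by homogeneous components lifts from the quotient. -/
theorem mem_spanDeg_of_toQuotGr {W' : Set Γ} (h : W ⊆ W') {x : M}
    (hx : (M.toQuotGr W).lin x ∈ (M.quotGr W).spanDeg W') : x ∈ M.spanDeg W' := by
  have h1 : (M.quotGr W).spanDeg W' ≤ (M.spanDeg W').map (M.toQuotGr W).lin := by
    refine Submodule.span_le.2 ?_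
    rintro q ⟨γ, hγ, hq⟩
    obtain ⟨m, hm, rfl⟩ := exists_of_mem_quotGr_deg hq
    exact ⟨m, mem_spanDeg hγ hm, rfl⟩
  obtain ⟨y, hy, hyx⟩ := h1 hx
  have h2 : x - y ∈ M.spanDeg W := by
    rw [← toQuotGr_eq_zero, map_sub, hyx, sub_self]
  have := add_mem (spanDeg_mono M h h2) hy
  rwa [sub_add_cancel] at this

end GrMod

/-- Right cancellation makes `δ` unique, so the supremum has at most one term. -/
theorem mem_shiftDeg_iff [IsRightCancelAdd Γ] {γ w : Γ} {a : A} :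
    a ∈ shiftDeg 𝒜 γ w ↔ a = 0 ∨ ∃ δ, δ + w = γ ∧ a ∈ 𝒜 δ := by
  constructor
  · intro h
    by_cases hδ : ∃ δ, δ + w = γ
    · obtain ⟨δ, hδ⟩ := hδ
      right
      refine ⟨δ, hδ, ?_⟩
      refine shiftDeg_induction (fun δ' h' => ?_) h
      rw [add_right_cancel (h'.trans hδ.symm)]
    · left
      have : shiftDeg 𝒜 γ w ≤ ⊥ := shiftDeg_induction fun δ' h' => absurd ⟨δ', h'⟩ hδ
      exact this h
  · rintro (rfl | ⟨δ, hδ, ha⟩)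
    · exact zero_mem _
    · exact mem_shiftDeg hδ ha

/-- A homogeneous dual basis of a graded module over a subalgebra `R`: homogeneous elements `g j`
and homogeneous `R`-linear forms `φ j` with values in `R` such that `x = ∑ φ j x • g j`. -/
def HasDualBasis (R : Subalgebra K A) (M : GrMod 𝒜) : Prop :=
  ∃ (ι : Type u) (g : ι → M) (w : ι → Γ) (φ : M →ₗ[R] (ι →₀ A)),
    (∀ j, g j ∈ M.deg (w j)) ∧ (∀ m j, φ m j ∈ R) ∧
    (∀ γ, ∀ m ∈ M.deg γ, ∀ j, φ m j ∈ shiftDeg 𝒜 γ (w j)) ∧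
    ∀ m, Finsupp.linearCombination A g (φ m) = m

/-- The conditions on a subalgebra and a set of degrees under which the truncation by these degrees
depends only on the structure of a module over the subalgebra. -/
structure Truncates (R : Subalgebra K A) (W : Set Γ) (𝒜 : Γ → Submodule K A) : Prop where
  span_le : ∀ (M : GrMod 𝒜), ∀ x ∈ M.spanDeg W,
    x ∈ Submodule.span R {m : M | ∃ γ ∈ W, m ∈ M.deg γ}
  mem_of_add : ∀ x ∈ R, ∀ δ w, x ∈ 𝒜 δ → x ≠ 0 → δ + w ∈ W → w ∈ W

variable {R : Subalgebra K A} {W : Set Γ}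

/-- By `span_le` only the `R`-generators of degrees in `W` need to be tested, and a nonzero
coordinate of degree `δ` has `δ + w j ∈ W`, whence `w j ∈ W`. So in `x = ∑ φ x j • g j` only
generators with degree in `W` occur. -/
theorem Truncates.coord_eq_zero [IsRightCancelAdd Γ] (h : Truncates R W 𝒜) {M : GrMod 𝒜}
    {ι : Type u} {w : ι → Γ} {φ : M →ₗ[R] (ι →₀ A)} (hφ : ∀ m j, φ m j ∈ R)
    (hφ' : ∀ γ, ∀ m ∈ M.deg γ, ∀ j, φ m j ∈ shiftDeg 𝒜 γ (w j)) {x : M} (hx : x ∈ M.spanDeg W)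
    {j : ι} (hj : w j ∉ W) : φ x j = 0 := by
  refine (Submodule.span_le (p := LinearMap.ker
    ((Finsupp.lapply j : (ι →₀ A) →ₗ[R] A) ∘ₗ φ))).2 ?_ (h.span_le M x hx)
  rintro m ⟨γ, hγ, hm⟩
  change φ m j = 0
  rcases mem_shiftDeg_iff.1 (hφ' γ m hm j) with h0 | ⟨δ, rfl, hδ⟩
  · exact h0
  · by_contra h0
    exact hj (h.mem_of_add _ (hφ m j) δ _ hδ h0 hγ)

theorem linearCombination_mem_deg [IsRightCancelAdd Γ] {M : GrMod 𝒜} {ι : Type u} {w : ι → Γ}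
    {y : ι → M} (hy : ∀ j, y j ∈ M.deg (w j)) {γ : Γ} {c : ι →₀ A}
    (hc : ∀ j, c j ∈ shiftDeg 𝒜 γ (w j)) : Finsupp.linearCombination A y c ∈ M.deg γ := by
  rw [Finsupp.linearCombination_apply]
  refine sum_mem fun j _ => ?_
  rcases mem_shiftDeg_iff.1 (hc j) with h0 | ⟨δ, rfl, hδ⟩
  · dsimp only
    rw [h0, zero_smul]
    exact zero_mem _
  · exact SetLike.GradedSMul.smul_mem hδ (hy j)

variable [GradedAlgebra 𝒜]

/-- The lifting property of the part of a graded module with a homogeneous dual basis that is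
generated in the degrees `W`. -/
theorem Truncates.exists_lift [IsRightCancelAdd Γ] (h : Truncates R W 𝒜) {M N : GrMod 𝒜}
    (hM : HasDualBasis R M) (d : N ⟶ M) (p : M →ₗ[R] M)
    (hp : ∀ γ, ∀ m ∈ M.deg γ, p m ∈ M.deg γ)
    (hpd : ∀ x ∈ M.spanDeg W, p x ∈ LinearMap.range d.lin) :
    ∃ σ : M →ₗ[R] N, (∀ γ, ∀ m ∈ M.deg γ, σ m ∈ N.deg γ) ∧ (∀ m, σ m ∈ N.spanDeg W) ∧
      ∀ x ∈ M.spanDeg W, d.lin (σ x) = p x := by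
  obtain ⟨ι, g, w, φ, hg, hφ, hφ', hsum⟩ := hM
  have hy : ∀ j, ∃ y ∈ N.deg (w j), y ∈ N.spanDeg W ∧ (w j ∈ W → d.lin y = p (g j)) := by
    intro j
    by_cases hj : w j ∈ W
    · obtain ⟨y, hy⟩ := hpd (g j) (GrMod.mem_spanDeg hj (hg j))
      -- The component of degree `w j` of a preimage is still a preimage, as `d` preserves degrees,
      -- and it lies in the part generated in the degrees `W`.
      refine ⟨projDeg N.deg (w j) y, projDeg_mem _ _ _,
        GrMod.mem_spanDeg hj (projDeg_mem _ _ _), fun _ => ?_⟩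
      rw [GrMod.projDeg_map, hy, projDeg_same _ _ _ (hp _ _ (hg j))]
    · exact ⟨0, zero_mem _, zero_mem _, fun h => absurd h hj⟩
  choose y hy1 hy2 hy3 using hy
  refine ⟨(Finsupp.linearCombination A y).restrictScalars R ∘ₗ φ, ?_, ?_, ?_⟩
  · intro γ m hm
    exact linearCombination_mem_deg hy1 (hφ' γ m hm)
  · intro m
    change Finsupp.linearCombination A y (φ m) ∈ _
    rw [Finsupp.linearCombination_apply]
    exact sum_mem fun j _ => Submodule.smul_mem _ _ (hy2 j)
  · intro x hx
    change d.lin (Finsupp.linearCombination A y (φ x)) = p x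
    conv_rhs => rw [← hsum x]
    rw [Finsupp.linearCombination_apply, Finsupp.linearCombination_apply, Finsupp.sum, Finsupp.sum,
      map_sum, map_sum]
    refine Finset.sum_congr rfl fun j _ => ?_
    -- For `w j ∉ W` the value `y j = 0` was arbitrary, but the coordinate `φ x j` vanishes.
    by_cases hj : w j ∈ W
    · rw [map_smul, hy3 j hj]
      exact (map_smul p (⟨φ x j, hφ x j⟩ : R) (g j)).symm
    · rw [h.coord_eq_zero hφ hφ' hx hj, zero_smul, zero_smul, map_zero, map_zero]

/-- If `⋯ → P 2 → P 1 → P 0` is exact in the degrees `W`, then so is the subcomplex generated in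
the degrees `W`. -/
theorem Truncates.exists_retraction [IsRightCancelAdd Γ] (h : Truncates R W 𝒜) {P : ℕ → GrMod 𝒜}
    (hP : ∀ i, HasDualBasis R (P i)) (d : ∀ i, P (i + 1) ⟶ P i) {Z : ∀ i, Submodule A (P i)}
    (hZ0 : (P 0).spanDeg W ≤ Z 0) (hZ : ∀ i, Z (i + 1) = LinearMap.ker (d i).lin)
    (hex : ∀ i, Z i = LinearMap.range (d i).lin) (i : ℕ) :
    ∃ p : P i →ₗ[R] P i, (∀ γ, ∀ m ∈ (P i).deg γ, p m ∈ (P i).deg γ) ∧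
      (∀ x ∈ (P i).spanDeg W, p x ∈ Z i) ∧ ∀ x ∈ (P i).spanDeg W, x ∈ Z i → p x = x := by
  induction i with
  -- At the start every element generated in the degrees `W` is already in `Z 0`, by `hZ0`.
  | zero => exact ⟨LinearMap.id, fun _ _ hm => hm, fun x hx => hZ0 hx, fun _ _ _ => rfl⟩
  | succ i ih =>
    obtain ⟨p, hp1, hp2, hp3⟩ := ih
    obtain ⟨σ, hσ1, hσ2, hσ3⟩ := h.exists_lift (hP i) (d i) p hp1 fun x hx => hex i ▸ hp2 x hx
    -- With `σ` a lift of `p` along `d`, the element `x - σ (d x)` is a cycle: `d (σ (d x)) = p (d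
    -- x) = d x`, because `d x` lies in `Z i` and is fixed by `p`. On cycles the subtracted term is
    -- `0`.
    refine ⟨LinearMap.id - σ ∘ₗ (d i).lin.restrictScalars R, ?_, ?_, ?_⟩
    · intro γ m hm
      exact sub_mem hm (hσ1 _ _ ((d i).map_deg _ _ hm))
    · intro x hx
      rw [hZ, LinearMap.mem_ker]
      change (d i).lin (x - σ ((d i).lin x)) = 0
      have h1 := GrMod.map_mem_spanDeg (d i) hx
      rw [map_sub, hσ3 _ h1, hp3 _ h1, sub_self]
      rw [hex]
      exact ⟨x, rfl⟩
    · intro x _ hx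
      rw [hZ, LinearMap.mem_ker] at hx
      change x - σ ((d i).lin x) = x
      rw [hx, map_zero, sub_zero]

/-- The point is that the preimage stays in the part generated in the degrees `W`: since `p` fixes
`x`, a lift of `p` along `d i` maps `x` to such a preimage. -/
theorem Truncates.exists_preimage [IsRightCancelAdd Γ] (h : Truncates R W 𝒜) {P : ℕ → GrMod 𝒜}
    (hP : ∀ i, HasDualBasis R (P i)) (d : ∀ i, P (i + 1) ⟶ P i) {Z : ∀ i, Submodule A (P i)}
    (hZ0 : (P 0).spanDeg W ≤ Z 0) (hZ : ∀ i, Z (i + 1) = LinearMap.ker (d i).lin)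
    (hex : ∀ i, Z i = LinearMap.range (d i).lin) (i : ℕ) {x : P i} (hx : x ∈ (P i).spanDeg W)
    (hxZ : x ∈ Z i) : ∃ y ∈ (P (i + 1)).spanDeg W, (d i).lin y = x := by
  obtain ⟨p, hp1, hp2, hp3⟩ := h.exists_retraction hP d hZ0 hZ hex i
  obtain ⟨σ, hσ1, hσ2, hσ3⟩ := h.exists_lift (hP i) (d i) p hp1 fun x hx => hex i ▸ hp2 x hx
  exact ⟨σ x, hσ2 x, (hσ3 x hx).trans (hp3 x hx hxZ)⟩

/-- The truncation of a module with a homogeneous dual basis has a homogeneous dual basis. -/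
theorem Truncates.hasDualBasis_quotGr [IsRightCancelAdd Γ] (h : Truncates R W 𝒜) {M : GrMod 𝒜}
    (hM : HasDualBasis R M) : HasDualBasis R (M.quotGr W) := by
  obtain ⟨ι, g, w, φ, hg, hφ, hφ', hsum⟩ := hM
  -- The coordinates at `j` with `w j ∉ W` vanish on the truncated part and pass to the quotient;
  -- the generators with `w j ∈ W` become zero there.
  let ψ : M →ₗ[R] ({j | w j ∉ W} →₀ A) := Finsupp.lsubtypeDomain {j | w j ∉ W} ∘ₗ φ
  have hψ : (M.spanDeg W).restrictScalars R ≤ LinearMap.ker ψ := by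
    intro x hx
    rw [LinearMap.mem_ker]
    ext j
    exact h.coord_eq_zero hφ hφ' hx j.2
  refine ⟨{j | w j ∉ W}, fun j => (M.toQuotGr W).lin (g j), fun j => w j,
    (Submodule.liftQ _ ψ hψ : (M ⧸ (M.spanDeg W).restrictScalars R) →ₗ[R] _) ∘ₗ
      (Submodule.Quotient.restrictScalarsEquiv R (M.spanDeg W)).symm.toLinearMap, ?_, ?_, ?_, ?_⟩
  · exact fun j => (M.toQuotGr W).map_deg _ _ (hg j)
  · intro q j
    obtain ⟨m, rfl⟩ := M.toQuotGr_surjective W q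
    exact hφ m j
  · intro γ q hq j
    obtain ⟨m, hm, rfl⟩ := GrMod.exists_of_mem_quotGr_deg hq
    exact hφ' γ m hm j
  · intro q
    obtain ⟨m, rfl⟩ := M.toQuotGr_surjective W q
    change Finsupp.linearCombination A _ ((φ m).subtypeDomain fun j => w j ∉ W) = _
    conv_rhs => rw [← hsum m]
    rw [Finsupp.linearCombination_apply, Finsupp.linearCombination_apply, Finsupp.sum,
      Finsupp.sum, map_sum]
    classical
    rw [← Finset.sum_filter_add_sum_filter_not _ (fun j => w j ∉ W)]
    have h0 : ∑ j ∈ (φ m).support.filter (fun j => ¬ w j ∉ W),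
        (M.toQuotGr W).lin (φ m j • g j) = 0 := by
      refine Finset.sum_eq_zero fun j hj => ?_
      rw [map_smul, GrMod.toQuotGr_eq_zero.2, smul_zero]
      exact GrMod.mem_spanDeg (not_not.1 (Finset.mem_filter.1 hj).2) (hg j)
    rw [h0, add_zero, ← Finset.sum_subtype_eq_sum_filter]
    refine Finset.sum_congr ?_ fun j _ => ((M.toQuotGr W).lin.map_smul _ _).symm
    ext j
    simp

end Truncate

end KostantSchur

end

noncomputable section

namespace KostantSchur

/-! ### Dual bases of projective modules and exactness of truncated complexes -/

section Projective

variable {K : Type u} [Field K] {Γ : Type} [AddMonoid Γ] [DecidableEq Γ]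
  {A : Type u} [Ring A] [Algebra K A] {𝒜 : Γ → Submodule K A} [GradedAlgebra 𝒜]

theorem exists_projDeg_smul (F : GrMod 𝒜) {w : Γ} {e : F} (he : e ∈ F.deg w) (γ : Γ) (c : A) :
    ∃ c' ∈ shiftDeg 𝒜 γ w, projDeg F.deg γ (c • e) = c' • e := by
  have hc : c ∈ ⨆ α, 𝒜 α := by rw [iSup_deg]; trivial
  induction hc using Submodule.iSup_induction' with
  | zero => exact ⟨0, zero_mem _, by simp⟩
  | add a b _ _ ha hb =>
    obtain ⟨a', ha', h⟩ := ha
    obtain ⟨b', hb', h'⟩ := hb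
    exact ⟨a' + b', add_mem ha' hb', by rw [add_smul, map_add, h, h', add_smul]⟩
  | mem α a ha =>
    have hm : a • e ∈ F.deg (α +ᵥ w) := SetLike.GradedSMul.smul_mem ha he
    by_cases h : α + w = γ
    · exact ⟨a, mem_shiftDeg h ha, projDeg_same _ _ _ (h ▸ hm)⟩
    · exact ⟨0, zero_mem _, by rw [projDeg_ne _ _ _ h _ hm, zero_smul]⟩

/-- The coordinates of a homogeneous element with respect to a homogeneous basis. -/
theorem repr_mem_shiftDeg {F : GrMod 𝒜} {ι : Type u} (b : Module.Basis ι A F) {w : ι → Γ}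
    (hw : ∀ i, b i ∈ F.deg (w i)) {γ : Γ} {x : F} (hx : x ∈ F.deg γ) (j : ι) :
    b.repr x j ∈ shiftDeg 𝒜 γ (w j) := by
  classical
  choose c' hc' h using fun j => exists_projDeg_smul F (hw j) γ (b.repr x j)
  have hx' : x = ∑ i ∈ (b.repr x).support, c' i • b i := by
    conv_lhs => rw [← projDeg_same _ _ _ hx, ← b.linearCombination_repr x,
      Finsupp.linearCombination_apply, Finsupp.sum, map_sum]
    exact Finset.sum_congr rfl fun i _ => h i
  have : b.repr x j = if j ∈ (b.repr x).support then c' j else 0 := by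
    conv_lhs => rw [hx', map_sum, Finsupp.finsetSum_apply]
    simp only [map_smul, Module.Basis.repr_self, Finsupp.smul_single, smul_eq_mul, mul_one]
    simp only [Finsupp.single_apply]
    exact Finset.sum_ite_eq' _ j c'
  rw [this]
  split_ifs
  · exact hc' j
  · exact zero_mem _

/-- A summand of a free graded module takes the projected basis as generators and the coordinates of
the inclusion as forms. -/
theorem GrMod.IsProjective.hasDualBasis {P : GrMod 𝒜} (h : P.IsProjective) :
    HasDualBasis ⊤ P := by
  obtain ⟨F, ⟨ι, b, hb⟩, i, p, hip⟩ := h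
  choose w hw using hb
  refine ⟨ι, fun j => p.lin (b j), w, (b.repr.toLinearMap ∘ₗ i.lin).restrictScalars _, ?_, ?_, ?_,
    ?_⟩
  · exact fun j => p.map_deg _ _ (hw j)
  · exact fun _ _ => trivial
  · exact fun γ m hm j => repr_mem_shiftDeg b hw (i.map_deg γ m hm) j
  · intro m
    have h1 : p.lin (Finsupp.linearCombination A b (b.repr (i.lin m))) = m := by
      rw [b.linearCombination_repr]
      exact LinearMap.congr_fun (congrArg GrMod.Hom.lin hip) m
    conv_rhs => rw [← h1]
    rw [Finsupp.apply_linearCombination]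
    rfl

theorem GrMod.spanDeg_union {M : GrMod 𝒜} {W V : Set Γ} (h : ∀ γ ∈ W, M.deg γ = ⊥) :
    M.spanDeg (W ∪ V) = M.spanDeg V := by
  refine le_antisymm (Submodule.span_le.2 ?_) (M.spanDeg_mono Set.subset_union_right)
  rintro m ⟨γ, hγ | hγ, hm⟩
  · rw [h γ hγ, Submodule.mem_bot] at hm
    rw [hm]
    exact zero_mem _
  · exact mem_spanDeg hγ hm

/-- In a product from `R L` the factor of `L` acts first and does not leave the `K`-span of the
components in question, so `R` alone generates the `A`-submodule. -/
theorem mem_span_of_forall_smul_mem {R L : Subalgebra K A}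
    (hA : ∀ x, x ∈ Subalgebra.toSubmodule R * Subalgebra.toSubmodule L) {M : GrMod 𝒜} {W : Set Γ}
    (hL : ∀ c ∈ L, ∀ m ∈ Submodule.span K {m : M | ∃ γ ∈ W, m ∈ M.deg γ},
      c • m ∈ Submodule.span K {m : M | ∃ γ ∈ W, m ∈ M.deg γ}) {x : M} (hx : x ∈ M.spanDeg W) :
    x ∈ Submodule.span R {m : M | ∃ γ ∈ W, m ∈ M.deg γ} := by
  have hST : ∀ m ∈ Submodule.span K {m : M | ∃ γ ∈ W, m ∈ M.deg γ},
      m ∈ Submodule.span R {m : M | ∃ γ ∈ W, m ∈ M.deg γ} :=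
    (Submodule.span_le (p := (Submodule.span R _).restrictScalars K)).2
      fun m hm => Submodule.subset_span hm
  induction hx using Submodule.closure_induction with
  | zero => exact zero_mem _
  | add x y _ _ hx hy => exact add_mem hx hy
  | smul_mem a m hm =>
    have hm' := Submodule.subset_span (R := K) hm
    refine Submodule.mul_induction_on (hA a) ?_ ?_
    · intro b hb c hc
      rw [mul_smul]
      exact Submodule.smul_mem _ (⟨b, hb⟩ : R) (hST _ (hL c hc m hm'))
    · intro x y hx hy
      rw [add_smul]
      exact add_mem hx hy

/-- Change of the subalgebra in a homogeneous dual basis: the case of a subalgebra `R` that is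
free over `R'`. -/
theorem HasDualBasis.of_coord {R R' : Subalgebra K A} (hR : R' ≤ R) {τ : Type} {e : τ → Γ}
    {t : τ → A} (ht : ∀ j, t j ∈ 𝒜 (e j)) (c : A →+ (τ →₀ A)) (hc : ∀ x ∈ R, ∀ j, c x j ∈ R')
    (hc' : ∀ b ∈ R', ∀ x ∈ R, c (b * x) = b • c x)
    (hcd : ∀ γ, ∀ x ∈ 𝒜 γ, ∀ j, c x j ∈ shiftDeg 𝒜 γ (e j))
    (hct : ∀ x ∈ R, ((c x).sum fun j y => y * t j) = x) {M : GrMod 𝒜} (h : HasDualBasis R M) :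
    HasDualBasis R' M := by
  obtain ⟨ι, g, w, φ, hg, hφ, hφ', hsum⟩ := h
  have hsmul (b : R') (m : M) : φ (b • m) = (b : A) • φ m := φ.map_smul (⟨b, hR b.2⟩ : R) m
  -- The new generators are the `t i • g j`, and the new forms are the coordinates over `R'` of the
  -- old forms.
  let ψ : M →ₗ[R'] (ι × τ →₀ A) :=
    { toFun := fun m => ((φ m).mapRange c (map_zero c)).uncurry
      map_add' := fun x y => by
        ext ⟨j, i⟩
        change c (φ (x + y) j) i = c (φ x j) i + c (φ y j) i
        rw [map_add, Finsupp.add_apply, map_add, Finsupp.add_apply]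
      map_smul' := fun b x => by
        ext ⟨j, i⟩
        change c (φ (b • x) j) i = (b : A) * c (φ x j) i
        rw [hsmul, Finsupp.smul_apply, smul_eq_mul, hc' b b.2 _ (hφ x j)]
        rfl }
  refine ⟨ι × τ, fun p => t p.2 • g p.1, fun p => e p.2 + w p.1, ψ, ?_, ?_, ?_, ?_⟩
  · exact fun p => SetLike.GradedSMul.smul_mem (ht p.2) (hg p.1)
  · exact fun m p => hc _ (hφ m p.1) p.2
  · intro γ m hm p
    change c (φ m p.1) p.2 ∈ _
    have h1 := hφ' γ m hm p.1
    unfold shiftDeg at h1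
    generalize φ m p.1 = u at h1 ⊢
    induction h1 using Submodule.iSup_induction' with
    | mem δ x hx =>
      have h2 := hcd δ x hx p.2
      unfold shiftDeg at h2
      generalize c x p.2 = u at h2 ⊢
      induction h2 using Submodule.iSup_induction' with
      | mem δ' y hy =>
        refine mem_shiftDeg ?_ hy
        rw [← add_assoc, δ'.2, δ.2]
      | zero => exact zero_mem _
      | add x y _ _ hx hy => exact add_mem hx hy
    | zero =>
      rw [map_zero]
      exact zero_mem _
    | add x y _ _ hx hy =>
      rw [map_add]
      exact add_mem hx hy
  · intro m
    conv_rhs => rw [← hsum m]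
    change Finsupp.linearCombination _ _ ((φ m).mapRange c (map_zero c)).uncurry = _
    rw [Finsupp.linearCombination_apply, Finsupp.linearCombination_apply,
      Finsupp.sum_uncurry_index]
    rw [Finsupp.sum_mapRange_index (h := fun i (f : τ →₀ A) => f.sum fun b a => a • t b • g i)
      fun _ => Finsupp.sum_zero_index]
    refine Finsupp.sum_congr fun j _ => ?_
    conv_rhs => rw [← hct _ (hφ m j), Finsupp.sum, Finset.sum_smul]
    exact Finset.sum_congr rfl fun t _ => (mul_smul _ _ _).symm

section Exact

variable {R : Subalgebra K A} {W : Set Γ} {P : ℕ → GrMod 𝒜} {d : ∀ i, P (i + 1) ⟶ P i}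
  {M : GrMod 𝒜} {ε : P 0 ⟶ M}

/-- A cycle of the quotient lifts to some `u` with `d u` in the truncated part. Then `d u = d y`
with `y` in the truncated part, by `Truncates.exists_preimage`, and `u - y` is a genuine cycle,
hence a boundary. The hypothesis `hε` starts the chain: all elements of the truncated part of `P 0`
are cycles. -/
theorem Truncates.exact_quotGr [IsRightCancelAdd Γ] (ht : Truncates R W 𝒜)
    (hP : ∀ i, HasDualBasis R (P i)) (hex : ∀ i, Function.Exact (d (i + 1)).lin (d i).lin)
    (hex0 : Function.Exact (d 0).lin ε.lin) (hε : ∀ x ∈ (P 0).spanDeg W, ε.lin x = 0) (i : ℕ) :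
    Function.Exact (GrMod.quotGrMap W (d (i + 1))).lin (GrMod.quotGrMap W (d i)).lin := by
  intro u
  obtain ⟨u, rfl⟩ := GrMod.toQuotGr_surjective _ W u
  constructor
  · intro h
    rw [GrMod.quotGrMap_apply, GrMod.toQuotGr_eq_zero] at h
    obtain ⟨y, hy, hyu⟩ := ht.exists_preimage hP d (Z := fun i => LinearMap.range (d i).lin)
      (fun x hx => (hex0 x).1 (hε x hx)) (fun i => (LinearMap.exact_iff.1 (hex i)).symm)
      (fun _ => rfl) i h ⟨u, rfl⟩
    obtain ⟨v, hv⟩ := (hex i (u - y)).1 (by rw [map_sub, hyu, sub_self])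
    refine ⟨(GrMod.toQuotGr _ W).lin v, ?_⟩
    rw [GrMod.quotGrMap_apply, hv, map_sub, GrMod.toQuotGr_eq_zero.2 hy, sub_zero]
  · rintro ⟨v, hv⟩
    obtain ⟨v, rfl⟩ := GrMod.toQuotGr_surjective _ W v
    rw [← hv, GrMod.quotGrMap_apply, GrMod.quotGrMap_apply, (hex i _).2 ⟨v, rfl⟩, map_zero]

theorem exact_quotGr_zero (hex0 : Function.Exact (d 0).lin ε.lin)
    (hε : ∀ x ∈ (P 0).spanDeg W, ε.lin x = 0) :
    Function.Exact (GrMod.quotGrMap W (d 0)).lin (GrMod.quotGrDesc ε hε).lin := by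
  intro u
  obtain ⟨u, rfl⟩ := GrMod.toQuotGr_surjective _ W u
  constructor
  · intro h
    obtain ⟨v, hv⟩ := (hex0 u).1 h
    exact ⟨(GrMod.toQuotGr _ W).lin v, by rw [GrMod.quotGrMap_apply, hv]⟩
  · rintro ⟨v, hv⟩
    obtain ⟨v, rfl⟩ := GrMod.toQuotGr_surjective _ W v
    rw [← hv, GrMod.quotGrMap_apply, GrMod.quotGrDesc_apply]
    exact (hex0 _).2 ⟨v, rfl⟩

end Exact

/-- If the quotient of a complex by its components with degree in `W` is exact modulo the
components with degree in `V`, then the complex is exact modulo those with degree in `W ∪ V`. -/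
theorem exists_sub_mem_spanDeg_union {W V : Set Γ} {P₀ P₁ P₂ : GrMod 𝒜} {d : P₁ ⟶ P₀}
    {d' : P₂ ⟶ P₁} (h : ∀ u, (GrMod.quotGrMap W d).lin u ∈ (P₀.quotGr W).spanDeg V →
      ∃ v, u - (GrMod.quotGrMap W d').lin v ∈ (P₁.quotGr W).spanDeg V) {x : P₁}
    (hx : d.lin x ∈ P₀.spanDeg (W ∪ V)) :
    ∃ y, x - d'.lin y ∈ P₁.spanDeg (W ∪ V) := by
  have hW (M : GrMod 𝒜) : (M.quotGr W).spanDeg (W ∪ V) = (M.quotGr W).spanDeg V :=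
    GrMod.spanDeg_union fun γ hγ => GrMod.quotGr_deg_eq_bot hγ
  obtain ⟨v, hv⟩ := h ((P₁.toQuotGr W).lin x) (by
    rw [GrMod.quotGrMap_apply, ← hW]
    exact GrMod.map_mem_spanDeg _ hx)
  obtain ⟨v, rfl⟩ := P₂.toQuotGr_surjective W v
  refine ⟨v, GrMod.mem_spanDeg_of_toQuotGr Set.subset_union_left ?_⟩
  rw [map_sub, hW]
  exact hv

end Projective

end KostantSchur

end

noncomputable section

namespace KostantSchur

/-! ### Removal of the negative coordinates one at a time -/

section Rows

variable {K : Type u} [Field K] {n : ℕ}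

theorem kRow_succ_le (k : ℕ) : kRow K n (k + 1) ≤ kRow K n k :=
  Algebra.adjoin_mono fun _ ⟨p, a, h, h'⟩ => ⟨p, a, (Nat.le_succ k).trans h, h'⟩

/-- Restriction to the smaller algebra keeps a dual basis because `kRow k` is graded free over `kRow
(k + 1)` on the monomials of row `k`. -/
theorem HasDualBasis.kRow_succ {k : ℕ} (hk : k < n) {M : GrMod (kostantDeg K n)}
    (h : HasDualBasis (kRow K n k) M) : HasDualBasis (kRow K n (k + 1)) M := by
  have h1 : ∀ t : PosRoot n → ℕ, pbw K t ∈ kostantDeg K n (expDeg t) := pbw_mem_deg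
  let c : Kostant K n →+ (PosRoot n → ℕ) →₀ Kostant K n :=
    AddMonoidHom.mk' (fun x => rowCoord K n k x) (fun x y => (rowCoord K n k).map_add x y)
  have h2 : ∀ x ∈ kRow K n k, ∀ j, c x j ∈ kRow K n (k + 1) := fun _ hx => rowCoord_mem hk hx
  have h3 : ∀ b ∈ kRow K n (k + 1), ∀ x ∈ kRow K n k, c (b * x) = b • c x :=
    fun _ hb _ hx => rowCoord_smul hk hb hx
  have h4 : ∀ γ, ∀ x ∈ kostantDeg K n γ, ∀ j, c x j ∈ shiftDeg (kostantDeg K n) γ (expDeg j) :=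
    fun _ _ hx => rowCoord_deg k hx
  have h5 : ∀ x ∈ kRow K n k, ((c x).sum fun j y => y * pbw K j) = x :=
    fun _ hx => rowCoord_sum hk hx
  exact HasDualBasis.of_coord (𝒜 := kostantDeg K n) (R := kRow K n k) (R' := kRow K n (k + 1))
    (τ := PosRoot n → ℕ) (e := expDeg) (t := pbw K) (kRow_succ_le k) h1 c h2 h3 h4 h5 h

/-- The degrees `γ` for which some coordinate `j ≥ k` of `γ + z` is negative. -/
def negFrom (z : Fin n → ℤ) (k : ℕ) : Set (Psi n) :=
  {γ | ∃ j : Fin n, k ≤ j ∧ ((γ : Fin n → ℤ) + z) j < 0}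

/-- The degrees `γ` for which the coordinate `k` of `γ + z` is negative. -/
def negAt (z : Fin n → ℤ) (k : Fin n) : Set (Psi n) := {γ | ((γ : Fin n → ℤ) + z) k < 0}

theorem negAt_subset (z : Fin n → ℤ) (k : Fin n) : negAt z k ⊆ negFrom z k :=
  fun _ h => ⟨k, le_rfl, h⟩

theorem negFrom_eq_union (z : Fin n → ℤ) (k : Fin n) :
    negFrom z k = negAt z k ∪ negFrom z (k + 1) := by
  ext γ
  constructor
  · rintro ⟨j, hj, h⟩
    rcases Nat.eq_or_lt_of_le hj with h' | h'
    · left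
      rwa [show k = j from Fin.ext h']
    · exact Or.inr ⟨j, h', h⟩
  · rintro (h | ⟨j, hj, h⟩)
    · exact negAt_subset z k h
    · exact ⟨j, (Nat.le_succ _).trans hj, h⟩

/-- The coordinate `k` of a root `v_i - v_j` is `0` or `-1` for `i < k` and `0` or `1` for `i ≥ k`.
So the low rows keep the coordinate `k` of a degree negative, and with `A = kRow k * kLow k` the
high rows suffice to generate. Conversely, the high rows cannot make this coordinate negative if it
was not. -/
theorem truncates_negAt (z : Fin n → ℤ) (k : Fin n) :
    Truncates (kRow K n k) (negAt z k) (kostantDeg K n) where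
  span_le M x hx := by
    refine mem_span_of_forall_smul_mem (L := kLow K n k)
      (fun x => rowAlg_mul_lowAlg kostant_relations k.2.le (show x ∈ kRow K n 0 from ?_)) ?_ hx
    · rw [kRow_zero]
      trivial
    intro c hc
    generalize hS : Submodule.span K {m : M | ∃ γ ∈ negAt z k, m ∈ M.deg γ} = S
    induction hc using Algebra.adjoin_induction with
    | mem c hc =>
      obtain ⟨p, a, hp, rfl⟩ := hc
      subst hS
      intro m hm
      refine (Submodule.span_le (p := (Submodule.span K
        {m : M | ∃ γ ∈ negAt z k, m ∈ M.deg γ}).comap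
          (Algebra.lsmul K K M (divPowK K (p, a))))).2 ?_ hm
      rintro m ⟨γ, hγ, hm⟩
      have hd : divPowK K (p, a) ∈ kostantDeg K n (a • rootDeg p) :=
        Submodule.subset_span ⟨[(p, a)], by simp [listDeg], by simp⟩
      refine Submodule.subset_span ⟨_, ?_, SetLike.GradedSMul.smul_mem hd hm⟩
      refine lt_of_le_of_lt (b := ((γ : Fin n → ℤ) + z) k) ?_ hγ
      change ((a • (Pi.single p.1.1 1 - Pi.single p.1.2 1) : Fin n → ℤ) + γ + z) k ≤ _
      simp only [Pi.add_apply, Pi.smul_apply, Pi.sub_apply]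
      -- The first index is less than `k`, so the root can only subtract from the coordinate `k`.
      have h1 : (Pi.single p.1.1 1 : Fin n → ℤ) k = 0 :=
        Pi.single_eq_of_ne (fun h => hp.ne' (congrArg Fin.val h)) _
      have h2 : 0 ≤ (Pi.single p.1.2 1 : Fin n → ℤ) k := by
        rw [Pi.single_apply]
        split_ifs <;> simp
      rw [h1, zero_sub, smul_neg]
      have := nsmul_nonneg h2 a
      linarith
    | algebraMap c =>
      intro m hm
      rw [algebraMap_smul]
      exact S.smul_mem c hm
    | add a b _ _ ha hb =>
      intro m hm
      rw [add_smul]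
      exact S.add_mem (ha m hm) (hb m hm)
    | mul a b _ _ ha hb =>
      intro m hm
      rw [mul_smul]
      exact ha _ (hb m hm)
  mem_of_add x hx δ w hδ h0 h := by
    have h1 := deg_nonneg_of_mem_kRow hx hδ h0
    change ((δ : Fin n → ℤ) + w + z) k < 0 at h
    change ((w : Fin n → ℤ) + z) k < 0
    simp only [Pi.add_apply] at h ⊢
    linarith

/-- Induction on the number `c` of coordinates `k, …, n - 1` that remain. The quotient by the
degrees that are negative at `k` is again exact and has dual bases over `kRow (k + 1)`, so the
induction hypothesis applies to it. Truncation need not preserve projectivity over the whole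
algebra, which is why only dual bases over `kRow k` are assumed. -/
theorem exists_sub_mem_spanDeg (z : Fin n → ℤ) (c : ℕ) : ∀ (k : ℕ), k + c = n →
    ∀ (P : ℕ → GrMod (kostantDeg K n)) (d : ∀ i, P (i + 1) ⟶ P i) (M : GrMod (kostantDeg K n))
      (ε : P 0 ⟶ M), (∀ i, HasDualBasis (kRow K n k) (P i)) →
      (∀ i, Function.Exact (d (i + 1)).lin (d i).lin) → Function.Exact (d 0).lin ε.lin →
      (∀ γ ∈ negFrom z k, M.deg γ = ⊥) →
      ∀ i x, (d i).lin x ∈ (P i).spanDeg (negFrom z k) →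
        ∃ y, x - (d (i + 1)).lin y ∈ (P (i + 1)).spanDeg (negFrom z k) := by
  induction c with
  | zero =>
    rintro k hk P d M ε - hex - - i x hx
    have hn : negFrom z k = ∅ := by
      rw [Set.eq_empty_iff_forall_notMem]
      rintro γ ⟨j, hj, -⟩
      omega
    rw [GrMod.spanDeg_eq_bot (by simp [hn])] at hx
    obtain ⟨y, hy⟩ := (hex i x).1 hx
    exact ⟨y, by rw [hy, sub_self]; exact zero_mem _⟩
  | succ c ih =>
    rintro k hk P d M ε hP hex hex0 hM i x hx
    let k' : Fin n := ⟨k, by omega⟩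
    have ht : Truncates (kRow K n k) (negAt z k') (kostantDeg K n) := truncates_negAt z k'
    have hε : ∀ x ∈ (P 0).spanDeg (negAt z k'), ε.lin x = 0 := by
      intro x hx
      have := GrMod.map_mem_spanDeg ε hx
      rwa [GrMod.spanDeg_eq_bot fun γ hγ => hM γ (negAt_subset z k' hγ)] at this
    have hk' : negFrom z k = negAt z k' ∪ negFrom z (k + 1) := negFrom_eq_union z k'
    rw [hk'] at hx ⊢
    refine exists_sub_mem_spanDeg_union ?_ hx
    refine ih (k + 1) (by omega) _ (fun i => GrMod.quotGrMap (negAt z k') (d i)) M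
      (GrMod.quotGrDesc ε hε) (fun i => (ht.hasDualBasis_quotGr (hP i)).kRow_succ k'.2)
      (ht.exact_quotGr hP hex hex0 hε) (exact_quotGr_zero hex0 hε) ?_ i
    rintro γ ⟨j, hj, h⟩
    exact hM γ ⟨j, by omega, h⟩

/-- A graded projective resolution of the trivial module stays exact modulo the components whose
degrees `γ` do not satisfy `γ + z ≥ 0`. -/
theorem GrMod.IsProjRes.exists_sub_mem_spanDeg {z : Fin n → ℤ} (hz : ∀ j, 0 ≤ z j)
    {P : ℕ → GrMod (kostantDeg K n)} {d : ∀ i, P (i + 1) ⟶ P i} {ε : P 0 ⟶ trivialMod K n}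
    (h : GrMod.IsProjRes P d ε) {i : ℕ} {x : P (i + 1)}
    (hx : (d i).lin x ∈ (P i).spanDeg (negFrom z 0)) :
    ∃ y, x - (d (i + 1)).lin y ∈ (P (i + 1)).spanDeg (negFrom z 0) := by
  refine KostantSchur.exists_sub_mem_spanDeg z n 0 (zero_add n) P d (trivialMod K n) ε ?_ h.exact
    h.exact_zero ?_ i x hx
  · intro i
    rw [kRow_zero]
    exact (h.projective i).hasDualBasis
  · rintro γ ⟨j, -, hj⟩
    -- The trivial module lives in degree `0`, and `0 + z` has no negative coordinate.
    refine if_neg ?_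
    rintro rfl
    refine absurd hj (not_lt.2 ?_)
    change 0 ≤ (0 + z) j
    rw [zero_add]
    exact hz j

end Rows

end KostantSchur

end

noncomputable section

namespace KostantSchur

/-! ### Maps out of `(C ⧸ I) ⊗_C Q` -/

section Lift

variable {K : Type u} [Field K] {C : Type u} [Ring C] [Algebra K C] (I : Ideal C) [I.IsTwoSided]
  {Q : Type u} [AddCommGroup Q] [Module K Q] [Module C Q] [IsScalarTower K C Q]

/-- Linear maps from `(C ⧸ I) ⊗_C Q`. -/
def quotTensorLift {Y : Type*} [AddCommGroup Y] [Module K Y] (h : Q →ₗ[K] Y)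
    (hI : ∀ c ∈ I, ∀ q, h (c • q) = 0) : QuotTensor K I Q →ₗ[K] Y :=
  let f : C →ₗ[K] Q →ₗ[K] Y :=
    LinearMap.mk₂ K (fun c q => h (c • q))
      (fun c c' q => by rw [add_smul, map_add])
      (fun k c q => by rw [smul_assoc, map_smul])
      (fun c q q' => by rw [smul_add, map_add])
      (fun k c q => by rw [smul_comm, map_smul])
  let g : ((C ⧸ I) ⊗[K] Q) →ₗ[K] Y :=
    TensorProduct.lift (Submodule.liftQ (I.restrictScalars K) f (fun c hc => by
      ext q
      exact hI c hc q) : (C ⧸ I) →ₗ[K] Q →ₗ[K] Y)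
  Submodule.liftQ ((tensorRel (K := K) I Q).restrictScalars K) g (by
    intro t ht
    -- The relations span a `C ⧸ I`-submodule while `g` is only `K`-linear, so vanishing is proved
    -- for all multiples at once.
    have key : ∀ y : C ⧸ I, g (y • t) = 0 := by
      refine Submodule.span_induction (p := fun t _ => ∀ y : C ⧸ I, g (y • t) = 0)
        ?_ ?_ ?_ ?_ (show t ∈ tensorRel (K := K) I Q from ht)
      · rintro _ ⟨x, c, q, rfl⟩ y
        obtain ⟨b, rfl⟩ := Ideal.Quotient.mk_surjective x
        obtain ⟨a, rfl⟩ := Ideal.Quotient.mk_surjective y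
        rw [smul_sub, TensorProduct.smul_tmul', TensorProduct.smul_tmul', map_sub, sub_eq_zero]
        change h ((a * (b * c)) • q) = h ((a * b) • (c • q))
        rw [← mul_smul, mul_assoc]
      · intro y
        rw [smul_zero, map_zero]
      · intro t t' _ _ h h' y
        rw [smul_add, map_add, h, h', add_zero]
      · intro x t _ h y
        rw [← mul_smul, h]
    simpa using key 1)

theorem quotTensorLift_oneTmul {Y : Type*} [AddCommGroup Y] [Module K Y] (h : Q →ₗ[K] Y)
    (hI : ∀ c ∈ I, ∀ q, h (c • q) = 0) (q : Q) : quotTensorLift I h hI (oneTmul K I q) = h q := by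
  change h ((1 : C) • q) = _
  rw [one_smul]

theorem mk_smul_oneTmul (c : C) (q : Q) :
    Ideal.Quotient.mk I c • oneTmul K I q = oneTmul K I (c • q) := by
  change Ideal.Quotient.mk I c • qtmul K I 1 q = qtmul K I 1 (c • q)
  rw [smul_qtmul, mul_one, qtmul_mk]

/-- `C ⧸ I`-linear maps from `(C ⧸ I) ⊗_C Q`. -/
def quotTensorLiftₗ {Y : Type*} [AddCommGroup Y] [Module K Y] [Module (C ⧸ I) Y] (h : Q →ₗ[K] Y)
    (hI : ∀ c q, h (c • q) = Ideal.Quotient.mk I c • h q) : QuotTensor K I Q →ₗ[C ⧸ I] Y where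
  toFun := quotTensorLift I h fun c hc q => by
    rw [hI, Ideal.Quotient.eq_zero_iff_mem.2 hc, zero_smul]
  map_add' := map_add _
  map_smul' y t := by
    obtain ⟨c, rfl⟩ := Ideal.Quotient.mk_surjective y
    obtain ⟨q, rfl⟩ := oneTmul_surjective (K := K) I t
    rw [mk_smul_oneTmul, quotTensorLift_oneTmul, quotTensorLift_oneTmul, hI, RingHom.id_apply]

theorem quotTensorLiftₗ_oneTmul {Y : Type*} [AddCommGroup Y] [Module K Y] [Module (C ⧸ I) Y]
    (h : Q →ₗ[K] Y) (hI : ∀ c q, h (c • q) = Ideal.Quotient.mk I c • h q) (q : Q) :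
    quotTensorLiftₗ I h hI (oneTmul K I q) = h q :=
  quotTensorLift_oneTmul I h (fun c hc q => by
    rw [hI, Ideal.Quotient.eq_zero_iff_mem.2 hc, zero_smul]) q

end Lift

/-! ### Free graded modules with generators of given degrees -/

section Free

variable {K : Type u} [Field K] {Γ : Type} [AddMonoid Γ] [DecidableEq Γ] [IsRightCancelAdd Γ]
  {C : Type u} [Ring C] [Algebra K C] (𝒞 : Γ → Submodule K C) [GradedAlgebra 𝒞]

/-- The grading of a free module whose basis elements have the degrees `w`. -/
def freeDeg {ι : Type u} (w : ι → Γ) (γ : Γ) : Submodule K (ι →₀ C) where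
  carrier := {v | ∀ j, v j ∈ shiftDeg 𝒞 γ (w j)}
  zero_mem' _ := zero_mem _
  add_mem' h h' j := add_mem (h j) (h' j)
  smul_mem' k _ h j := Submodule.smul_mem _ k (h j)

open Classical in
/-- The projection of `C` onto the span of the components of degree `δ` with `δ + w = γ`. -/
def projShift (γ w : Γ) : C →ₗ[K] C :=
  if h : ∃ δ, δ + w = γ then projDeg 𝒞 h.choose else 0

theorem projShift_same {γ w : Γ} {c : C} (hc : c ∈ shiftDeg 𝒞 γ w) : projShift 𝒞 γ w c = c := by
  rcases mem_shiftDeg_iff.1 hc with rfl | ⟨δ, h, hδ⟩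
  · exact map_zero _
  · have h' : ∃ δ, δ + w = γ := ⟨δ, h⟩
    rw [projShift, dif_pos h', projDeg_same]
    rwa [add_right_cancel (h'.choose_spec.trans h.symm)]

theorem projShift_ne {γ γ' w : Γ} (hγ : γ' ≠ γ) {c : C} (hc : c ∈ shiftDeg 𝒞 γ' w) :
    projShift 𝒞 γ w c = 0 := by
  rcases mem_shiftDeg_iff.1 hc with rfl | ⟨δ, h, hδ⟩
  · exact map_zero _
  · unfold projShift
    split_ifs with h'
    · refine projDeg_ne 𝒞 _ δ ?_ c hδ
      rintro h2
      exact hγ (h.symm.trans ((congrArg (· + w) h2).trans h'.choose_spec))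
    · rfl

theorem single_mem_freeDeg {ι : Type u} {w : ι → Γ} {γ : Γ} {j : ι} {c : C}
    (hc : c ∈ shiftDeg 𝒞 γ (w j)) : Finsupp.single j c ∈ freeDeg 𝒞 w γ := by
  classical
  intro i
  rw [Finsupp.single_apply]
  split_ifs with h
  · rwa [← h]
  · exact zero_mem _

theorem freeDeg_isInternal {ι : Type u} (w : ι → Γ) : DirectSum.IsInternal (freeDeg 𝒞 w) := by
  let p (γ : Γ) : (ι →₀ C) →ₗ[K] (ι →₀ C) :=
    { toFun := fun v => Finsupp.onFinset v.support (fun j => projShift 𝒞 γ (w j) (v j))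
        fun j hj => Finsupp.mem_support_iff.2 fun h => hj (by rw [h, map_zero])
      map_add' := fun v v' => Finsupp.ext fun j => map_add (projShift 𝒞 γ (w j)) _ _
      map_smul' := fun k v => Finsupp.ext fun j => map_smul (projShift 𝒞 γ (w j)) k _ }
  refine isInternal_of_proj _ p ?_ ?_ ?_
  · exact fun γ v hv => Finsupp.ext fun j => projShift_same 𝒞 (hv j)
  · exact fun γ γ' h v hv => Finsupp.ext fun j => projShift_ne 𝒞 h (hv j)
  · rw [eq_top_iff]
    rintro v -
    induction v using Finsupp.induction_linear with
    | zero => exact zero_mem _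
    | add x y hx hy => exact add_mem hx hy
    | single j c =>
      have hc : c ∈ ⨆ δ, 𝒞 δ := by rw [iSup_deg]; trivial
      induction hc using Submodule.iSup_induction' with
      | zero => rw [Finsupp.single_zero]; exact zero_mem _
      | add x y _ _ hx hy => rw [Finsupp.single_add]; exact add_mem hx hy
      | mem δ c hc =>
        exact Submodule.mem_iSup_of_mem (δ + w j) (single_mem_freeDeg 𝒞 (mem_shiftDeg rfl hc))

/-- The free graded module on generators of the degrees `w`. -/
def freeGr {ι : Type u} (w : ι → Γ) : GrMod 𝒞 where
  carrier := ι →₀ C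
  deg := freeDeg 𝒞 w
  decomposition := (freeDeg_isInternal 𝒞 w).chooseDecomposition
  gradedSMul := ⟨fun {α γ c v} hc hv j => by
    change c * v j ∈ _
    rcases mem_shiftDeg_iff.1 (hv j) with h | ⟨δ, h, hδ⟩
    · rw [h, mul_zero]
      exact zero_mem _
    · exact mem_shiftDeg (by rw [add_assoc, h]; rfl) (SetLike.GradedMul.mul_mem hc hδ)⟩

theorem freeGr_isFree {ι : Type u} (w : ι → Γ) : (freeGr 𝒞 w).IsFree :=
  ⟨ι, (Finsupp.basisSingleOne : Module.Basis ι C (ι →₀ C)), fun j => ⟨w j,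
    single_mem_freeDeg 𝒞 (mem_shiftDeg (zero_add _) SetLike.GradedOne.one_mem)⟩⟩

end Free

/-! ### The truncation functor as a quotient by components -/

section TruncFunctor

variable {K : Type u} [Field K] {Γ : Type} [AddMonoid Γ] [DecidableEq Γ]
  {A : Type u} [Ring A] [Algebra K A] {𝒜 : Γ → Submodule K A} [GradedAlgebra 𝒜]
  {S : Type} [AddAction Γ S] (X : Set S) (x : S)

/-- The basis element of the one-dimensional module `N_x`. -/
def evalOne : EvalModule K x := (1 : K)

theorem exists_smul_evalOne (v : EvalModule K x) : ∃ k : K, k • evalOne x = v :=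
  ⟨v, mul_one (show K from v)⟩

/-- The map `m ↦ m ⊗ 1` from a graded module `M` to `M ⋉ N_x`. -/
def skewMk (M : GrMod 𝒜) : M →ₗ[K] skewObj 𝒜 S (EvalModule K x) M :=
  (TensorProduct.mk K M (EvalModule K x)).flip (evalOne x)

theorem skewMk_smul_eq_tmul (M : GrMod 𝒜) (k : K) (m : M) :
    skewMk x M (k • m) = (m ⊗ₜ (k • evalOne x) : M ⊗[K] EvalModule K x) :=
  TensorProduct.smul_tmul _ _ _

theorem skewMk_mem_deg {M : GrMod 𝒜} {γ : Γ} {m : M} (hm : m ∈ M.deg γ) :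
    skewMk x M m ∈ (skewObj 𝒜 S (EvalModule K x) M).deg γ :=
  tmul_mem_skewModuleDeg M.deg (EvalModule K x) hm _

theorem exists_skewMk_of_mem_deg {M : GrMod 𝒜} {γ : Γ} {q : skewObj 𝒜 S (EvalModule K x) M}
    (hq : q ∈ (skewObj 𝒜 S (EvalModule K x) M).deg γ) : ∃ m ∈ M.deg γ, skewMk x M m = q := by
  refine skewModuleDeg_le M.deg (EvalModule K x)
    (p := (M.deg γ).map (skewMk (𝒜 := 𝒜) x M)) ?_ hq
  intro m hm v
  obtain ⟨k, rfl⟩ := exists_smul_evalOne x v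
  exact ⟨k • m, Submodule.smul_mem _ _ hm, skewMk_smul_eq_tmul x M k m⟩

theorem skewMk_surjective (M : GrMod 𝒜) : Function.Surjective (skewMk (𝒜 := 𝒜) x M) := by
  intro q
  have hq := GrMod.iSup_deg' _ q
  induction hq using Submodule.iSup_induction' with
  | mem γ q hq =>
    obtain ⟨m, -, h⟩ := exists_skewMk_of_mem_deg x hq
    exact ⟨m, h⟩
  | zero => exact ⟨0, map_zero _⟩
  | add y z _ _ hy hz =>
    obtain ⟨m, rfl⟩ := hy
    obtain ⟨m', rfl⟩ := hz
    exact ⟨m + m', map_add _ _ _⟩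

/-- The inverse of `m ↦ m ⊗ 1`. -/
def skewInv (M : GrMod 𝒜) : skewObj 𝒜 S (EvalModule K x) M →ₗ[K] M :=
  (TensorProduct.rid K M).toLinearMap

theorem skewInv_skewMk (M : GrMod 𝒜) (m : M) : skewInv x M (skewMk x M m) = m :=
  (TensorProduct.rid_tmul m (1 : K)).trans (one_smul K m)

theorem tmul_smul_skewMk {M : GrMod 𝒜} {γ : Γ} {m : M} (hm : m ∈ M.deg γ) (a : A) (b : S → K) :
    SkewProduct.tmul 𝒜 a b • skewMk x M m = b (γ +ᵥ x) • skewMk x M (a • m) := by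
  refine (skewAct_tmul M.deg hm a b (evalOne x)).trans ?_
  rw [← map_smul, skewMk_smul_eq_tmul]
  rfl

theorem skewProduct_induction {p : SkewProduct 𝒜 S → Prop} (c : SkewProduct 𝒜 S) (h0 : p 0)
    (hadd : ∀ y z, p y → p z → p (y + z)) (h : ∀ a b, p (SkewProduct.tmul 𝒜 a b)) : p c := by
  refine TensorProduct.induction_on (motive := p) c h0 h hadd

/-- The map `m ↦ 1 ⊗ (m ⊗ 1)` from a graded module to its image under the functor
`C(X) ⊗_C (- ⋉ N_x)`. -/
def toTrunc (M : GrMod 𝒜) : M →ₗ[K] (truncFunctor 𝒜 X x).obj M :=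
  oneTmul K (truncIdeal 𝒜 X) (Q := skewObj 𝒜 S (EvalModule K x) M) ∘ₗ skewMk x M

theorem toTrunc_surjective (M : GrMod 𝒜) : Function.Surjective (toTrunc X x M) := by
  intro t
  obtain ⟨q, rfl⟩ := oneTmul_surjective (K := K) (truncIdeal 𝒜 X) t
  obtain ⟨m, rfl⟩ := skewMk_surjective x M q
  exact ⟨m, rfl⟩

theorem map_toTrunc {M N : GrMod 𝒜} (f : M ⟶ N) (m : M) :
    ((truncFunctor 𝒜 X x).map f).lin (toTrunc X x M m) = toTrunc X x N (f.lin m) := rfl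

theorem of_smul_toTrunc {M : GrMod 𝒜} {γ : Γ} {m : M} (hm : m ∈ M.deg γ) (a : A) (b : S → K) :
    Trunc.of 𝒜 X a b • toTrunc X x M m = b (γ +ᵥ x) • toTrunc X x M (a • m) := by
  refine (mk_smul_oneTmul (K := K) (truncIdeal 𝒜 X) (Q := skewObj 𝒜 S (EvalModule K x) M)
    (SkewProduct.tmul 𝒜 a b) (skewMk x M m)).trans ?_
  rw [tmul_smul_skewMk x hm]
  exact map_smul (oneTmul K (truncIdeal 𝒜 X) (Q := skewObj 𝒜 S (EvalModule K x) M)) _ _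

theorem of_one_smul_toTrunc {M : GrMod 𝒜} (m : M) (a : A) :
    Trunc.of 𝒜 X a 1 • toTrunc X x M m = toTrunc X x M (a • m) := by
  induction M.iSup_deg' m using Submodule.iSup_induction' with
  | zero => rw [map_zero, smul_zero, smul_zero, map_zero]
  | add y y' _ _ h h' => rw [map_add, smul_add, h, h', smul_add, map_add]
  | mem γ m hm =>
    rw [of_smul_toTrunc X x hm]
    exact one_smul K _

/-- The ideal that defines `C(X)` annihilates the modules without components outside of `X`. -/
theorem smul_eq_zero_of_mem_truncIdeal {M : GrMod 𝒜} (hM : ∀ γ, γ +ᵥ x ∉ X → M.deg γ = ⊥)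
    {c : SkewProduct 𝒜 S} (hc : c ∈ truncIdeal 𝒜 X) (q : skewObj 𝒜 S (EvalModule K x) M) :
    c • q = 0 := by
  classical
  have he : ∀ q : skewObj 𝒜 S (EvalModule K x) M, idem 𝒜 Xᶜ • q = 0 := by
    intro q
    obtain ⟨m, rfl⟩ := skewMk_surjective x M q
    induction M.iSup_deg' m using Submodule.iSup_induction' with
    | zero => rw [map_zero, smul_zero]
    | add y y' _ _ h h' => rw [map_add, smul_add, h, h', add_zero]
    | mem γ m hm =>
      unfold idem
      rw [tmul_smul_skewMk x hm]
      by_cases hγ : γ +ᵥ x ∈ X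
      · rw [Set.indicator_of_notMem (s := Xᶜ) (fun h => h hγ), zero_smul]
      · rw [hM γ hγ, Submodule.mem_bot] at hm
        rw [hm, smul_zero, map_zero, smul_zero]
  replace hc : c ∈ TwoSidedIdeal.span {idem 𝒜 Xᶜ} := hc
  rw [TwoSidedIdeal.mem_span_iff_mem_addSubgroup_closure] at hc
  induction hc using AddSubgroup.closure_induction with
  | zero => exact zero_smul _ _
  | add y z _ _ hy hz => rw [add_smul, hy, hz, add_zero]
  | neg y _ hy => rw [neg_smul, hy, neg_zero]
  | mem y hy =>
    obtain ⟨_, ⟨a, -, _, rfl, rfl⟩, b, -, rfl⟩ := hy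
    change (a * idem 𝒜 Xᶜ * b) • q = 0
    rw [mul_smul, mul_smul, he, smul_zero]

/-- The degrees that the functor `C(X) ⊗_C (- ⋉ N_x)` annihilates. -/
def outside : Set Γ := {γ | γ +ᵥ x ∉ X}

/-- This identifies the functor with `M ↦ M ⧸ M.spanDeg (outside X x)`. On a component of degree
outside, the idempotent of the complement of `X` acts as `1`, but it is `0` in `C(X)`. Conversely,
the quotient `N` has no components outside, so the ideal annihilates `N ⋉ N_x`, and `M → N` factors
through the image of `M`. -/
theorem toTrunc_eq_zero {M : GrMod 𝒜} {m : M} :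
    toTrunc X x M m = 0 ↔ m ∈ M.spanDeg (outside X x) := by
  constructor
  · intro h
    let N := M.quotGr (outside X x)
    let π : skewObj 𝒜 S (EvalModule K x) M ⟶ skewObj 𝒜 S (EvalModule K x) N :=
      (skewFunctor 𝒜 S (EvalModule K x)).map (M.toQuotGr (outside X x))
    have h1 := quotTensorLift_oneTmul (truncIdeal 𝒜 X) (skewInv x N ∘ₗ π.lin.restrictScalars K) (by
      intro c hc q
      change skewInv x N (π.lin (c • q)) = 0
      rw [map_smul, smul_eq_zero_of_mem_truncIdeal X x _ hc, map_zero]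
      exact fun γ hγ => GrMod.quotGr_deg_eq_bot hγ) (skewMk x M m)
    have h2 : oneTmul K (truncIdeal 𝒜 X) (skewMk x M m) = 0 := h
    rw [h2, map_zero] at h1
    exact GrMod.toQuotGr_eq_zero.1 ((skewInv_skewMk x N _).symm.trans h1.symm)
  · intro h
    induction h using Submodule.closure_induction with
    | zero => exact map_zero _
    | add y z _ _ hy hz => rw [map_add, hy, hz, add_zero]
    | smul_mem a m hm =>
      obtain ⟨γ, hγ, hm⟩ := hm
      -- The idempotent fixes `m`, as its weight `γ +ᵥ x` lies in the complement of `X`.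
      have h1 := of_smul_toTrunc X x hm 1 (Xᶜ.indicator 1)
      rw [Set.indicator_of_mem (s := Xᶜ) hγ, Pi.one_apply, one_smul, one_smul] at h1
      have h2 : Trunc.of 𝒜 X 1 (Xᶜ.indicator (1 : S → K)) = 0 :=
        Ideal.Quotient.eq_zero_iff_mem.2 (TwoSidedIdeal.subset_span rfl)
      rw [← of_one_smul_toTrunc, ← h1, h2, zero_smul, smul_zero]

theorem toTrunc_mem_deg {M : GrMod 𝒜} {γ : Γ} {m : M} (hm : m ∈ M.deg γ) :
    toTrunc X x M m ∈ ((truncFunctor 𝒜 X x).obj M).deg γ :=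
  ⟨skewMk x M m, skewMk_mem_deg x hm, rfl⟩

theorem exists_toTrunc_of_mem_deg {M : GrMod 𝒜} {γ : Γ} {t : (truncFunctor 𝒜 X x).obj M}
    (ht : t ∈ ((truncFunctor 𝒜 X x).obj M).deg γ) : ∃ m ∈ M.deg γ, toTrunc X x M m = t := by
  obtain ⟨q, hq, rfl⟩ := ht
  obtain ⟨m, hm, rfl⟩ := exists_skewMk_of_mem_deg x hq
  exact ⟨m, hm, rfl⟩

end TruncFunctor

end KostantSchur

end

noncomputable section

namespace KostantSchur

/-! ### Projectivity, exactness and radicals under the truncation functor -/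

section TruncFunctor

variable {K : Type u} [Field K] {Γ : Type} [AddMonoid Γ] [DecidableEq Γ]
  {A : Type u} [Ring A] [Algebra K A] {𝒜 : Γ → Submodule K A} [GradedAlgebra 𝒜]
  {S : Type} [AddAction Γ S] (X : Set S) (x : S)

theorem Trunc.of_mul_of {γ : Γ} {a' : A} (ha' : a' ∈ 𝒜 γ) (a : A) (b b' : S → K) :
    Trunc.of 𝒜 X a b * Trunc.of 𝒜 X a' b' = Trunc.of 𝒜 X (a * a') (shift γ b * b') :=
  (map_mul (Ideal.Quotient.mk (truncIdeal 𝒜 X)) _ _).symm.trans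
    (congrArg _ (SkewProduct.tmul_mul_tmul 𝒜 ha' a b b'))

variable (𝒜) in
/-- `a ⊗ b`, as a bilinear function of `a` and `b`. -/
def Trunc.ofₗ : A →ₗ[K] (S → K) →ₗ[K] Trunc 𝒜 X :=
  (TensorProduct.mk K A (S → K)).compr₂
    ((Ideal.Quotient.mkₐ K (truncIdeal 𝒜 X)).toLinearMap :
      SkewProduct 𝒜 S →ₗ[K] Trunc 𝒜 X)

theorem Trunc.ofₗ_apply (a : A) (b : S → K) : Trunc.ofₗ 𝒜 X a b = Trunc.of 𝒜 X a b := rfl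

theorem Trunc.of_mem {γ : Γ} {a : A} (ha : a ∈ 𝒜 γ) (b : S → K) :
    Trunc.of 𝒜 X a b ∈ truncDeg 𝒜 X γ :=
  mk_mem_quotDeg (skewDeg 𝒜 S) (truncIdeal 𝒜 X) (tmul_mem_skewModuleDeg 𝒜 (S → K) ha b)

theorem Trunc.induction {p : Trunc 𝒜 X → Prop} (c : Trunc 𝒜 X) (h0 : p 0)
    (hadd : ∀ y z, p y → p z → p (y + z)) (h : ∀ a b, p (Trunc.of 𝒜 X a b)) : p c := by
  obtain ⟨c, rfl⟩ := Ideal.Quotient.mk_surjective c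
  refine skewProduct_induction (p := fun c => p (Ideal.Quotient.mk _ c)) c ?_ ?_ h
  · rwa [map_zero]
  · intro y z hy hz
    rw [map_add]
    exact hadd _ _ hy hz

theorem comp_skewInv_smul {M : GrMod 𝒜} {Y : Type*} [AddCommGroup Y] [Module K Y]
    [Module (Trunc 𝒜 X) Y] (h : M →ₗ[K] Y) (hh : ∀ γ, ∀ m ∈ M.deg γ, ∀ (a : A) (b : S → K),
      h (b (γ +ᵥ x) • a • m) = Trunc.of 𝒜 X a b • h m) (c : SkewProduct 𝒜 S)
    (q : skewObj 𝒜 S (EvalModule K x) M) :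
    (h ∘ₗ skewInv x M) (c • q) =
      Ideal.Quotient.mk (truncIdeal 𝒜 X) c • (h ∘ₗ skewInv x M) q := by
  obtain ⟨m, rfl⟩ := skewMk_surjective x M q
  rw [LinearMap.comp_apply, LinearMap.comp_apply, skewInv_skewMk]
  refine skewProduct_induction (p := fun c => h (skewInv x M (c • skewMk x M m)) =
    Ideal.Quotient.mk (truncIdeal 𝒜 X) c • h m) c ?_ ?_ ?_
  · rw [zero_smul, map_zero, map_zero, map_zero, zero_smul]
  · intro y z hy hz
    rw [add_smul, map_add, map_add, hy, hz, map_add, add_smul]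
  · intro a b
    induction M.iSup_deg' m using Submodule.iSup_induction' with
    | zero => simp only [map_zero, smul_zero]
    | add y z _ _ hy hz => simp only [map_add, smul_add, hy, hz]
    | mem γ m hm =>
      rw [tmul_smul_skewMk x hm, ← map_smul, skewInv_skewMk]
      exact hh γ m hm a b

variable {X x} in
/-- `C(X)`-linear maps from the image of a graded module under the functor `C(X) ⊗_C (- ⋉ N_x)`.
-/
def truncLift {M : GrMod 𝒜} {Y : Type*} [AddCommGroup Y] [Module K Y] [Module (Trunc 𝒜 X) Y]
    (h : M →ₗ[K] Y) (hh : ∀ γ, ∀ m ∈ M.deg γ, ∀ (a : A) (b : S → K),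
      h (b (γ +ᵥ x) • a • m) = Trunc.of 𝒜 X a b • h m) :
    (truncFunctor 𝒜 X x).obj M →ₗ[Trunc 𝒜 X] Y :=
  let f : QuotTensor K (truncIdeal 𝒜 X) (skewObj 𝒜 S (EvalModule K x) M) →ₗ[Trunc 𝒜 X] Y :=
    quotTensorLiftₗ (truncIdeal 𝒜 X) (h ∘ₗ skewInv x M) (comp_skewInv_smul X x h hh)
  f

theorem truncLift_toTrunc {M : GrMod 𝒜} {Y : Type*} [AddCommGroup Y] [Module K Y]
    [Module (Trunc 𝒜 X) Y] (h : M →ₗ[K] Y) (hh : ∀ γ, ∀ m ∈ M.deg γ, ∀ (a : A) (b : S → K),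
      h (b (γ +ᵥ x) • a • m) = Trunc.of 𝒜 X a b • h m) (m : M) :
    truncLift h hh (toTrunc X x M m) = h m :=
  (quotTensorLiftₗ_oneTmul (truncIdeal 𝒜 X) (h ∘ₗ skewInv x M) (comp_skewInv_smul X x h hh)
    (skewMk x M m)).trans (congrArg h (skewInv_skewMk x M m))

theorem shift_mul_indicator (γ : Γ) (b : S → K) (y : S) :
    shift γ b * Set.indicator {y} 1 = b (γ +ᵥ y) • Set.indicator {y} 1 := by
  funext s
  rw [Pi.mul_apply, Pi.smul_apply, shift_apply, smul_eq_mul]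
  by_cases h : s = y
  · rw [h]
  · rw [Set.indicator_of_notMem (s := {y}) h, mul_zero, mul_zero]

/-- The functor `C(X) ⊗_C (- ⋉ N_x)` maps graded projective modules to graded projective modules.
-/
theorem HasDualBasis.isProjective [IsRightCancelAdd Γ] {P : GrMod 𝒜} (h : HasDualBasis ⊤ P) :
    ((truncFunctor 𝒜 X x).obj P).IsProjective := by
  obtain ⟨ι, g, w, φ, hg, -, hφ, hsum⟩ := h
  have hφA (a : A) (m : P) : φ (a • m) = a • φ m :=
    φ.map_smul (⟨a, trivial⟩ : (⊤ : Subalgebra K A)) m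
  have hφK (k : K) (m : P) : φ (k • m) = k • φ m := by
    rw [← algebraMap_smul A k m, hφA, algebraMap_smul]
  -- The generator `g j` has the weight `w j +ᵥ x`. Multiplied by the indicator of this point, the
  -- coordinate becomes `C(X)`-linear: a function `b` moved past an element of degree `δ` acts there
  -- as the scalar `b (δ +ᵥ w j +ᵥ x)`.
  let e (j : ι) : S → K := Set.indicator {w j +ᵥ x} 1
  have hs (m : P) (j : ι) (hj : Trunc.ofₗ 𝒜 X (φ m j) (e j) ≠ 0) : j ∈ (φ m).support :=
    Finsupp.mem_support_iff.2 fun h => hj (by rw [h, map_zero]; rfl)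
  let h0 : P →ₗ[K] (ι →₀ Trunc 𝒜 X) :=
    { toFun := fun m => Finsupp.onFinset (φ m).support (fun j => Trunc.ofₗ 𝒜 X (φ m j) (e j)) (hs m)
      map_add' := fun m m' => Finsupp.ext fun j => by
        change Trunc.ofₗ 𝒜 X (φ (m + m') j) (e j) =
          Trunc.ofₗ 𝒜 X (φ m j) (e j) + Trunc.ofₗ 𝒜 X (φ m' j) (e j)
        rw [map_add, Finsupp.add_apply, map_add, LinearMap.add_apply]
      map_smul' := fun k m => Finsupp.ext fun j => by
        change Trunc.ofₗ 𝒜 X (φ (k • m) j) (e j) = k • Trunc.ofₗ 𝒜 X (φ m j) (e j)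
        rw [hφK, Finsupp.smul_apply, map_smul, LinearMap.smul_apply] }
  have hh : ∀ γ, ∀ m ∈ P.deg γ, ∀ (a : A) (b : S → K),
      h0 (b (γ +ᵥ x) • a • m) = Trunc.of 𝒜 X a b • h0 m := by
    intro γ m hm a b
    rw [map_smul]
    ext j
    change b (γ +ᵥ x) • Trunc.ofₗ 𝒜 X (φ (a • m) j) (e j) =
      Trunc.of 𝒜 X a b * Trunc.ofₗ 𝒜 X (φ m j) (e j)
    rw [hφA, Finsupp.smul_apply, smul_eq_mul]
    rcases mem_shiftDeg_iff.1 (hφ γ m hm j) with h | ⟨δ, rfl, hδ⟩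
    · rw [h, mul_zero, map_zero, LinearMap.zero_apply, smul_zero, mul_zero]
    · rw [Trunc.ofₗ_apply _ (φ m j), Trunc.of_mul_of X hδ, shift_mul_indicator, ← Trunc.ofₗ_apply,
        map_smul, ← add_vadd]
  let i : (truncFunctor 𝒜 X x).obj P ⟶ freeGr (truncDeg 𝒜 X) w :=
    { lin := truncLift h0 hh
      map_deg := by
        intro γ t ht
        obtain ⟨m, hm, rfl⟩ := exists_toTrunc_of_mem_deg X x ht
        suffices h : h0 m ∈ freeDeg (truncDeg 𝒜 X) w γ by
          rw [← truncLift_toTrunc X x h0 hh m] at h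
          exact h
        intro j
        change Trunc.ofₗ 𝒜 X (φ m j) (e j) ∈ _
        rcases mem_shiftDeg_iff.1 (hφ γ m hm j) with h | ⟨δ, rfl, hδ⟩
        · rw [h, map_zero]
          exact zero_mem _
        · exact mem_shiftDeg rfl (Trunc.of_mem X hδ _) }
  let p : freeGr (truncDeg 𝒜 X) w ⟶ (truncFunctor 𝒜 X x).obj P :=
    { lin := Finsupp.linearCombination (Trunc 𝒜 X) fun j => toTrunc X x P (g j)
      map_deg := fun γ v hv =>
        linearCombination_mem_deg (fun j => toTrunc_mem_deg X x (hg j)) hv }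
  refine ⟨freeGr (truncDeg 𝒜 X) w, freeGr_isFree _ w, i, p, GrMod.hom_ext (LinearMap.ext ?_)⟩
  intro t
  obtain ⟨m, rfl⟩ := toTrunc_surjective X x P t
  change Finsupp.linearCombination _ _ (truncLift h0 hh (toTrunc X x P m)) = toTrunc X x P m
  rw [truncLift_toTrunc, Finsupp.linearCombination_apply]
  refine (Finsupp.onFinset_sum (g := fun j c => c • toTrunc X x P (g j)) (hs m)
    fun j => zero_smul (Trunc 𝒜 X) (toTrunc X x P (g j))).trans ?_
  conv_rhs => rw [← hsum m, Finsupp.linearCombination_apply, Finsupp.sum, map_sum]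
  refine Finset.sum_congr rfl fun j _ => ?_
  rw [Trunc.ofₗ_apply, of_smul_toTrunc X x (hg j), show e j (w j +ᵥ x) = 1 from
    Set.indicator_of_mem (s := {w j +ᵥ x}) rfl 1, one_smul]

theorem truncFunctor_finite {M : GrMod 𝒜} [Module.Finite A M] :
    Module.Finite (Trunc 𝒜 X) ((truncFunctor 𝒜 X x).obj M) := by
  classical
  obtain ⟨s, hs⟩ := Module.Finite.fg_top (R := A) (M := M)
  refine ⟨s.image (toTrunc X x M), ?_⟩
  rw [eq_top_iff]
  rintro t -
  obtain ⟨m, rfl⟩ := toTrunc_surjective X x M t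
  have hm : m ∈ Submodule.span A (s : Set M) := by rw [hs]; trivial
  rw [Finset.coe_image]
  induction hm using Submodule.span_induction with
  | mem m hm => exact Submodule.subset_span ⟨m, hm, rfl⟩
  | zero => rw [map_zero]; exact zero_mem _
  | add y z _ _ hy hz => rw [map_add]; exact add_mem hy hz
  | smul a m _ hm =>
    rw [← of_one_smul_toTrunc]
    exact Submodule.smul_mem _ _ hm

/-- The functor `C(X) ⊗_C (- ⋉ N_x)` preserves a resolution that stays exact modulo the components
with degree outside of `X`. -/
theorem GrMod.IsProjRes.truncFunctor [IsRightCancelAdd Γ] {P : ℕ → GrMod 𝒜}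
    {d : ∀ i, P (i + 1) ⟶ P i} {M : GrMod 𝒜} {ε : P 0 ⟶ M} (h : GrMod.IsProjRes P d ε)
    (hd : ∀ i y, (d i).lin y ∈ (P i).spanDeg (outside X x) →
      ∃ z, y - (d (i + 1)).lin z ∈ (P (i + 1)).spanDeg (outside X x))
    (hM : ∀ γ ∈ outside X x, M.deg γ = ⊥) :
    GrMod.IsProjRes (fun i => (truncFunctor 𝒜 X x).obj (P i))
      (fun i => (truncFunctor 𝒜 X x).map (d i)) ((truncFunctor 𝒜 X x).map ε) where
  projective i := (h.projective i).hasDualBasis.isProjective X x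
  exact i t := by
    obtain ⟨y, rfl⟩ := toTrunc_surjective X x _ t
    rw [map_toTrunc, toTrunc_eq_zero]
    constructor
    · intro hy
      obtain ⟨z, hz⟩ := hd i y hy
      refine ⟨toTrunc X x _ z, ?_⟩
      rw [map_toTrunc, ← sub_eq_zero, ← map_sub, toTrunc_eq_zero, ← neg_mem_iff, neg_sub]
      exact hz
    · rintro ⟨t, ht⟩
      obtain ⟨z, rfl⟩ := toTrunc_surjective X x _ t
      rw [map_toTrunc] at ht
      rw [← toTrunc_eq_zero, ← map_toTrunc, ← ht, map_toTrunc, (h.exact i _).2 ⟨z, rfl⟩, map_zero]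
  exact_zero t := by
    obtain ⟨y, rfl⟩ := toTrunc_surjective X x _ t
    rw [map_toTrunc, toTrunc_eq_zero, GrMod.spanDeg_eq_bot hM, Submodule.mem_bot]
    constructor
    · intro hy
      obtain ⟨z, rfl⟩ := (h.exact_zero y).1 hy
      exact ⟨toTrunc X x _ z, rfl⟩
    · rintro ⟨t, ht⟩
      obtain ⟨z, rfl⟩ := toTrunc_surjective X x _ t
      rw [map_toTrunc] at ht
      have h2 : toTrunc X x _ (ε.lin y) = 0 := by
        rw [← map_toTrunc, ← ht, map_toTrunc, (h.exact_zero _).2 ⟨z, rfl⟩, map_zero]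
      rwa [toTrunc_eq_zero, GrMod.spanDeg_eq_bot hM] at h2
  surjective t := by
    obtain ⟨m, rfl⟩ := toTrunc_surjective X x _ t
    obtain ⟨y, rfl⟩ := h.surjective m
    exact ⟨toTrunc X x _ y, rfl⟩

theorem range_truncFunctor_map_le {J : Ideal A} {J' : Ideal (Trunc 𝒜 X)}
    (hJ : ∀ a ∈ J, Trunc.of 𝒜 X a 1 ∈ J') {P Q : GrMod 𝒜} {d : P ⟶ Q}
    (hd : LinearMap.range d.lin ≤ J • (⊤ : Submodule A Q)) :
    LinearMap.range ((truncFunctor 𝒜 X x).map d).lin ≤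
      J' • (⊤ : Submodule (Trunc 𝒜 X) ((truncFunctor 𝒜 X x).obj Q)) := by
  rintro _ ⟨t, rfl⟩
  obtain ⟨m, rfl⟩ := toTrunc_surjective X x _ t
  rw [map_toTrunc]
  refine Submodule.smul_induction_on (hd ⟨m, rfl⟩) ?_ ?_
  · intro a ha q _
    rw [← of_one_smul_toTrunc]
    exact Submodule.smul_mem_smul (hJ a ha) trivial
  · intro y z hy hz
    rw [map_add]
    exact add_mem hy hz

end TruncFunctor

section Ungraded

variable {K : Type u} [Field K] {Γ : Type} [AddMonoid Γ] [DecidableEq Γ]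
  {A : Type u} [Ring A] [Algebra K A] {𝒜 : Γ → Submodule K A}

theorem GrMod.IsProjective.projective {P : GrMod 𝒜} (h : P.IsProjective) :
    Module.Projective A P := by
  obtain ⟨F, ⟨ι, b, -⟩, i, p, hip⟩ := h
  have : Module.Projective A F := Module.Projective.of_basis b
  exact Module.Projective.of_split i.lin p.lin (congrArg GrMod.Hom.lin hip)

end Ungraded

end KostantSchur

end

noncomputable section

namespace KostantSchur

/-! ### Elements of positive height and the two radicals -/

section Radical

variable {K : Type u} [Field K] {Γ : Type} [AddMonoid Γ] [DecidableEq Γ]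
  {C : Type u} [Ring C] [Algebra K C] (𝒞 : Γ → Submodule K C) [GradedAlgebra 𝒞]

/-- The kernel of `χ` is homogeneous, since `χ` vanishes outside degree `0`, and it has codimension
one; so it is itself a maximal graded left ideal. -/
theorem gradedRadical_le_ker (χ : C →ₐ[K] K) (hχ : ∀ γ, γ ≠ 0 → ∀ c ∈ 𝒞 γ, χ c = 0) :
    gradedRadical 𝒞 ≤ RingHom.ker χ := by
  classical
  refine sInf_le ⟨⟨fun γ c hc => ?_, ?_⟩, fun I hI hle c hc => ?_⟩
  · have hd (β : Γ) : β ≠ 0 → χ (DirectSum.decompose 𝒞 c β : C) = 0 :=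
      fun h => hχ β h _ (SetLike.coe_mem _)
    by_cases h : γ = 0
    · have hs := congrArg χ (DirectSum.sum_support_decompose 𝒞 c)
      rw [map_sum, RingHom.mem_ker.1 hc] at hs
      rw [RingHom.mem_ker, h]
      by_cases h0 : (0 : Γ) ∈ DFinsupp.support (DirectSum.decompose 𝒞 c)
      · rwa [Finset.sum_eq_single_of_mem 0 h0 fun β _ hβ => hd β hβ] at hs
      · rw [DFinsupp.notMem_support_iff.1 h0]
        exact map_zero χ
    · exact hd γ h
  · rw [Ideal.ne_top_iff_one, RingHom.mem_ker, map_one]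
    exact one_ne_zero
  · by_contra hne
    refine hI.2 ((Ideal.eq_top_iff_one I).2 ?_)
    -- If `c` is not in the kernel, then the nonzero scalar `χ c` lies in `I`.
    have h1 : c - algebraMap K C (χ c) ∈ I := hle (by
      rw [RingHom.mem_ker, map_sub, AlgHom.commutes, Algebra.algebraMap_self_apply, sub_self])
    have h2 : algebraMap K C (χ c) ∈ I := by
      have := I.sub_mem hc h1
      rwa [sub_sub_cancel] at this
    have h3 := I.mul_mem_left (algebraMap K C (χ c)⁻¹) h2
    rwa [← map_mul, inv_mul_cancel₀ hne, map_one] at h3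

variable (l : Γ →+ ℤ)

/-- The span of the components of degree at least `k` with respect to the height `l`. -/
def heightGE (k : ℕ) : Submodule K C := Submodule.span K {c | ∃ γ, (k : ℤ) ≤ l γ ∧ c ∈ 𝒞 γ}

theorem mul_mem_heightGE {k k' : ℕ} {x y : C} (hx : x ∈ heightGE 𝒞 l k)
    (hy : y ∈ heightGE 𝒞 l k') : x * y ∈ heightGE 𝒞 l (k + k') := by
  have h := Submodule.mul_mem_mul hx hy
  unfold heightGE at h
  rw [Submodule.span_mul_span] at h
  refine Submodule.span_mono ?_ h
  rintro _ ⟨x, ⟨γ, hγ, hx⟩, y, ⟨γ', hγ', hy⟩, rfl⟩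
  refine ⟨γ + γ', ?_, SetLike.GradedMul.mul_mem hx hy⟩
  rw [map_add, Nat.cast_add]
  exact add_le_add hγ hγ'

variable {𝒞 l}

theorem mem_heightGE_zero (hl : ∀ γ, 0 ≤ l γ) (x : C) : x ∈ heightGE 𝒞 l 0 := by
  have hx : x ∈ ⨆ γ, 𝒞 γ := by rw [iSup_deg]; trivial
  exact (iSup_le fun γ c hc => Submodule.subset_span ⟨γ, hl γ, hc⟩ :
    ⨆ γ, 𝒞 γ ≤ heightGE 𝒞 l 0) hx

/-- The product `b c` has only components of height at least `1`, so its `N`-th power has only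
components of height at least `N`, which vanish. Thus `b c` is nilpotent. -/
theorem isUnit_one_sub_mul (hl : ∀ γ, 0 ≤ l γ) {N : ℕ} (hN : ∀ γ, (N : ℤ) ≤ l γ → 𝒞 γ = ⊥) {γ : Γ}
    (hγ : 1 ≤ l γ) {c : C} (hc : c ∈ 𝒞 γ) (b : C) : IsUnit (1 - b * c) := by
  have h1 : b * c ∈ heightGE 𝒞 l 1 := by
    rw [← zero_add 1]
    exact mul_mem_heightGE 𝒞 l (mem_heightGE_zero hl b) (Submodule.subset_span ⟨γ, hγ, hc⟩)
  have h2 (k : ℕ) : (b * c) ^ k ∈ heightGE 𝒞 l k := by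
    induction k with
    | zero => exact mem_heightGE_zero hl _
    | succ k ih =>
      rw [pow_succ]
      exact mul_mem_heightGE 𝒞 l ih h1
  refine IsNilpotent.isUnit_one_sub ⟨N, ?_⟩
  have h3 : heightGE 𝒞 l N ≤ ⊥ := by
    refine Submodule.span_le.2 ?_
    rintro c ⟨γ, hγ, hc⟩
    rwa [hN γ hγ] at hc
  exact h3 (h2 N)

/-- If `1 = y + b c` with `y ∈ I`, then `y = 1 - b c` is a unit. Hence `c` can be adjoined to any
maximal left ideal, graded or not, without enlarging it, so `c` lies in both radicals. -/
theorem sup_span_ne_top (hl : ∀ γ, 0 ≤ l γ) {N : ℕ} (hN : ∀ γ, (N : ℤ) ≤ l γ → 𝒞 γ = ⊥) {γ : Γ}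
    (hγ : 1 ≤ l γ) {c : C} (hc : c ∈ 𝒞 γ) {I : Ideal C} (hI : I ≠ ⊤) : I ⊔ Ideal.span {c} ≠ ⊤ := by
  intro h
  have h1 : (1 : C) ∈ I ⊔ Ideal.span {c} := by
    rw [h]
    trivial
  obtain ⟨y, hy, z, hz, h⟩ := Submodule.mem_sup.1 h1
  obtain ⟨b, rfl⟩ := Submodule.mem_span_singleton.1 hz
  have h2 := isUnit_one_sub_mul hl hN hγ hc b
  rw [← h, smul_eq_mul, add_sub_cancel_right] at h2
  exact hI (Ideal.eq_top_of_isUnit_mem I hy h2)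

theorem mem_jacobson_of_height (hl : ∀ γ, 0 ≤ l γ) {N : ℕ} (hN : ∀ γ, (N : ℤ) ≤ l γ → 𝒞 γ = ⊥)
    {γ : Γ} (hγ : 1 ≤ l γ) {c : C} (hc : c ∈ 𝒞 γ) : c ∈ Ring.jacobson C := by
  rw [Ring.jacobson_eq_sInf_isMaximal, Ideal.mem_sInf]
  intro m hm
  replace hm : m.IsMaximal := hm
  by_contra hcm
  exact sup_span_ne_top hl hN hγ hc hm.ne_top
    (hm.out.2 _ (left_lt_sup.2 fun h => hcm (h (Ideal.mem_span_singleton_self c))))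

theorem isHomogeneous_sup_span {I : Ideal C} (hI : Submodule.IsHomogeneous I 𝒞) {γ : Γ} {c : C}
    (hc : c ∈ 𝒞 γ) : Submodule.IsHomogeneous (I ⊔ Ideal.span {c}) 𝒞 := by
  intro β x hx
  obtain ⟨y, hy, z, hz, rfl⟩ := Submodule.mem_sup.1 hx
  obtain ⟨b, rfl⟩ := Submodule.mem_span_singleton.1 hz
  change projDeg 𝒞 β (y + b • c) ∈ _
  rw [map_add]
  refine add_mem (Submodule.mem_sup_left (hI β hy)) (Submodule.mem_sup_right ?_)
  clear hx hz
  have hb : b ∈ ⨆ α, 𝒞 α := by rw [iSup_deg]; trivial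
  induction hb using Submodule.iSup_induction' with
  | zero =>
    rw [zero_smul, map_zero]
    exact zero_mem _
  | add b b' _ _ h h' =>
    rw [add_smul, map_add]
    exact add_mem h h'
  | mem α b hb =>
    have h : b • c ∈ 𝒞 (α + γ) := SetLike.GradedMul.mul_mem hb hc
    by_cases h' : α + γ = β
    · rw [projDeg_same _ _ _ (h' ▸ h)]
      exact Ideal.mul_mem_left _ _ (Ideal.mem_span_singleton_self c)
    · rw [projDeg_ne _ _ _ h' _ h]
      exact zero_mem _

theorem mem_gradedRadical_of_height (hl : ∀ γ, 0 ≤ l γ) {N : ℕ}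
    (hN : ∀ γ, (N : ℤ) ≤ l γ → 𝒞 γ = ⊥) {γ : Γ} (hγ : 1 ≤ l γ) {c : C} (hc : c ∈ 𝒞 γ) :
    c ∈ gradedRadical 𝒞 := by
  rw [gradedRadical, Ideal.mem_sInf]
  intro m hm
  have h1 := hm.2 ⟨isHomogeneous_sup_span hm.1.1 hc, sup_span_ne_top hl hN hγ hc hm.1.2⟩
    le_sup_left
  exact h1 (Submodule.mem_sup_right (Ideal.mem_span_singleton_self c))

end Radical

/-! ### Vanishing of elements of `C(X)` -/

section Truncation

variable {K : Type u} [Field K] {Γ : Type} [AddMonoid Γ] [DecidableEq Γ]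
  {A : Type u} [Ring A] [Algebra K A] {𝒜 : Γ → Submodule K A} [GradedAlgebra 𝒜]
  {S : Type} [AddAction Γ S] {X : Set S}

theorem Trunc.of_indicator_compl : Trunc.of 𝒜 X 1 (Xᶜ.indicator (1 : S → K)) = 0 :=
  Ideal.Quotient.eq_zero_iff_mem.2 (TwoSidedIdeal.subset_span rfl)

/-- In `C(X)`, the element `a ⊗ b` with `a` of degree `γ` vanishes if `b` vanishes at all points
`s` for which `s` and `γ + s` lie in `X`. -/
theorem Trunc.of_eq_zero {γ : Γ} {a : A} (ha : a ∈ 𝒜 γ) {b : S → K}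
    (hb : ∀ s ∈ X, γ +ᵥ s ∈ X → b s = 0) : Trunc.of 𝒜 X a b = 0 := by
  classical
  -- The first summand carries the points `s` outside `X` and is killed by the idempotent on the
  -- right; the second carries those with `γ +ᵥ s` outside `X` and is killed by the idempotent on
  -- the left.
  have h1 : b = Xᶜ.indicator b + shift γ (Xᶜ.indicator 1) * X.indicator b := by
    funext s
    rw [Pi.add_apply, Pi.mul_apply, shift_apply]
    by_cases hs : s ∈ X
    · rw [Set.indicator_of_notMem (s := Xᶜ) (fun h => h hs), Set.indicator_of_mem hs, zero_add]
      by_cases hs' : γ +ᵥ s ∈ X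
      · rw [hb s hs hs', mul_zero]
      · rw [Set.indicator_of_mem (s := Xᶜ) hs', Pi.one_apply, one_mul]
    · rw [Set.indicator_of_mem (s := Xᶜ) hs, Set.indicator_of_notMem hs, mul_zero, add_zero]
  have h2 : Trunc.of 𝒜 X a (Xᶜ.indicator b) = 0 := by
    have h := Trunc.of_mul_of X (SetLike.GradedOne.one_mem (A := 𝒜)) a b (Xᶜ.indicator 1)
    rw [Trunc.of_indicator_compl, mul_zero, mul_one, shift_zero] at h
    rw [h]
    congr 1
    funext s
    by_cases hs : s ∈ Xᶜ
    · simp [Set.indicator_of_mem hs]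
    · simp [Set.indicator_of_notMem hs]
  have h3 : Trunc.of 𝒜 X a (shift γ (Xᶜ.indicator 1) * X.indicator b) = 0 := by
    have h := Trunc.of_mul_of X ha 1 (Xᶜ.indicator 1) (X.indicator b)
    rwa [Trunc.of_indicator_compl, zero_mul, one_mul, eq_comm] at h
  rw [h1, ← Trunc.ofₗ_apply, map_add, Trunc.ofₗ_apply, Trunc.ofₗ_apply, h2, h3, add_zero]

theorem Trunc.of_mem_ideal {J : Ideal (Trunc 𝒜 X)} {a : A} (b : S → K)
    (h : ∀ γ, projDeg 𝒜 γ a = 0 ∨ Trunc.of 𝒜 X (projDeg 𝒜 γ a) b ∈ J) : Trunc.of 𝒜 X a b ∈ J := by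
  classical
  have h1 := congrArg (fun a => Trunc.ofₗ 𝒜 X a b) (DirectSum.sum_support_decompose 𝒜 a)
  dsimp only at h1
  rw [Trunc.ofₗ_apply _ a, map_sum, LinearMap.sum_apply] at h1
  rw [← h1]
  refine sum_mem fun γ _ => ?_
  rcases h γ with h | h
  · rw [show (DirectSum.decompose 𝒜 a γ : A) = 0 from h, map_zero]
    exact J.zero_mem
  · exact h

theorem truncDeg_eq_bot {γ : Γ} (h : ∀ s ∈ X, γ +ᵥ s ∉ X) : truncDeg 𝒜 X γ = ⊥ := by
  rw [eq_bot_iff]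
  rintro _ ⟨c, hc, rfl⟩
  refine skewModuleDeg_le 𝒜 (S → K)
    (p := LinearMap.ker ((Ideal.Quotient.mkₐ K (truncIdeal 𝒜 X)).toLinearMap :
      SkewProduct 𝒜 S →ₗ[K] Trunc 𝒜 X)) ?_ hc
  intro a ha b
  exact Trunc.of_eq_zero ha fun s hs hs' => absurd hs' (h s hs)

end Truncation

/-! ### Height bounds and the radical of the Kostant form -/

section Kostant

variable {K : Type u} [Field K] {n r : ℕ}

/-- The height on `Ψ_n`. -/
def height (n : ℕ) : Psi n →+ ℤ where
  toFun γ := -∑ i : Fin n, (i : ℤ) * (γ : Fin n → ℤ) i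
  map_zero' := by simp
  map_add' γ γ' := by simp [mul_add, Finset.sum_add_distrib, add_comm]

theorem height_rootDeg (p : PosRoot n) : height n (rootDeg p) = (p.1.2 : ℤ) - (p.1.1 : ℤ) := by
  change -∑ i : Fin n, (i : ℤ) * (Pi.single p.1.1 1 - Pi.single p.1.2 1 : Fin n → ℤ) i = _
  simp [mul_sub, Finset.sum_sub_distrib, Pi.single_apply]

theorem one_le_height_rootDeg (p : PosRoot n) : 1 ≤ height n (rootDeg p) := by
  rw [height_rootDeg]
  have : (p.1.1 : ℕ) < p.1.2 := p.2
  omega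

theorem eq_zero_or_one_le_height (γ : Psi n) : γ = 0 ∨ 1 ≤ height n γ := by
  obtain ⟨γ, hγ⟩ := γ
  induction hγ using AddSubmonoid.closure_induction with
  | mem γ hγ =>
    obtain ⟨i, j, hij, rfl⟩ := hγ
    have h : i < j := Fin.lt_def.2 (by omega)
    exact Or.inr (one_le_height_rootDeg ⟨(i, j), h⟩)
  | zero => exact Or.inl rfl
  | add γ γ' hγ hγ' h h' =>
    rcases h with h | h
    · rcases h' with h' | h'
      · have h1 : γ = 0 := congrArg Subtype.val h
        have h2 : γ' = 0 := congrArg Subtype.val h'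
        exact Or.inl (Subtype.ext (by simp [h1, h2]))
      · right
        have : γ = 0 := congrArg Subtype.val h
        simpa [this] using h'
    · right
      have h2 := (height n).map_add ⟨γ, hγ⟩ ⟨γ', hγ'⟩
      change height n ⟨γ + γ', _⟩ = _ at h2
      rw [h2]
      rcases h' with h' | h'
      · rw [h', map_zero, add_zero]
        exact h
      · linarith

theorem height_nonneg (γ : Psi n) : 0 ≤ height n γ := by
  rcases eq_zero_or_one_le_height γ with rfl | h
  · rw [map_zero]
  · linarith

/-- A nonzero component of degree `γ` requires `s` and `γ + s` in `Λ(n, r)`. The height of `γ` is `∑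
i s_i - ∑ i (γ + s)_i`, where the first sum is at most `n r` and the second is nonnegative. -/
theorem cLambdaDeg_eq_bot {γ : Psi n} (hγ : ((n * r + 1 : ℕ) : ℤ) ≤ height n γ) :
    cLambdaDeg K n r γ = ⊥ := by
  refine truncDeg_eq_bot fun s hs hs' => ?_
  have h1 : height n γ = ∑ i : Fin n, (i : ℤ) * s i - ∑ i : Fin n, (i : ℤ) * (γ +ᵥ s) i := by
    change -∑ i : Fin n, (i : ℤ) * (γ : Fin n → ℤ) i =
      _ - ∑ i : Fin n, (i : ℤ) * ((γ : Fin n → ℤ) i + s i)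
    simp [mul_add, Finset.sum_add_distrib]
  have h2 : 0 ≤ ∑ i : Fin n, (i : ℤ) * (γ +ᵥ s) i :=
    Finset.sum_nonneg fun i _ => mul_nonneg (Nat.cast_nonneg _) (hs'.1 i)
  have h3 : ∑ i : Fin n, (i : ℤ) * s i ≤ n * r := by
    rw [← hs.2, Finset.mul_sum]
    refine Finset.sum_le_sum fun i _ => mul_le_mul_of_nonneg_right ?_ (hs.1 i)
    exact_mod_cast i.2.le
  push_cast at hγ
  linarith

/-- Heights add up, and every divided power with positive exponent has positive height; so in a
product of degree `0` all exponents are `0`. -/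
theorem kostantDeg_zero_le : kostantDeg K n 0 ≤ Submodule.span K {1} := by
  refine Submodule.span_le.2 ?_
  rintro _ ⟨l, hl, rfl⟩
  have h : (l.map (divPowK K)).prod = 1 := by
    have h1 := congrArg (height n) hl
    rw [listDeg, map_list_sum, map_zero, List.map_map] at h1
    refine List.prod_eq_one fun x hx => ?_
    obtain ⟨q, hq, rfl⟩ := List.mem_map.1 hx
    have h2 : (height n) (q.2 • rootDeg q.1) = 0 := by
      refine le_antisymm ?_ (height_nonneg _)
      rw [← h1]
      refine List.single_le_sum ?_ _ (List.mem_map.2 ⟨q, hq, rfl⟩)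
      intro x hx
      obtain ⟨q, -, rfl⟩ := List.mem_map.1 hx
      exact height_nonneg _
    rw [map_nsmul, nsmul_eq_mul, mul_eq_zero] at h2
    have h3 : q.2 = 0 := by
      rcases h2 with h2 | h2
      · exact_mod_cast h2
      · have := one_le_height_rootDeg q.1
        omega
    obtain ⟨p, a⟩ := q
    obtain rfl : a = 0 := h3
    exact divPowK_zero K p
  rw [h]
  exact Submodule.subset_span rfl

theorem counitK_projDeg (a : Kostant K n) :
    counitK K n (projDeg (kostantDeg K n) 0 a) = counitK K n a := by
  have ha : a ∈ ⨆ γ, kostantDeg K n γ := by rw [iSup_deg]; trivial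
  induction ha using Submodule.iSup_induction' with
  | zero => rw [map_zero]
  | add x y _ _ hx hy => rw [map_add, map_add, map_add, hx, hy]
  | mem γ a ha =>
    by_cases h : γ = 0
    · subst h
      have h1 : projDeg (kostantDeg K n) 0 a = a := projDeg_same _ _ _ ha
      rw [h1]
    · have h1 : projDeg (kostantDeg K n) 0 a = 0 := projDeg_ne _ _ _ h _ ha
      rw [h1, map_zero, counitK_eq_zero K h ha]

/-- The radical lies in the augmentation ideal, and the component of degree `0` of an element is the
scalar given by its augmentation. Only components of positive height remain, which is what
`of_mem_of_mem_gradedRadical` uses. -/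
theorem projDeg_zero_of_mem_gradedRadical {a : Kostant K n}
    (ha : a ∈ gradedRadical (kostantDeg K n)) : projDeg (kostantDeg K n) 0 a = 0 := by
  have h1 := gradedRadical_le_ker (kostantDeg K n) (counitK K n)
    (fun γ hγ c hc => counitK_eq_zero K hγ hc) ha
  rw [RingHom.mem_ker] at h1
  obtain ⟨k, hk⟩ := Submodule.mem_span_singleton.1
    (kostantDeg_zero_le (projDeg_mem (kostantDeg K n) 0 a))
  have h2 := counitK_projDeg a
  rw [← hk, map_smul, map_one, smul_eq_mul, mul_one] at h2
  rw [← hk, h2.trans h1, zero_smul]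

theorem of_mem_of_mem_gradedRadical {J : Ideal (CLambda K n r)}
    (hJ : ∀ γ : Psi n, 1 ≤ height n γ → ∀ c ∈ cLambdaDeg K n r γ, c ∈ J) {a : Kostant K n}
    (ha : a ∈ gradedRadical (kostantDeg K n)) : CLambda.of K n r a 1 ∈ J := by
  refine Trunc.of_mem_ideal 1 fun γ => ?_
  rcases eq_zero_or_one_le_height γ with rfl | hγ
  · exact Or.inl (projDeg_zero_of_mem_gradedRadical ha)
  · exact Or.inr (hJ γ hγ _ (Trunc.of_mem _ (projDeg_mem _ γ a) 1))

theorem mem_gradedRadical_cLambda {γ : Psi n} (hγ : 1 ≤ height n γ) {c : CLambda K n r}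
    (hc : c ∈ cLambdaDeg K n r γ) : c ∈ gradedRadical (cLambdaDeg K n r) :=
  mem_gradedRadical_of_height (𝒞 := cLambdaDeg K n r) (l := height n) (N := n * r + 1)
    height_nonneg (fun _ => cLambdaDeg_eq_bot) hγ hc

theorem mem_jacobson_cLambda {γ : Psi n} (hγ : 1 ≤ height n γ) {c : CLambda K n r}
    (hc : c ∈ cLambdaDeg K n r γ) : c ∈ Ring.jacobson (CLambda K n r) :=
  mem_jacobson_of_height (𝒞 := cLambdaDeg K n r) (l := height n) (N := n * r + 1)
    height_nonneg (fun _ => cLambdaDeg_eq_bot) hγ hc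

theorem of_mem_gradedRadical {a : Kostant K n} (ha : a ∈ gradedRadical (kostantDeg K n)) :
    CLambda.of K n r a 1 ∈ gradedRadical (cLambdaDeg K n r) :=
  of_mem_of_mem_gradedRadical (fun _ hγ _ hc => mem_gradedRadical_cLambda hγ hc) ha

theorem of_mem_jacobson {a : Kostant K n} (ha : a ∈ gradedRadical (kostantDeg K n)) :
    CLambda.of K n r a 1 ∈ Ring.jacobson (CLambda K n r) :=
  of_mem_of_mem_gradedRadical (fun _ hγ _ hc => mem_jacobson_cLambda hγ hc) ha

end Kostant

end KostantSchur

end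

noncomputable section

namespace KostantSchur

/-! ### Representations of `C(X)` from weighted representations of `A` -/

section TruncRep

variable {K : Type u} [Field K] {Γ : Type} [AddMonoid Γ] [DecidableEq Γ]
  {A : Type u} [Ring A] [Algebra K A] {𝒜 : Γ → Submodule K A} [GradedAlgebra 𝒜]
  {S : Type} [AddAction Γ S] {X : Set S} {ι : Type} [Fintype ι] [DecidableEq ι]
  (ρ : A →ₐ[K] Matrix ι ι K) (wt : ι → S)

variable (𝒜) in
/-- The linear map `a ⊗ b ↦ ρ a * diag (b ∘ wt)`. -/
def skewRepLin : SkewProduct 𝒜 S →ₗ[K] Matrix ι ι K :=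
  TensorProduct.lift (LinearMap.mk₂ K (fun (a : A) (b : S → K) => ρ a * Matrix.diagonal (b ∘ wt))
    (fun a a' b => by rw [map_add, add_mul])
    (fun k a b => by rw [map_smul, smul_mul_assoc])
    (fun a b b' => by
      rw [← mul_add, Matrix.diagonal_add]
      rfl)
    (fun k a b => by
      rw [← mul_smul_comm, ← Matrix.diagonal_smul]
      rfl))

theorem skewRepLin_tmul (a : A) (b : S → K) :
    skewRepLin 𝒜 ρ wt (SkewProduct.tmul 𝒜 a b) = ρ a * Matrix.diagonal (b ∘ wt) :=
  TensorProduct.lift.tmul _ _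

variable {ρ wt} in
/-- The representation of a skew product that is defined by a representation of `A` on which the
elements of degree `γ` shift the weights by `γ`. -/
def skewRep (h : ∀ γ, ∀ a ∈ 𝒜 γ, ∀ i j, ρ a i j ≠ 0 → wt i = γ +ᵥ wt j) :
    SkewProduct 𝒜 S →ₐ[K] Matrix ι ι K :=
  AlgHom.ofLinearMap (skewRepLin 𝒜 ρ wt)
    (by
      rw [SkewProduct.one_def, skewRepLin_tmul, map_one, one_mul]
      exact Matrix.diagonal_one)
    (by
      intro x y
      refine skewProduct_induction (p := fun x => skewRepLin 𝒜 ρ wt (x * y) =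
        skewRepLin 𝒜 ρ wt x * skewRepLin 𝒜 ρ wt y) x ?_ ?_ ?_
      · rw [zero_mul, map_zero, zero_mul]
      · intro x x' hx hx'
        rw [add_mul, map_add, map_add, hx, hx', add_mul]
      · intro a b
        refine skewProduct_induction (p := fun y => skewRepLin 𝒜 ρ wt (SkewProduct.tmul 𝒜 a b * y) =
          skewRepLin 𝒜 ρ wt (SkewProduct.tmul 𝒜 a b) * skewRepLin 𝒜 ρ wt y) y ?_ ?_ ?_
        · rw [mul_zero, map_zero, mul_zero]
        · intro x x' hx hx'
          rw [mul_add, map_add, map_add, hx, hx', mul_add]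
        · intro a' b'
          have ha' : a' ∈ ⨆ γ, 𝒜 γ := by rw [iSup_deg]; trivial
          induction ha' using Submodule.iSup_induction' with
          | zero =>
            have h0 : SkewProduct.tmul 𝒜 0 b' = 0 := TensorProduct.zero_tmul _ _
            rw [h0, mul_zero, map_zero, mul_zero]
          | add x x' _ _ hx hx' =>
            have h0 : SkewProduct.tmul 𝒜 (x + x') b' =
              SkewProduct.tmul 𝒜 x b' + SkewProduct.tmul 𝒜 x' b' := TensorProduct.add_tmul _ _ _
            rw [h0, mul_add, map_add, map_add, hx, hx', mul_add]
          | mem γ a' ha' =>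
            rw [SkewProduct.tmul_mul_tmul 𝒜 ha', skewRepLin_tmul, skewRepLin_tmul,
              skewRepLin_tmul, map_mul, mul_assoc, mul_assoc]
            congr 1
            -- A nonzero entry of `ρ a'` at `(i, j)` forces `wt i = γ +ᵥ wt j`, so moving the
            -- diagonal matrix of `b` to the right shifts `b` by `γ`.
            ext i j
            rw [Matrix.mul_diagonal, Matrix.diagonal_mul, Matrix.mul_diagonal]
            by_cases hij : ρ a' i j = 0
            · rw [hij, zero_mul, zero_mul, mul_zero]
            · simp only [Function.comp_apply, Pi.mul_apply, shift_apply, h γ a' ha' i j hij]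
              ring)

variable {ρ wt} in
/-- The representation of `C(X)` that is defined by a representation of `A` with weights in `X`. -/
def truncRep (h : ∀ γ, ∀ a ∈ 𝒜 γ, ∀ i j, ρ a i j ≠ 0 → wt i = γ +ᵥ wt j) (hX : ∀ i, wt i ∈ X) :
    Trunc 𝒜 X →ₐ[K] Matrix ι ι K :=
  Ideal.Quotient.liftₐ (truncIdeal 𝒜 X) (skewRep h) (by
    have h1 : TwoSidedIdeal.span {idem 𝒜 Xᶜ} ≤ TwoSidedIdeal.ker (skewRep h) := by
      rw [TwoSidedIdeal.span_le]
      rintro _ rfl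
      refine (TwoSidedIdeal.mem_ker _).2 ?_
      refine (skewRepLin_tmul (𝒜 := 𝒜) ρ wt 1 _).trans ?_
      rw [map_one, one_mul, Matrix.diagonal_eq_zero]
      funext i
      exact Set.indicator_of_notMem (s := Xᶜ) (fun h => h (hX i)) 1
    exact fun c hc => (TwoSidedIdeal.mem_ker _).1 (h1 hc))

theorem truncRep_of (h : ∀ γ, ∀ a ∈ 𝒜 γ, ∀ i j, ρ a i j ≠ 0 → wt i = γ +ᵥ wt j)
    (hX : ∀ i, wt i ∈ X) (a : A) (b : S → K) (i j : ι) :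
    truncRep h hX (Trunc.of 𝒜 X a b) i j = ρ a i j * b (wt j) := by
  refine (congrFun (congrFun (skewRepLin_tmul (𝒜 := 𝒜) ρ wt a b) i) j).trans ?_
  rw [Matrix.mul_diagonal]
  rfl

end TruncRep

/-! ### Count matrices of pairs of multi-indices -/

section Count

variable {n r : ℕ}

/-- The number of positions at which `(g, f)` is a given pair. -/
def count (g f : Idx n r) (p : Fin n × Fin n) : ℕ :=
  (Finset.univ.filter fun s => g s = p.1 ∧ f s = p.2).card

theorem sum_count_left (g f : Idx n r) (j : Fin n) : ∑ i, (count g f (i, j) : ℤ) = weight f j := by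
  unfold weight
  rw [Finset.card_eq_sum_card_fiberwise (f := g) (t := Finset.univ) (fun _ _ => by simp)]
  push_cast
  refine Finset.sum_congr rfl fun i _ => ?_
  rw [count, Finset.filter_filter]
  simp only [and_comm]

theorem weight_mem_compositions (f : Idx n r) : weight f ∈ compositions n r := by
  refine ⟨fun i => Nat.cast_nonneg _, ?_⟩
  have h := Finset.card_eq_sum_card_fiberwise (s := (Finset.univ : Finset (Fin r))) (f := f)
    (t := Finset.univ) (fun _ _ => by simp)
  rw [Finset.card_fin] at h
  unfold weight
  exact_mod_cast h.symm

theorem sum_posRoot {M : Type*} [AddCommMonoid M] (F : PosRoot n → M) :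
    ∑ p, F p = ∑ x : Fin n × Fin n, if h : x.1 < x.2 then F ⟨x, h⟩ else 0 := by
  rw [← Finset.sum_filter_of_ne (p := fun x : Fin n × Fin n => x.1 < x.2)]
  · rw [Finset.sum_subtype (p := fun x : Fin n × Fin n => x.1 < x.2) _ (by simp)]
    refine Finset.sum_congr rfl fun p _ => ?_
    rw [dif_pos p.2]
  · intro x _ hx
    by_contra h
    exact hx (dif_neg h)

/-- A position `s` with `g s = i < j = f s` contributes `v_i - v_j` both to the degree and to the
difference of the weights; the other positions contribute nothing. -/
theorem expDeg_add_weight {g f : Idx n r} (hgf : ∀ s, g s ≤ f s) {T : PosRoot n → ℕ}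
    (hT : ∀ p : PosRoot n, count g f p.1 = T p) :
    (expDeg T : Fin n → ℤ) + weight f = weight g := by
  funext i
  rw [Pi.add_apply, coe_expDeg_apply]
  have h1 (f : Idx n r) : weight f i = ∑ s, if i = f s then (1 : ℤ) else 0 := by
    unfold weight
    rw [Finset.card_filter]
    push_cast
    exact Finset.sum_congr rfl fun s _ => by simp only [eq_comm]
  rw [h1 f, h1 g, ← eq_sub_iff_add_eq, ← Finset.sum_sub_distrib]
  have h2 (p : PosRoot n) : (T p : ℤ) = ∑ s, if g s = p.1.1 ∧ f s = p.1.2 then 1 else 0 := by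
    rw [← hT, count, Finset.card_filter]
    push_cast
    rfl
  simp only [h2, Finset.sum_mul]
  rw [Finset.sum_comm]
  refine Finset.sum_congr rfl fun s _ => ?_
  rcases (hgf s).eq_or_lt with h | h
  · rw [h, sub_self]
    refine Finset.sum_eq_zero fun p _ => ?_
    rw [if_neg, zero_mul]
    rintro ⟨h3, h4⟩
    exact absurd p.2 (by rw [← h3, ← h4]; exact lt_irrefl _)
  · rw [Finset.sum_eq_single_of_mem (⟨(g s, f s), h⟩ : PosRoot n) (Finset.mem_univ _)]
    · simp
    · rintro p - hp
      rw [if_neg, zero_mul]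
      rintro ⟨h3, h4⟩
      exact hp (Subtype.ext (Prod.ext h3.symm h4.symm))

/-- The count matrices of pairs of multi-indices `g ≤ f`. -/
def Upper (N : Fin n × Fin n → ℕ) : Prop := ∀ p, p.2 < p.1 → N p = 0

theorem upper_count {g f : Idx n r} (h : ∀ s, g s ≤ f s) : Upper (count g f) := by
  intro p hp
  refine Finset.card_eq_zero.2 (Finset.filter_eq_empty_iff.2 ?_)
  rintro s - ⟨h1, h2⟩
  exact absurd (h s) (not_le.2 (by rwa [h1, h2]))

theorem le_of_upper_count {g f : Idx n r} (h : Upper (count g f)) (s : Fin r) : g s ≤ f s := by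
  by_contra h'
  have := h (g s, f s) (not_le.1 h')
  rw [count, Finset.card_eq_zero, Finset.filter_eq_empty_iff] at this
  exact this (Finset.mem_univ s) ⟨rfl, rfl⟩

theorem exists_count_eq {N : Fin n × Fin n → ℕ} (hN : ∑ p, N p = r) :
    ∃ g f : Idx n r, count g f = N := by
  obtain ⟨c, hc⟩ := exists_card_fiber N hN
  refine ⟨fun s => (c s).1, fun s => (c s).2, funext fun p => ?_⟩
  rw [← hc p, count]
  simp only [Prod.ext_iff]

/-- The exponents of positive roots in a count matrix. -/
def upperPart (N : Fin n × Fin n → ℕ) (p : PosRoot n) : ℕ := N p.1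

/-- The column sums of a count matrix. -/
def colSum (N : Fin n × Fin n → ℕ) (j : Fin n) : ℤ := ∑ i, (N (i, j) : ℤ)

/-- The diagonal entries of an upper triangular count matrix are determined by the entries above the
diagonal and the column sums, and the column sums are the weight of `f`. -/
theorem count_eq_iff {N : Fin n × Fin n → ℕ} (hN : Upper N) {g f : Idx n r} :
    count g f = N ↔ ((∀ s, g s ≤ f s) ∧ ∀ p : PosRoot n, count g f p.1 = upperPart N p) ∧
      weight f = colSum N := by
  constructor
  · rintro rfl
    exact ⟨⟨le_of_upper_count hN, fun _ => rfl⟩, funext fun j => (sum_count_left g f j).symm⟩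
  · rintro ⟨⟨h1, h2⟩, h3⟩
    have h4 : ∀ i j, i ≠ j → count g f (i, j) = N (i, j) := by
      intro i j hij
      rcases lt_or_gt_of_ne hij with h | h
      · exact h2 ⟨(i, j), h⟩
      · rw [hN _ h, upper_count h1 _ h]
    funext ⟨i, j⟩
    by_cases hij : i = j
    · subst hij
      have h5 := congrFun h3 i
      rw [← sum_count_left g f i, colSum, ← Finset.add_sum_erase _ _ (Finset.mem_univ i),
        ← Finset.add_sum_erase (a := i) _ (fun j => (N (j, i) : ℤ)) (Finset.mem_univ i)] at h5
      have h6 : ∑ j ∈ Finset.univ.erase i, (count g f (j, i) : ℤ) =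
          ∑ j ∈ Finset.univ.erase i, (N (j, i) : ℤ) :=
        Finset.sum_congr rfl fun j hj => by rw [h4 j i (Finset.ne_of_mem_erase hj)]
      rw [h6] at h5
      exact_mod_cast add_right_cancel h5
    · exact h4 i j hij

/-- The count matrix with given part above the diagonal and given column sums. -/
def mkCount (T : PosRoot n → ℕ) (w : Fin n → ℤ) (p : Fin n × Fin n) : ℕ :=
  if h : p.1 < p.2 then T ⟨p, h⟩
  else if p.1 = p.2 then
    -- If this difference is negative, the entry is `0` and the column sum exceeds `w`;
    -- `colSum_mkCount` excludes this case.
    (w p.2 - ∑ i, ((if h : i < p.2 then T ⟨(i, p.2), h⟩ else 0 : ℕ) : ℤ)).toNat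
  else 0

theorem upper_mkCount (T : PosRoot n → ℕ) (w : Fin n → ℤ) : Upper (mkCount T w) := by
  intro p hp
  rw [mkCount, dif_neg hp.not_gt, if_neg hp.ne']

theorem upperPart_mkCount (T : PosRoot n → ℕ) (w : Fin n → ℤ) : upperPart (mkCount T w) = T := by
  funext p
  exact dif_pos p.2

theorem colSum_mkCount {T : PosRoot n → ℕ} {w : Fin n → ℤ}
    (h : ∀ j, ∑ i, ((if h : i < j then T ⟨(i, j), h⟩ else 0 : ℕ) : ℤ) ≤ w j) :
    colSum (mkCount T w) = w := by
  funext j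
  have h1 (i : Fin n) : (mkCount T w (i, j) : ℤ) =
      ((if h : i < j then T ⟨(i, j), h⟩ else 0 : ℕ) : ℤ) +
        if i = j then w j - ∑ i, ((if h : i < j then T ⟨(i, j), h⟩ else 0 : ℕ) : ℤ) else 0 := by
    rcases lt_trichotomy i j with hij | rfl | hij
    · simp [mkCount, hij, hij.ne]
    · rw [mkCount, dif_neg (lt_irrefl _), if_pos rfl, dif_neg (lt_irrefl _), if_pos rfl,
        Int.toNat_of_nonneg (sub_nonneg.2 (h i))]
      simp
    · simp [mkCount, hij.not_gt, hij.ne']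
  unfold colSum
  simp only [h1]
  rw [Finset.sum_add_distrib, Finset.sum_ite_eq' Finset.univ j, if_pos (Finset.mem_univ j)]
  ring

theorem sum_eq_of_colSum_mem {N : Fin n × Fin n → ℕ} (hN : colSum N ∈ compositions n r) :
    ∑ p, N p = r := by
  have h := hN.2
  unfold colSum at h
  rw [Finset.sum_comm] at h
  rw [Fintype.sum_prod_type]
  exact_mod_cast h

end Count

end KostantSchur

end

noncomputable section

namespace KostantSchur

/-! ### Faithfulness of `C_n(Λ(n, r))` on the tensor power -/

section WeightRep

variable {K : Type u} [Field K] {n r : ℕ}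

theorem weight_eq_of_kostantRep_ne_zero {γ : Psi n} {x : Kostant K n} (hx : x ∈ kostantDeg K n γ)
    {g f : Idx n r} (h : kostantRep K n r x g f ≠ 0) : weight g = γ +ᵥ weight f := by
  by_contra h'
  apply h
  refine Submodule.span_induction (p := fun x _ => kostantRep K n r x g f = 0) ?_ ?_ ?_ ?_
    (mem_span_pbw_of_deg hx)
  · rintro _ ⟨T, hT, rfl⟩
    rw [kostantRep_pbw, if_neg]
    rintro ⟨h1, h2⟩
    exact h' ((expDeg_add_weight h1 h2).symm.trans (congrArg (fun γ : Psi n =>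
      (γ : Fin n → ℤ) + weight f) hT))
  · rw [map_zero]
    rfl
  · intro x y _ _ h1 h2
    rw [map_add, Matrix.add_apply, h1, h2, add_zero]
  · intro k x _ h1
    rw [map_smul, Matrix.smul_apply, h1, smul_zero]

variable (K n r) in
/-- The representation of `C_n(Λ(n, r))` on the tensor power, in matrix form. -/
def weightRep : CLambda K n r →ₐ[K] Matrix (Idx n r) (Idx n r) K :=
  truncRep (𝒜 := kostantDeg K n) (X := compositions n r) (ρ := kostantRep K n r)
    (wt := weight) (fun _ _ ha _ _ h => weight_eq_of_kostantRep_ne_zero ha h)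
    weight_mem_compositions

theorem weightRep_of (a : Kostant K n) (b : (Fin n → ℤ) → K) (g f : Idx n r) :
    weightRep K n r (CLambda.of K n r a b) g f = kostantRep K n r a g f * b (weight f) :=
  truncRep_of (𝒜 := kostantDeg K n) _ _ _ _ a b g f

/-- The matrix whose entry at `(g, f)` is `1` if the count matrix of `(g, f)` is `N`, and `0`
otherwise. -/
def orbMat (K : Type u) [Field K] (N : Fin n × Fin n → ℕ) : Matrix (Idx n r) (Idx n r) K :=
  Matrix.of fun g f => if count g f = N then 1 else 0

theorem orbMat_apply (N : Fin n × Fin n → ℕ) (g f : Idx n r) :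
    orbMat K N g f = if count g f = N then 1 else 0 := rfl

variable (K r) in
/-- The element of `C_n(Λ(n, r))` that is represented by the matrix of an orbit. -/
def orbElt (N : Fin n × Fin n → ℕ) : CLambda K n r :=
  CLambda.of K n r (pbw K (upperPart N)) (Set.indicator {colSum N} 1)

/-- The monomial fixes the multiplicities above the diagonal and the indicator function fixes the
weight of `f`; by `count_eq_iff` both together fix the count matrix. -/
theorem weightRep_orbElt {N : Fin n × Fin n → ℕ} (hN : Upper N) :
    weightRep K n r (orbElt K r N) = orbMat K N := by
  ext g f
  rw [orbElt, weightRep_of, kostantRep_pbw, orbMat_apply, ite_cond_congr (propext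
    (count_eq_iff hN)), Set.indicator_apply (s := {colSum N})]
  by_cases h1 : weight f = colSum N
  · rw [if_pos (show weight f ∈ ({colSum N} : Set _) from h1), Pi.one_apply, mul_one]
    exact ite_cond_congr (propext (and_iff_left h1).symm)
  · rw [if_neg (show weight f ∉ ({colSum N} : Set _) from h1), mul_zero, if_neg (fun h => h1 h.2)]

/-- The monomial is a left multiple of its part `T'` in the rows `i < j`. From the weight `w`, this
part subtracts `∑ T (i, j)` from the coordinate `j` and adds nothing to it, so it leads out of `Λ(n,
r)` if that sum exceeds `w j`. -/
theorem of_pbw_indicator_eq_zero {T : PosRoot n → ℕ} {w : Fin n → ℤ} {j : Fin n}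
    (h : w j < ∑ i, ((if h : i < j then T ⟨(i, j), h⟩ else 0 : ℕ) : ℤ)) :
    CLambda.of K n r (pbw K T) (Set.indicator {w} 1) = 0 := by
  set T' : PosRoot n → ℕ := fun p => if p.1.1 < j then T p else 0 with hT'
  have hj : (j : ℕ) + (n - j) = n := by omega
  have h1 : pbw K T = mon K (rootsFrom n j (n - j)) T * pbw K T' := by
    rw [pbw_eq_mul hj, pbw_eq_mul hj T',
      mon_eq_one (l := rootsFrom n j (n - j)) (T := T') (fun p hp => ?_), one_mul,
      mon_congr (l := rootsFrom n 0 j) (T := T') (T' := T) (fun p hp => ?_)]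
    · rw [mem_rootsFrom] at hp
      exact if_pos (Fin.lt_def.2 (by omega))
    · rw [mem_rootsFrom] at hp
      exact if_neg (not_lt.2 (Fin.le_def.2 hp.1))
  -- A row `i < j` changes the coordinate `j` only through the root `(i, j)`.
  have h2 : (expDeg T' : Fin n → ℤ) j =
      -∑ i, ((if h : i < j then T ⟨(i, j), h⟩ else 0 : ℕ) : ℤ) := by
    rw [coe_expDeg_apply, sum_posRoot (fun p => (T' p : ℤ) * _), Fintype.sum_prod_type,
      ← Finset.sum_neg_distrib]
    refine Finset.sum_congr rfl fun i _ => ?_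
    rw [Finset.sum_eq_single_of_mem j (Finset.mem_univ j)]
    · by_cases hij : i < j
      · simp [hT', hij, hij.ne']
      · simp [hij]
    · intro l _ hl
      by_cases hil : i < l
      · by_cases hij : i < j
        · simp [hil, hij.ne', hl.symm]
        · simp [hT', hil, hij]
      · simp [hil]
  have h3 : CLambda.of K n r (pbw K T') (Set.indicator {w} 1) = 0 := by
    refine Trunc.of_eq_zero (𝒜 := kostantDeg K n) (X := compositions n r) (pbw_mem_deg T') ?_
    intro s _ hs
    refine Set.indicator_of_notMem (s := {w}) ?_ _
    rintro rfl
    have h4 : 0 ≤ (expDeg T' : Fin n → ℤ) j + s j := hs.1 j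
    rw [h2] at h4
    omega
  have h5 := Trunc.of_mul_of (𝒜 := kostantDeg K n) (compositions n r) (pbw_mem_deg (K := K) T')
    (mon K (rootsFrom n j (n - j)) T) 1 (Set.indicator {w} 1)
  rw [map_one, one_mul, ← h1] at h5
  exact h5.symm.trans ((congrArg _ h3).trans (mul_zero _))

variable (n r) in
theorem finite_compositions : (compositions n r).Finite :=
  (Set.finite_range (weight : Idx n r → _)).subset fun _ hz => exists_weight_eq hz

theorem of_pbw_eq_sum (T : PosRoot n → ℕ) (b : (Fin n → ℤ) → K) :
    CLambda.of K n r (pbw K T) b = ∑ w ∈ (finite_compositions n r).toFinset,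
      b w • CLambda.of K n r (pbw K T) (Set.indicator {w} 1) := by
  have h1 (a : Kostant K n) (b : (Fin n → ℤ) → K) :
    CLambda.of K n r a b = Trunc.ofₗ (kostantDeg K n) (compositions n r) a b := rfl
  simp only [h1]
  simp only [← map_smul]
  rw [← map_sum, ← sub_eq_zero, ← map_sub]
  refine Trunc.of_eq_zero (𝒜 := kostantDeg K n) (X := compositions n r) (pbw_mem_deg T) ?_
  intro s hs _
  rw [Pi.sub_apply, Finset.sum_apply, Finset.sum_eq_single_of_mem s
    ((finite_compositions n r).mem_toFinset.2 hs), sub_eq_zero, Pi.smul_apply,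
    Set.indicator_of_mem (s := {s}) rfl, Pi.one_apply, smul_eq_mul, mul_one]
  intro w _ hw
  rw [Pi.smul_apply, Set.indicator_of_notMem (s := {w}) (fun h => hw h.symm), smul_zero]

/-- The count matrices that index the basis of `C_n(Λ(n, r))`. -/
abbrev OrbIdx (n r : ℕ) : Type := {N : Fin n × Fin n → ℕ // Upper N ∧ ∑ p, N p = r}

/-- Either the exponents fit into the columns of `w` and suitable diagonal entries complete them to
a count matrix, or some column is too small and the element is zero. -/
theorem of_pbw_indicator_mem {T : PosRoot n → ℕ} {w : Fin n → ℤ} (hw : w ∈ compositions n r) :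
    CLambda.of K n r (pbw K T) (Set.indicator {w} 1) ∈
      Submodule.span K (Set.range fun N : OrbIdx n r => orbElt K r N.1) := by
  by_cases h : ∀ j, ∑ i, ((if h : i < j then T ⟨(i, j), h⟩ else 0 : ℕ) : ℤ) ≤ w j
  · refine Submodule.subset_span ⟨⟨mkCount T w, upper_mkCount T w, sum_eq_of_colSum_mem ?_⟩, ?_⟩
    · rwa [colSum_mkCount h]
    · change CLambda.of K n r (pbw K (upperPart (mkCount T w)))
        (Set.indicator {colSum (mkCount T w)} 1) = _
      rw [colSum_mkCount h, upperPart_mkCount]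
  · push Not at h
    obtain ⟨j, hj⟩ := h
    rw [of_pbw_indicator_eq_zero hj]
    exact zero_mem _

theorem span_orbElt :
    Submodule.span K (Set.range fun N : OrbIdx n r => orbElt K r N.1) = ⊤ := by
  rw [eq_top_iff]
  rintro c -
  refine Trunc.induction (𝒜 := kostantDeg K n) (X := compositions n r)
    (p := fun c => c ∈ Submodule.span K (Set.range fun N : OrbIdx n r => orbElt K r N.1))
    c (zero_mem _) (fun _ _ => add_mem) ?_
  intro a b
  have ha : a ∈ Submodule.span K (Set.range (pbw K)) := by
    rw [span_pbw]
    trivial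
  refine Submodule.span_induction (p := fun a _ => Trunc.ofₗ (kostantDeg K n) (compositions n r) a b
    ∈ Submodule.span K (Set.range fun N : OrbIdx n r => orbElt K r N.1)) ?_ ?_ ?_ ?_ ha
  · rintro _ ⟨T, rfl⟩
    rw [show Trunc.ofₗ (kostantDeg K n) (compositions n r) (pbw K T) b = _ from of_pbw_eq_sum T b]
    refine sum_mem fun w hw => Submodule.smul_mem _ _ (of_pbw_indicator_mem ?_)
    exact (finite_compositions n r).mem_toFinset.1 hw
  · rw [map_zero, LinearMap.zero_apply]
    exact zero_mem _
  · intro x y _ _ hx hy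
    rw [map_add, LinearMap.add_apply]
    exact add_mem hx hy
  · intro k x _ hx
    rw [map_smul, LinearMap.smul_apply]
    exact Submodule.smul_mem _ _ hx

/-- Every pair `(g, f)` lies in the support of only one matrix, and every admissible `N` is the
count matrix of some pair. -/
theorem linearIndependent_orbMat : LinearIndependent K
    (fun N : OrbIdx n r => (orbMat K N.1 : Matrix (Idx n r) (Idx n r) K)) := by
  rw [linearIndependent_iff]
  intro c hc
  ext N
  obtain ⟨g, f, hgf⟩ := exists_count_eq N.2.2
  have h := congrFun (congrFun hc g) f
  rw [Finsupp.linearCombination_apply, Finsupp.sum, Matrix.sum_apply,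
    Finset.sum_eq_single N] at h
  · rwa [Matrix.smul_apply, orbMat_apply, if_pos hgf, smul_eq_mul, mul_one] at h
  · intro N' _ hN
    rw [Matrix.smul_apply, orbMat_apply, hgf, if_neg (fun h => hN (Subtype.ext h.symm)), smul_zero]
  · intro hN
    rw [Finsupp.notMem_support_iff.1 hN, zero_smul]
    rfl

theorem weightRep_comp_orbElt : (fun N : OrbIdx n r => weightRep K n r (orbElt K r N.1)) =
    fun N : OrbIdx n r => orbMat K N.1 := funext fun N => weightRep_orbElt N.2.1

theorem injective_of_linearIndependent {V W ι : Type*} [AddCommGroup V] [Module K V]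
    [AddCommGroup W] [Module K W] (φ : V →ₗ[K] W) {v : ι → V}
    (hv : Submodule.span K (Set.range v) = ⊤) (h : LinearIndependent K (fun i => φ (v i))) :
    Function.Injective φ := by
  rw [injective_iff_map_eq_zero]
  intro x hx
  obtain ⟨c, rfl⟩ := Finsupp.mem_span_range_iff_exists_finsupp.1
    (hv.symm ▸ Submodule.mem_top : x ∈ Submodule.span K (Set.range v))
  have h1 : Finsupp.linearCombination K (fun i => φ (v i)) c = 0 := by
    rw [← hx, Finsupp.linearCombination_apply, Finsupp.sum, Finsupp.sum, map_sum]
    exact Finset.sum_congr rfl fun N _ => (map_smul φ _ _).symm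
  rw [linearIndependent_iff.1 h c h1, Finsupp.sum_zero_index]

/-- A spanning family is mapped to an independent one, so no relation is lost. -/
theorem weightRep_injective : Function.Injective (weightRep K n r) := by
  have h : LinearIndependent K
    (fun N : OrbIdx n r => (orbMat K N.1 : Matrix (Idx n r) (Idx n r) K)) := linearIndependent_orbMat
  rw [← weightRep_comp_orbElt] at h
  exact injective_of_linearIndependent (weightRep K n r).toLinearMap span_orbElt h

end WeightRep

/-! ### The image is the Borel subalgebra of the Schur algebra -/

section Range

variable {K : Type u} [Field K] {n r : ℕ}

theorem prod_eq_prod_pow_count {R : Type*} [CommMonoid R] (F : Fin n × Fin n → R) (g f : Idx n r) :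
    ∏ s, F (g s, f s) = ∏ p, F p ^ count g f p := by
  rw [← Finset.prod_fiberwise Finset.univ fun s => (g s, f s)]
  refine Finset.prod_congr rfl fun p _ => ?_
  rw [Finset.prod_congr rfl (g := fun _ => F p) fun s hs => by rw [(Finset.mem_filter.1 hs).2],
    Finset.prod_const, count]
  simp only [Prod.ext_iff]

theorem toMat_tau (x : GL (Fin n) K) (g f : Idx n r) : toMat K n r (tau K n r x) g f =
    ∏ p : Fin n × Fin n, (x : Matrix (Fin n) (Fin n) K) p.1 p.2 ^ count g f p := by
  refine (toMat_map _ g f).trans ?_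
  rw [← prod_eq_prod_pow_count fun p => (x : Matrix (Fin n) (Fin n) K) p.1 p.2]
  simp

theorem toMat_mem_range {x : Module.End K (TensorPow K n r)} (hx : x ∈ borelSchur K n r) :
    toMat K n r x ∈ (weightRep K n r).range := by
  replace hx : x ∈ Submodule.span K (tau K n r '' upperBorel K n) := hx
  induction hx using Submodule.span_induction with
  | zero => rw [map_zero]; exact zero_mem _
  | add x y _ _ hx hy => rw [map_add]; exact add_mem hx hy
  | smul k x _ hx => rw [map_smul]; exact Subalgebra.smul_mem _ hx k
  | mem x hx =>
    obtain ⟨x, hx, rfl⟩ := hx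
    -- The entry of `g^{⊗ r}` at `(g', f)` is a monomial in the entries of `g` that depends only on
    -- the count matrix `N`; for triangular `g` it vanishes unless `N` is upper triangular.
    have h : toMat K n r (tau K n r x) =
        ∑ N ∈ Finset.univ.image fun q : Idx n r × Idx n r => count q.1 q.2,
          (∏ p : Fin n × Fin n, (x : Matrix (Fin n) (Fin n) K) p.1 p.2 ^ N p) • orbMat K N := by
      ext g f
      rw [toMat_tau, Matrix.sum_apply, Finset.sum_eq_single_of_mem (count g f)
        (Finset.mem_image_of_mem (fun q : Idx n r × Idx n r => count q.1 q.2)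
          (Finset.mem_univ (g, f)))]
      · rw [Matrix.smul_apply, orbMat_apply, if_pos rfl, smul_eq_mul, mul_one]
      · intro N _ hN
        rw [Matrix.smul_apply, orbMat_apply, if_neg hN.symm, smul_zero]
    rw [h]
    refine sum_mem fun N _ => ?_
    by_cases hN : Upper N
    · refine Subalgebra.smul_mem _ ?_ _
      exact ⟨_, weightRep_orbElt hN⟩
    · unfold Upper at hN
      push Not at hN
      obtain ⟨p, hp, hp'⟩ := hN
      rw [Finset.prod_eq_zero (Finset.mem_univ p) (by rw [hx _ _ hp, zero_pow hp']), zero_smul]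
      exact zero_mem _

/-- The monomial of a count matrix, evaluated at the generic upper triangular matrix. -/
theorem prod_generic_pow (N : Fin n × Fin n → ℕ) :
    ∏ p : Fin n × Fin n, (if p.1 ≤ p.2 then (MvPolynomial.X p : MvPolynomial (Fin n × Fin n) K)
      else 0) ^ N p =
    open Classical in if Upper N then
      MvPolynomial.monomial (Finsupp.equivFunOnFinite.symm N) 1 else 0 := by
  classical
  split_ifs with h
  · rw [MvPolynomial.monomial_eq, map_one, one_mul, Finsupp.prod_fintype _ _ (by simp)]
    refine Finset.prod_congr rfl fun p _ => ?_
    by_cases hp : p.1 ≤ p.2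
    · rw [if_pos hp]
      rfl
    · have h1 : Finsupp.equivFunOnFinite.symm N p = 0 := h p (not_le.1 hp)
      rw [h p (not_le.1 hp), h1, pow_zero, pow_zero]
  · unfold Upper at h
    push Not at h
    obtain ⟨p, hp, hp'⟩ := h
    exact Finset.prod_eq_zero (Finset.mem_univ p) (by rw [if_neg (not_le.2 hp), zero_pow hp'])

theorem exists_upperBorel (x : Fin n × Fin n → K) (hx : ∀ i, x (i, i) ≠ 0) :
    ∃ g ∈ upperBorel K n, ∀ i j, (g : Matrix (Fin n) (Fin n) K) i j =
      if i ≤ j then x (i, j) else 0 := by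
  let m : Matrix (Fin n) (Fin n) K := Matrix.of fun i j => if i ≤ j then x (i, j) else 0
  have hm (i j : Fin n) (h : j < i) : m i j = 0 := if_neg (not_le.2 h)
  have hdet : m.det ≠ 0 := by
    rw [Matrix.det_of_isUpperTriangular fun i j h => hm i j h]
    refine Finset.prod_ne_zero_iff.2 fun i _ => ?_
    exact (if_pos le_rfl).trans_ne (hx i)
  exact ⟨Matrix.GeneralLinearGroup.mkOfDetNeZero m hdet, hm, fun i j => rfl⟩

/-- Otherwise a linear form `l` vanishes on the image of the Borel subalgebra but not on this
matrix. Evaluated at the tensor power of a generic upper triangular matrix, `l` gives a polynomial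
`P` whose coefficient at the monomial of `N` is the value of `l` at the matrix of `N`. As `P`
vanishes at all invertible triangular matrices and `K` is infinite, `P = 0`, a contradiction. -/
theorem orbMat_mem [Infinite K] {N : Fin n × Fin n → ℕ} (hN : Upper N) :
    (orbMat K N : Matrix (Idx n r) (Idx n r) K) ∈
      (Subalgebra.toSubmodule (borelSchur K n r)).map (toMat K n r).toLinearMap := by
  classical
  by_contra hmem
  obtain ⟨l, hl, hl'⟩ := Submodule.exists_dual_map_eq_bot_of_notMem hmem inferInstance
  have hsum (x : Matrix (Idx n r) (Idx n r) K) :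
      l x = ∑ g, ∑ f, x g f * l (Matrix.single g f 1) := by
    conv_lhs => rw [Matrix.matrix_eq_sum_single x, map_sum]
    refine Finset.sum_congr rfl fun g _ => ?_
    rw [map_sum]
    refine Finset.sum_congr rfl fun f _ => ?_
    rw [← smul_eq_mul, ← map_smul, Matrix.smul_single, smul_eq_mul, mul_one]
  let P : MvPolynomial (Fin n × Fin n) K := ∑ g : Idx n r, ∑ f : Idx n r,
    MvPolynomial.C (l (Matrix.single g f 1)) *
      ∏ p : Fin n × Fin n, (if p.1 ≤ p.2 then MvPolynomial.X p else 0) ^ count g f p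
  -- The product of the diagonal variables vanishes at the singular triangular matrices, so the
  -- polynomial vanishes at all points and not only at the invertible ones.
  have hP : (∏ i : Fin n, (MvPolynomial.X (i, i) : MvPolynomial (Fin n × Fin n) K)) * P = 0 := by
    refine MvPolynomial.funext fun x => ?_
    rw [map_mul, map_prod, map_zero]
    by_cases hx : ∀ i, x (i, i) ≠ 0
    · obtain ⟨g, hg, hgx⟩ := exists_upperBorel x hx
      have h0 : l (toMat K n r (tau K n r g)) = 0 := by
        have h1 : l (toMat K n r (tau K n r g)) ∈ ((Subalgebra.toSubmodule
          (borelSchur K n r)).map (toMat K n r).toLinearMap).map l :=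
          ⟨_, ⟨tau K n r g, Submodule.subset_span ⟨g, hg, rfl⟩, rfl⟩, rfl⟩
        rwa [hl', Submodule.mem_bot] at h1
      have h2 : MvPolynomial.eval x P = 0 := by
        rw [← h0, hsum]
        simp only [P, map_sum, map_mul, map_prod, map_pow, MvPolynomial.eval_C, toMat_tau, hgx]
        refine Finset.sum_congr rfl fun g' _ => Finset.sum_congr rfl fun f _ => ?_
        rw [mul_comm]
        congr 1
        refine Finset.prod_congr rfl fun p _ => ?_
        split_ifs
        · rw [MvPolynomial.eval_X]
        · rw [map_zero]
      rw [h2, mul_zero]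
    · push Not at hx
      obtain ⟨i, hi⟩ := hx
      rw [Finset.prod_eq_zero (Finset.mem_univ i) (by rw [MvPolynomial.eval_X, hi]), zero_mul]
  have hP' : P = 0 := (mul_eq_zero.1 hP).resolve_left
    (Finset.prod_ne_zero_iff.2 fun i _ => MvPolynomial.X_ne_zero _)
  apply hl
  -- The coefficient of `P` at the monomial of `N` collects exactly the pairs `(g, f)` with count
  -- matrix `N`.
  rw [hsum, ← MvPolynomial.coeff_zero (R := K) (Finsupp.equivFunOnFinite.symm N), ← hP']
  simp only [P]
  rw [MvPolynomial.coeff_sum]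
  refine Finset.sum_congr rfl fun g _ => ?_
  rw [MvPolynomial.coeff_sum]
  refine Finset.sum_congr rfl fun f _ => ?_
  rw [MvPolynomial.coeff_C_mul, prod_generic_pow, orbMat_apply, mul_comm]
  congr 1
  by_cases h : count g f = N
  · rw [if_pos h, h, if_pos hN, MvPolynomial.coeff_monomial, if_pos rfl]
  · rw [if_neg h]
    split_ifs
    · rw [MvPolynomial.coeff_monomial, if_neg (fun h' => h (Equiv.injective _ h'))]
    · rfl

theorem toMat_symm_range [Infinite K] :
    ((toMat K n r).symm.toAlgHom.comp (weightRep K n r)).range = borelSchur K n r := by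
  apply le_antisymm
  · rintro _ ⟨c, rfl⟩
    have hc : c ∈ Submodule.span K (Set.range fun N : OrbIdx n r => orbElt K r N.1) := by
      rw [span_orbElt]
      trivial
    change (toMat K n r).symm (weightRep K n r c) ∈ borelSchur K n r
    induction hc using Submodule.span_induction with
    | zero => rw [map_zero, map_zero]; exact zero_mem _
    | add x y _ _ hx hy => rw [map_add, map_add]; exact add_mem hx hy
    | smul k x _ hx => rw [map_smul, map_smul]; exact Subalgebra.smul_mem _ hx k
    | mem x hx =>
      obtain ⟨N, rfl⟩ := hx
      obtain ⟨y, hy, hy'⟩ := orbMat_mem (K := K) (r := r) N.2.1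
      rw [weightRep_orbElt N.2.1, ← hy']
      exact ((toMat K n r).symm_apply_apply y).symm ▸ hy
  · intro x hx
    obtain ⟨c, hc⟩ := toMat_mem_range hx
    refine ⟨c, ?_⟩
    change (toMat K n r).symm (weightRep K n r c) = x
    rw [AlgEquiv.symm_apply_eq]
    exact hc

variable (K n r) in
/-- The isomorphism of `C_n(Λ(n, r))` with the Borel subalgebra of the Schur algebra. -/
def schurEquiv [Infinite K] : CLambda K n r ≃ₐ[K] borelSchur K n r :=
  (AlgEquiv.ofInjective ((toMat K n r).symm.toAlgHom.comp (weightRep K n r))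
    ((toMat K n r).symm.injective.comp weightRep_injective)).trans
    (Subalgebra.equivOfEq _ _ toMat_symm_range)

theorem schurEquiv_coe [Infinite K] (c : CLambda K n r) :
    (schurEquiv K n r c : Module.End K (TensorPow K n r)) =
      (toMat K n r).symm (weightRep K n r c) := rfl

theorem toMat_schurEquiv [Infinite K] (c : CLambda K n r) :
    toMat K n r (schurEquiv K n r c : Module.End K (TensorPow K n r)) = weightRep K n r c := by
  rw [schurEquiv_coe, AlgEquiv.apply_symm_apply]

theorem schurEquiv_divPow [Infinite K] (q : PosRoot n × ℕ) :
    (schurEquiv K n r (CLambda.of K n r (divPowK K q) 1) : Module.End K (TensorPow K n r)) =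
      rho K r q := by
  apply (toMat K n r).injective
  rw [toMat_schurEquiv, toMat_rho]
  ext g f
  rw [weightRep_of, kostantRep_divPowK, Pi.one_apply, mul_one]

theorem schurEquiv_fun [Infinite K] (b : (Fin n → ℤ) → K) (f : Fin r → Fin n) :
    (schurEquiv K n r (CLambda.of K n r 1 b) : Module.End K (TensorPow K n r)) (basisVec K f) =
      b (weight f) • basisVec K f := by
  apply (tensorBasis K n r).repr.injective
  ext g
  rw [← toMat_apply, toMat_schurEquiv, weightRep_of, map_one, map_smul, Finsupp.smul_apply,
    ← tensorBasis_apply, Module.Basis.repr_self, Matrix.one_apply, Finsupp.single_apply,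
    smul_eq_mul, mul_comm]
  simp only [eq_comm]

end Range

end KostantSchur

end

noncomputable section

namespace KostantSchur

/-! ### Transport of resolutions along a ring isomorphism -/

section RestrictScalars

variable {R C : Type u} [Ring R] [Ring C] (e : R ≃+* C)

theorem projective_restrictScalars (M : ModuleCat.{u} C) [Module.Projective C M] :
    Module.Projective R ((ModuleCat.restrictScalars (e : R →+* C)).obj M) := by
  have := RingHomInvPair.of_ringEquiv e
  have := RingHomInvPair.of_ringEquiv_symm e
  let l : M ≃ₛₗ[(e.symm : C →+* R)] (ModuleCat.restrictScalars (e : R →+* C)).obj M :=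
    { toFun := fun m => m
      invFun := fun m => m
      left_inv := fun _ => rfl
      right_inv := fun _ => rfl
      map_add' := fun _ _ => rfl
      map_smul' := fun c m => by
        change c • m = e (e.symm c) • m
        rw [e.apply_symm_apply] }
  exact Module.Projective.of_equiv l

theorem range_restrictScalars_le {M N : ModuleCat.{u} C} {f : M ⟶ N}
    (hf : LinearMap.range f.hom ≤ Ring.jacobson C • (⊤ : Submodule C N)) :
    LinearMap.range ((ModuleCat.restrictScalars (e : R →+* C)).map f).hom ≤
      Ring.jacobson R •
        (⊤ : Submodule R ((ModuleCat.restrictScalars (e : R →+* C)).obj N)) := by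
  rintro _ ⟨m, rfl⟩
  have h : f.hom m ∈ Ring.jacobson C • (⊤ : Submodule C N) := hf ⟨m, rfl⟩
  change f.hom m ∈ _
  refine Submodule.smul_induction_on h ?_ fun x y hx hy => add_mem hx hy
  intro c hc y _
  have h1 : e.symm c ∈ Ring.jacobson R := by
    have : RingHomSurjective (e.symm : C →+* R) := ⟨e.symm.surjective⟩
    exact Ring.le_comap_jacobson (e.symm : C →+* R) hc
  rw [← e.apply_symm_apply c]
  exact Submodule.smul_mem_smul
    (N := (⊤ : Submodule R ((ModuleCat.restrictScalars (e : R →+* C)).obj N))) h1 trivial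

theorem isProjRes_restrictScalars {K : Type u} [Field K] {Γ : Type} [AddMonoid Γ]
    [DecidableEq Γ] [Algebra K C] {𝒞 : Γ → Submodule K C} {P : ℕ → GrMod 𝒞}
    {d : ∀ i, P (i + 1) ⟶ P i} {M : GrMod 𝒞} {ε : P 0 ⟶ M} (h : GrMod.IsProjRes P d ε)
    {N : ModuleCat.{u} R}
    (θ : (GrMod.forgetGrading 𝒞 ⋙ ModuleCat.restrictScalars (e : R →+* C)).obj M ≅ N) :
    IsProjRes (fun i => (GrMod.forgetGrading 𝒞 ⋙ ModuleCat.restrictScalars (e : R →+* C)).obj (P i))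
      (fun i => (GrMod.forgetGrading 𝒞 ⋙ ModuleCat.restrictScalars (e : R →+* C)).map (d i))
      ((GrMod.forgetGrading 𝒞 ⋙ ModuleCat.restrictScalars (e : R →+* C)).map ε ≫ θ.hom) where
  projective i := by
    have : Module.Projective C ((GrMod.forgetGrading 𝒞).obj (P i)) := (h.projective i).projective
    exact projective_restrictScalars e _
  exact i := h.exact i
  exact_zero x := by
    refine Iff.trans ?_ (h.exact_zero x)
    exact θ.toLinearEquiv.map_eq_zero_iff (x := ε.lin x)
  surjective := θ.toLinearEquiv.surjective.comp h.surjective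

end RestrictScalars

/-! ### Weights, one-dimensional modules and finite dimension -/

section Weight

variable {K : Type u} [Field K] {n r : ℕ}

theorem diagCoeff_eq (f : Idx n r) (x : Module.End K (TensorPow K n r)) :
    diagCoeff K f x = toMat K n r x f f := by
  rw [toMat_apply]
  suffices h : ∀ y, PiTensorProduct.lift ((MultilinearMap.mkPiAlgebra K (Fin r) K).compLinearMap
      fun s => LinearMap.proj (f s)) y = (tensorBasis K n r).repr y f from h _
  intro y
  induction y using PiTensorProduct.induction_on with
  | smul_tprod k v =>
    rw [map_smul, map_smul, PiTensorProduct.lift.tprod, Finsupp.smul_apply, tensorBasis,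
      Basis.piTensorProduct_repr_tprod_apply]
    simp
  | add x y hx hy => rw [map_add, map_add, hx, hy, Finsupp.add_apply]

/-- Elements of nonzero degree change the weight, so their diagonal entries vanish; elements of
degree `0` are scalars. -/
theorem kostantRep_diag (a : Kostant K n) (f : Idx n r) :
    kostantRep K n r a f f = counitK K n a := by
  have ha : a ∈ ⨆ γ, kostantDeg K n γ := by rw [iSup_deg]; trivial
  induction ha using Submodule.iSup_induction' with
  | zero => rw [map_zero, map_zero]; rfl
  | add x y _ _ hx hy => rw [map_add, map_add, Matrix.add_apply, hx, hy]
  | mem γ a ha =>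
    by_cases hγ : γ = 0
    · subst hγ
      obtain ⟨k, rfl⟩ := Submodule.mem_span_singleton.1 (kostantDeg_zero_le ha)
      rw [map_smul, map_smul, map_one, map_one, Matrix.smul_apply, Matrix.one_apply_eq]
    · rw [counitK_eq_zero K hγ ha]
      by_contra h
      have h1 : weight f = (γ : Fin n → ℤ) + weight f := weight_eq_of_kostantRep_ne_zero ha h
      exact hγ (Subtype.ext (right_eq_add.1 h1))

theorem weightChar_schurEquiv [Infinite K] (z : compositions n r) (a : Kostant K n)
    (b : (Fin n → ℤ) → K) :
    weightChar K z (schurEquiv K n r (CLambda.of K n r a b)) = counitK K n a * b z := by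
  have h : weight (exists_weight_eq z.2).choose = z.1 := (exists_weight_eq z.2).choose_spec
  refine (diagCoeff_eq (exists_weight_eq z.2).choose _).trans ?_
  refine (congrFun (congrFun (toMat_schurEquiv _) _) _).trans ?_
  refine (weightRep_of _ _ _ _).trans ?_
  rw [kostantRep_diag, h]

theorem sum_coe_Psi (γ : Psi n) : ∑ i, (γ : Fin n → ℤ) i = 0 := by
  obtain ⟨γ, hγ⟩ := γ
  change ∑ i, γ i = 0
  refine AddSubmonoid.closure_induction (motive := fun γ _ => ∑ i, γ i = 0) ?_ ?_ ?_ hγ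
  · rintro _ ⟨i, j, -, rfl⟩
    simp
  · simp
  · intro x y _ _ hx hy
    simp only [Pi.add_apply, Finset.sum_add_distrib, hx, hy, add_zero]

/-- Elements of `Ψ_n` have coordinate sum `0`, so `γ + z` always has the sum `r` and only the signs
of its coordinates matter. -/
theorem outside_compositions (z : compositions n r) :
    outside (compositions n r) (z : Fin n → ℤ) = negFrom (z : Fin n → ℤ) 0 := by
  ext γ
  change ¬ ((γ : Fin n → ℤ) + z.1 ∈ compositions n r) ↔
    ∃ j : Fin n, 0 ≤ (j : ℕ) ∧ ((γ : Fin n → ℤ) + z.1) j < 0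
  rw [← not_iff_not, not_not]
  push Not
  constructor
  · rintro ⟨h, -⟩ j -
    exact h j
  · intro h
    refine ⟨fun j => h j (Nat.zero_le _), ?_⟩
    simp only [Pi.add_apply, Finset.sum_add_distrib]
    rw [sum_coe_Psi, z.2.2, zero_add]

theorem trivialDeg_eq_bot_of_mem_outside (z : compositions n r) :
    ∀ γ ∈ outside (compositions n r) (z : Fin n → ℤ), (trivialMod K n).deg γ = ⊥ := by
  intro γ hγ
  refine if_neg ?_
  rintro rfl
  exact hγ (by rw [zero_vadd]; exact z.2)

theorem isSimpleModule_weightModule (z : compositions n r) :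
    IsSimpleModule (borelSchur K n r) (WeightModule K z) := by
  have h : RingHomSurjective (weightChar K z).toRingHom :=
    ⟨fun k => ⟨algebraMap K _ k, (weightChar K z).commutes k⟩⟩
  let l : WeightModule K z →ₛₗ[(weightChar K z).toRingHom] K :=
    { toFun := fun v => v
      map_add' := fun _ _ => rfl
      map_smul' := fun _ _ => rfl }
  exact (LinearMap.isSimpleModule_iff_of_bijective l Function.bijective_id).2 inferInstance

theorem finite_cLambda : Module.Finite K (CLambda K n r) :=
  FiniteDimensional.of_injective (weightRep K n r).toLinearMap weightRep_injective

theorem finiteDimensional_schurF (Φ : CLambda K n r ≃ₐ[K] borelSchur K n r) (z : compositions n r)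
    (M : GrMod (kostantDeg K n)) (hM : Module.Finite (Kostant K n) M) :
    FiniteDimensional K ((ModuleCat.restrictScalars (algebraMap K (borelSchur K n r))).obj
      ((schurF Φ z).obj M)) := by
  have h1 : Module.Finite (CLambda K n r) ((gradedF K z).obj M) :=
    truncFunctor_finite (compositions n r) (z : Fin n → ℤ)
  have h2 : Module.Finite K (CLambda K n r) := finite_cLambda
  have h3 : Module.Finite K ((gradedF K z).obj M) := Module.Finite.trans (CLambda K n r) _
  let l : (gradedF K z).obj M →ₗ[K]
      (ModuleCat.restrictScalars (algebraMap K (borelSchur K n r))).obj ((schurF Φ z).obj M) :=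
    { toFun := fun t => t
      map_add' := fun _ _ => rfl
      map_smul' := fun k t => by
        change k • t = Φ.symm (algebraMap K _ k) • t
        rw [AlgEquiv.commutes, algebraMap_smul] }
  exact Module.Finite.of_surjective l fun t => ⟨t, rfl⟩

end Weight

/-! ### The image of the trivial module and of its resolutions -/

section Resolutions

variable {K : Type u} [Field K] {n r : ℕ}

theorem gradedF_isProjRes (z : compositions n r) {P : ℕ → GrMod (kostantDeg K n)}
    {d : ∀ i, P (i + 1) ⟶ P i} {ε : P 0 ⟶ trivialMod K n} (h : GrMod.IsProjRes P d ε) :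
    GrMod.IsProjRes (fun i => (gradedF K z).obj (P i)) (fun i => (gradedF K z).map (d i))
      ((gradedF K z).map ε) := by
  refine GrMod.IsProjRes.truncFunctor (compositions n r) (z : Fin n → ℤ) h ?_
    (trivialDeg_eq_bot_of_mem_outside z)
  rw [outside_compositions]
  exact fun i y hy => h.exists_sub_mem_spanDeg z.2.1 hy

variable [Infinite K]

/-- The module `K_z`, as a module over `C_n(Λ(n, r))`. -/
@[reducible] def cLambdaModule (z : compositions n r) : Module (CLambda K n r) K :=
  Module.compHom K ((weightChar K z).comp (schurEquiv K n r).toAlgHom).toRingHom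

variable (K n) in
/-- The identification of the trivial module with the ground field. -/
def trivialCoord : trivialMod K n →ₗ[K] K where
  toFun m := m
  map_add' _ _ := rfl
  map_smul' _ _ := rfl

theorem trivialCoord_smul (a : Kostant K n) (m : trivialMod K n) :
    trivialCoord K n (a • m) = counitK K n a * trivialCoord K n m := rfl

/-- The map from the image of the trivial module to the simple module of weight `z`. -/
def trivialLift (z : compositions n r) :
    letI := cLambdaModule (K := K) z
    (gradedF K z).obj (trivialMod K n) →ₗ[CLambda K n r] K :=
  letI := cLambdaModule (K := K) z
  truncLift (𝒜 := kostantDeg K n) (X := compositions n r) (x := (z : Fin n → ℤ))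
    (M := trivialMod K n) (trivialCoord K n) (by
      intro γ m hm a b
      by_cases hγ : γ = 0
      · subst hγ
        rw [zero_vadd, map_smul, trivialCoord_smul]
        change b z * (counitK K n a * trivialCoord K n m) =
          weightChar K z (schurEquiv K n r (CLambda.of K n r a b)) * trivialCoord K n m
        rw [weightChar_schurEquiv]
        ring
      · have hm0 : m = 0 := (Submodule.mem_bot K).1 (by rwa [show (trivialMod K n).deg γ = ⊥ from
          if_neg hγ] at hm)
        rw [hm0, smul_zero, smul_zero, map_zero]
        exact (smul_zero _).symm)

theorem trivialLift_toTrunc (z : compositions n r) (m : trivialMod K n) :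
    trivialLift z (toTrunc (compositions n r) (z : Fin n → ℤ) (trivialMod K n) m) =
      trivialCoord K n m :=
  letI := cLambdaModule (K := K) z
  truncLift_toTrunc (𝒜 := kostantDeg K n) _ _ _ _ m

/-- The map `toTrunc` is surjective and `trivialLift` is a left inverse of it, so both are
bijective. In particular the image of the trivial module does not collapse to zero. -/
theorem trivialLift_bijective (z : compositions n r) :
    Function.Bijective (trivialLift (K := K) z) := by
  have h : Function.LeftInverse (trivialLift (K := K) z)
    (toTrunc (compositions n r) (z : Fin n → ℤ) (trivialMod K n)) := trivialLift_toTrunc z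
  exact ⟨(h.rightInverse_of_surjective (toTrunc_surjective _ _ _)).injective, h.surjective⟩

/-- The isomorphism of the image of the trivial module with the simple module of weight `z`. -/
def schurTrivial (z : compositions n r) : (schurF (schurEquiv K n r) z).obj (trivialMod K n) ≅
    ModuleCat.of (borelSchur K n r) (WeightModule K z) :=
  let l : (schurF (schurEquiv K n r) z).obj (trivialMod K n) →ₗ[borelSchur K n r]
      WeightModule K z :=
    letI := cLambdaModule (K := K) z
    { toFun := trivialLift z
      map_add' := (trivialLift z).map_add
      map_smul' := fun s t => by
        refine ((trivialLift z).map_smul ((schurEquiv K n r).symm s) t).trans ?_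
        exact congrArg (fun s' => weightChar K z s' * (trivialLift z t : K))
          ((schurEquiv K n r).apply_symm_apply s) }
  (LinearEquiv.ofBijective l (trivialLift_bijective (K := K) z)).toModuleIso

theorem schurF_isProjRes (z : compositions n r) {P : ℕ → GrMod (kostantDeg K n)}
    {d : ∀ i, P (i + 1) ⟶ P i} {ε : P 0 ⟶ trivialMod K n} (h : GrMod.IsProjRes P d ε)
    (θ : (schurF (schurEquiv K n r) z).obj (trivialMod K n) ≅
      ModuleCat.of (borelSchur K n r) (WeightModule K z)) :
    IsProjRes (fun i => (schurF (schurEquiv K n r) z).obj (P i))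
      (fun i => (schurF (schurEquiv K n r) z).map (d i))
      ((schurF (schurEquiv K n r) z).map ε ≫ θ.hom) :=
  isProjRes_restrictScalars (schurEquiv K n r).symm.toRingEquiv (gradedF_isProjRes z h) θ

theorem gradedF_isMinimalProjRes (z : compositions n r) {P : ℕ → GrMod (kostantDeg K n)}
    {d : ∀ i, P (i + 1) ⟶ P i} {ε : P 0 ⟶ trivialMod K n} (h : GrMod.IsMinimalProjRes P d ε) :
    GrMod.IsMinimalProjRes (fun i => (gradedF K z).obj (P i)) (fun i => (gradedF K z).map (d i))
      ((gradedF K z).map ε) where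
  toIsProjRes := gradedF_isProjRes z h.toIsProjRes
  minimal i := range_truncFunctor_map_le (compositions n r) (z : Fin n → ℤ)
    (fun _ ha => of_mem_gradedRadical ha) (h.minimal i)

/-- Over `C_n(Λ(n, r))` the images of the differentials lie in the multiples by the Jacobson
radical, by `of_mem_jacobson`, and a ring isomorphism carries one Jacobson radical to the other. -/
theorem schurF_isMinimalProjRes (z : compositions n r) {P : ℕ → GrMod (kostantDeg K n)}
    {d : ∀ i, P (i + 1) ⟶ P i} {ε : P 0 ⟶ trivialMod K n} (h : GrMod.IsMinimalProjRes P d ε)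
    (θ : (schurF (schurEquiv K n r) z).obj (trivialMod K n) ≅
      ModuleCat.of (borelSchur K n r) (WeightModule K z)) :
    IsMinimalProjRes (fun i => (schurF (schurEquiv K n r) z).obj (P i))
      (fun i => (schurF (schurEquiv K n r) z).map (d i))
      ((schurF (schurEquiv K n r) z).map ε ≫ θ.hom) where
  toIsProjRes := schurF_isProjRes z h.toIsProjRes θ
  minimal i := range_restrictScalars_le (schurEquiv K n r).symm.toRingEquiv
    (f := (GrMod.forgetGrading (cLambdaDeg K n r)).map ((gradedF K z).map (d i)))
    (range_truncFunctor_map_le (compositions n r) (z : Fin n → ℤ)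
      (fun _ ha => of_mem_jacobson ha) (h.minimal i))

end Resolutions

end KostantSchur

end

theorem mainTheorem1 {K : Type u} [Field K] [Infinite K] (n r : ℕ) :
    ∃ Φ : CLambda K n r ≃ₐ[K] borelSchur K n r,
      (∀ q : PosRoot n × ℕ,
        (Φ (CLambda.of K n r (divPowK K q) 1) : Module.End K (TensorPow K n r)) = rho K r q) ∧
      (∀ (b : (Fin n → ℤ) → K) (f : Fin r → Fin n),
        (Φ (CLambda.of K n r 1 b) : Module.End K (TensorPow K n r)) (basisVec K f) =
          b (weight f) • basisVec K f) ∧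
      ∀ z : compositions n r,
        IsSimpleModule (borelSchur K n r) (WeightModule K z) ∧
        (∀ M : GrMod (kostantDeg K n), Module.Finite (Kostant K n) M →
          FiniteDimensional K
            ((ModuleCat.restrictScalars (algebraMap K (borelSchur K n r))).obj
              ((schurF Φ z).obj M))) ∧
        ∃ θ : (schurF Φ z).obj (trivialMod K n) ≅
            ModuleCat.of (borelSchur K n r) (WeightModule K z),
          ∀ (P : ℕ → GrMod (kostantDeg K n)) (d : ∀ i, P (i + 1) ⟶ P i)
            (ε : P 0 ⟶ trivialMod K n),
            (GrMod.IsProjRes P d ε →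
              GrMod.IsProjRes (fun i => (gradedF K z).obj (P i))
                (fun i => (gradedF K z).map (d i)) ((gradedF K z).map ε) ∧
              IsProjRes (fun i => (schurF Φ z).obj (P i))
                (fun i => (schurF Φ z).map (d i)) ((schurF Φ z).map ε ≫ θ.hom)) ∧
            (GrMod.IsMinimalProjRes P d ε →
              GrMod.IsMinimalProjRes (fun i => (gradedF K z).obj (P i))
                (fun i => (gradedF K z).map (d i)) ((gradedF K z).map ε) ∧
              IsMinimalProjRes (fun i => (schurF Φ z).obj (P i))
                (fun i => (schurF Φ z).map (d i)) ((schurF Φ z).map ε ≫ θ.hom)) := by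
  refine ⟨schurEquiv K n r, schurEquiv_divPow, schurEquiv_fun, fun z =>
    ⟨isSimpleModule_weightModule z, finiteDimensional_schurF (schurEquiv K n r) z,
      schurTrivial z, fun P d ε => ⟨fun h => ⟨gradedF_isProjRes z h, schurF_isProjRes z h _⟩,
      fun h => ⟨gradedF_isMinimalProjRes z h, schurF_isMinimalProjRes z h _⟩⟩⟩⟩
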